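/- A multicategory $\mathbb C$ has a collection of objects, sets $\mathbb C_n(a_1,\dots,a_n;b)$ of $n$-ary multimaps ($n\ge 0$), identities $1_a\in\mathbb C_1(a;a)$ and substitutions $g\circ_i f$ of one multimap into the $i$-th variable of another, subject to the usual associativity, commutativity and identity laws. A multifunctor is a map of objects and multimaps preserving identities and all $\circ_i$. A short multicategory consists of a category $\mathcal C$, functors $\mathbb C_n(-;-)\colon(\mathcal C^n)^{op}\times\mathcal C\to\mathrm{Set}$ for $0\le n\le 4$ with $\mathbb C_1=\mathcal C(-,-)$, and substitutions $\circ_i\colon \mathbb C_n(\overline b;c)\times\mathbb C_m(\overline a;b_i)\to\mathbb C_{n+m-1}(\overline b_{<i},\overline a,\overline b_{>i};c)$ for $(n,m)\in\{(2,2),(3,2),(2,3),(2,0),(3,0)\}$, natural in $\overline a$, $b_j$ $(j\neq i)$ and $c$ and dinatural in $b_i$. For $f$ binary, $g$ $n$-ary and $h$ $p$-ary they satisfy $f\circ_i(g\circ_j h)=(f\circ_i g)\circ_{i+j-1}h$ when $n=2$, $p\in\{0,2\}$, and $(f\circ_1 g)\circ_{n+1}h=(f\circ_2 h)\circ_1 g$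 when $n,p\in\{0,2\}$. A morphism is a functor with natural families of maps on $n$-ary multimaps $(0\le n\le 4$, the functor itself for $n=1)$ commuting with all $\circ_i$. The forgetful functor from multicategories to short multicategories discards the multimaps of arity greater than $4$. A multicategory is left representable if every list $\overline a$ of objects admits a multimap $\theta_{\overline a}\colon\overline a\to m\overline a$ such that $-\circ_1\theta_{\overline a}\colon\mathbb C_{1+r}(m\overline a,\overline x;d)\to\mathbb C_{n+r}(\overline a,\overline x;d)$ is bijective for all $\overline x$ (of any length $r\geq 0$) and $d$; a short multicategory is left representable if this holds for the empty list (with $u\colon()\to i$) and for all lists $a,b$ (with $\theta_{a,b}\colon a,b\to ab$), with $\overline x$ of length at most $2$. A (short) multicategory is closed if for all objects $b,c$ there are an object $[b,c]$ and a binary map $e\colon[b,c],b\to c$ such that $e\circ_1-\colon\mathbb C_n(\overline x;[b,c])\to\mathbb C_{n+1}(\overline x,b;c)$ is bijective for all $\overline x$ (in the short case, all $\overline x$ of length $n\le 3$). Write $\mathrm{Mult}_{lr}^{cl}$, $\mathrm{ShMult}_{lr}$, $\mathrm{ShMult}_{lr}^{cl}$ for the full subcategories of left representable (closed) objects. A (left)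 skew monoidal category is a category with a functor $\otimes$, an object $i$ and natural families, not required to be invertible, $\alpha\colon(ab)c\to a(bc)$, $\lambda\colon ia\to a$, $\rho\colon a\to ai$ satisfying Szlachányi's five axioms. It is left normal if $\lambda$ is invertible, and closed if every $-\otimes b$ has a right adjoint. Let $\mathrm{SkMon}_{ln}$ and $\mathrm{SkMon}_{ln}^{cl}$ be the categories of left normal (closed) skew monoidal categories and lax monoidal functors. For a left representable short multicategory $\mathbb C$ let $K\mathbb C$ be the following left normal skew monoidal category. Its underlying category is that of $\mathbb C$, the tensor product of $a$ and $b$ is $ab$, the unit is $i$, and the structure maps are determined by $(f\otimes g)\circ\theta=(\theta\circ_1 f)\circ_2 g$, $(\alpha\circ\theta_{ab,c})\circ_1\theta_{a,b}=\theta_{a,bc}\circ_2\theta_{b,c}$, $(\lambda_a\circ\theta_{i,a})\circ_1u=1_a$ and $\rho_a=\theta_{a,i}\circ_2u$. For a morphism $F$ let $KF$ be the functor underlying $F$ with the lax structure determined by $f_0\circ u=Fu$, $f_2\circ\theta=F\theta$. Let $T_{lr}^{cl}\colon\mathrm{Mult}_{lr}^{cl}\to\mathrm{SkMon}_{ln}^{cl}$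 be given by the same formulas in a left representable closed multicategory. Theorem. The functor $K\colon\mathrm{ShMult}_{lr}\to\mathrm{SkMon}_{ln}$ is an equivalence and restricts to an equivalence $K_{lr}^{cl}\colon\mathrm{ShMult}_{lr}^{cl}\to\mathrm{SkMon}_{ln}^{cl}$. The functor $T_{lr}^{cl}$ and the forgetful functor $U_{lr}^{cl}\colon\mathrm{Mult}_{lr}^{cl}\to\mathrm{ShMult}_{lr}^{cl}$ are also equivalences, and the triangle commutes up to the choice of classifiers: there is a natural isomorphism $K_{lr}^{cl}U_{lr}^{cl}\cong T_{lr}^{cl}$ whose components are the identity on underlying categories. -/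

import Mathlib

set_option linter.checkUnivs false

open CategoryTheory

universe v u

namespace ShortMult

/-! ### Multicategories

Lists of objects are the domains of multimaps.  The substitution `g ∘ᵢ f` of `f` into `g` at the
position marked by a decomposition `L = Γ₁ ++ b :: Γ₂` of the domain `L` of `g` (so
`i = Γ₁.length + 1`) has domain `Γ₁ ++ Δ ++ Γ₂`.  Both decompositions enter as equations, so that
the laws can be written without transports. -/

/-- A multicategory, with single-position substitutions. -/
structure Multicategory where
  Obj : Type u
  Hom : List Obj → Obj → Type v
  id : ∀ a : Obj, Hom [a] a
  /-- `sub Γ₁ Γ₂ _ _ g f` is `g ∘ᵢ f` with `i = Γ₁.length + 1`. -/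
  sub : ∀ {L Δ L' : List Obj} {b c : Obj} (Γ₁ Γ₂ : List Obj),
    L = Γ₁ ++ b :: Γ₂ → L' = Γ₁ ++ Δ ++ Γ₂ → Hom L c → Hom Δ b → Hom L' c
  id_sub : ∀ {Δ : List Obj} {b : Obj} (f : Hom Δ b),
    sub [] [] rfl (by simp) (id b) f = f
  sub_id : ∀ {L : List Obj} {b c : Obj} (Γ₁ Γ₂ : List Obj) (eL : L = Γ₁ ++ b :: Γ₂) (g : Hom L c),
    sub Γ₁ Γ₂ eL (by simp [eL]) g (id b) = g
  /-- `h ∘ᵢ (g ∘ⱼ f) = (h ∘ᵢ g) ∘ f`, the last substitution being at position `j + i - 1`. -/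
  sub_assoc : ∀ {L M E M' L' K : List Obj} {b c d : Obj} (Γ₁ Γ₂ Δ₁ Δ₂ : List Obj)
    (eL : L = Γ₁ ++ c :: Γ₂) (eM : M = Δ₁ ++ b :: Δ₂) (eM' : M' = Δ₁ ++ E ++ Δ₂)
    (eL' : L' = Γ₁ ++ M ++ Γ₂) (eK : K = Γ₁ ++ M' ++ Γ₂)
    (h : Hom L d) (g : Hom M c) (f : Hom E b),
    sub Γ₁ Γ₂ eL eK h (sub Δ₁ Δ₂ eM eM' g f) =
      sub (Γ₁ ++ Δ₁) (Δ₂ ++ Γ₂) (by simp [eL', eM]) (by simp [eK, eM'])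
        (sub Γ₁ Γ₂ eL eL' h g) f
  /-- Substitutions at two different positions commute. -/
  sub_comm : ∀ {L M E L₁ L₂ K : List Obj} {b c d : Obj} (Γ₁ Γ₂ Γ₃ : List Obj)
    (eL : L = Γ₁ ++ b :: (Γ₂ ++ c :: Γ₃)) (eL₁ : L₁ = Γ₁ ++ M ++ (Γ₂ ++ c :: Γ₃))
    (eL₂ : L₂ = Γ₁ ++ b :: (Γ₂ ++ E ++ Γ₃)) (eK : K = Γ₁ ++ M ++ Γ₂ ++ E ++ Γ₃)
    (h : Hom L d) (g : Hom M b) (f : Hom E c),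
    sub (Γ₁ ++ M ++ Γ₂) Γ₃ (by simp [eL₁]) eK (sub Γ₁ (Γ₂ ++ c :: Γ₃) eL eL₁ h g) f =
      sub Γ₁ (Γ₂ ++ E ++ Γ₃) eL₂ (by simp [eK])
        (sub (Γ₁ ++ b :: Γ₂) Γ₃ (by simp [eL]) (by simp [eL₂]) h f) g

/-- A multifunctor.  The component at the list `L` is written with an arbitrary list `L'` equal to
the image of `L`. -/
@[ext]
structure Multifunctor (C D : Multicategory.{v, u}) where
  obj : C.Obj → D.Obj
  map : ∀ {L : List C.Obj} {L' : List D.Obj} {b : C.Obj}, L' = L.map obj →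
    C.Hom L b → D.Hom L' (obj b)
  map_id : ∀ a : C.Obj, map (L := [a]) (L' := [obj a]) rfl (C.id a) = D.id (obj a)
  map_sub : ∀ {L Δ L' : List C.Obj} {M Θ M' : List D.Obj} {b c : C.Obj} (Γ₁ Γ₂ : List C.Obj)
    (eL : L = Γ₁ ++ b :: Γ₂) (eL' : L' = Γ₁ ++ Δ ++ Γ₂)
    (eM : M = L.map obj) (eΘ : Θ = Δ.map obj) (eM' : M' = L'.map obj)
    (g : C.Hom L c) (f : C.Hom Δ b),
    map eM' (C.sub Γ₁ Γ₂ eL eL' g f) =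
      D.sub (Γ₁.map obj) (Γ₂.map obj) (by simp [eM, eL]) (by simp [eM', eL', eΘ])
        (map eM g) (map eΘ f)

namespace Multifunctor

/-- The identity multifunctor. -/
def idm (C : Multicategory.{v, u}) : Multifunctor C C where
  obj a := a
  map e g := cast (by rw [e, List.map_id']) g
  map_id _ := rfl
  map_sub Γ₁ Γ₂ eL eL' eM eΘ eM' g f := by
    simp only [List.map_id'] at eM eΘ eM'
    subst eM eΘ eM'
    simp

/-- Composition of multifunctors. -/
def comp {C D E : Multicategory.{v, u}} (F : Multifunctor C D) (G : Multifunctor D E) :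
    Multifunctor C E where
  obj a := G.obj (F.obj a)
  map {L _ _} e g := G.map (L := L.map F.obj) (by simp [e]) (F.map rfl g)
  map_id a := (congrArg (G.map rfl) (F.map_id a)).trans (G.map_id _)
  map_sub Γ₁ Γ₂ eL eL' eM eΘ eM' g f := by
    rw [F.map_sub Γ₁ Γ₂ eL eL' rfl rfl rfl,
      G.map_sub (Γ₁.map F.obj) (Γ₂.map F.obj) _ _ (eM.trans List.map_map.symm)
        (eΘ.trans List.map_map.symm) (eM'.trans List.map_map.symm)]
    simp only [List.map_map]
    rfl

lemma map_cast {C D : Multicategory.{v, u}} (F : Multifunctor C D) {L M : List C.Obj}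
    {L' : List D.Obj} {b : C.Obj} (e : L = M) (e' : L' = M.map F.obj)
    (h : C.Hom L b = C.Hom M b) (g : C.Hom L b) :
    F.map e' (cast h g) = F.map (e'.trans (by rw [e])) g := by
  subst e
  rfl

lemma map_map_congr {C D E : Multicategory.{v, u}} (H : Multifunctor D E) (G : Multifunctor C D)
    {L : List C.Obj} {M M' : List D.Obj} {N : List E.Obj} {b : C.Obj} (g : C.Hom L b)
    (e : M = L.map G.obj) (e' : M' = L.map G.obj) (k : N = M.map H.obj) (k' : N = M'.map H.obj) :
    H.map k (G.map e g) = H.map k' (G.map e' g) := by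
  subst e e'
  rfl

end Multifunctor

/-- The category of multicategories and multifunctors. -/
instance : Category Multicategory.{v, u} where
  Hom := Multifunctor
  id := Multifunctor.idm
  comp := Multifunctor.comp
  id_comp F := by
    refine Multifunctor.ext rfl (heq_of_eq ?_)
    funext L L' b e g
    exact F.map_cast (List.map_id' L).symm _ _ _
  comp_id F := by
    refine Multifunctor.ext rfl (heq_of_eq ?_)
    funext L L' b e g
    subst e
    rfl
  assoc F G H := by
    refine Multifunctor.ext rfl (heq_of_eq ?_)
    funext L L' b e g
    exact H.map_map_congr G _ _ _ _ _

/-! ### Short multicategories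

The same format, with maps of arity at most four.  The unary maps are the morphisms of the
underlying category; substitution of a unary map, or into a unary map, is the functorial action of
unary maps on `n`-ary maps.  Hence those laws below in which one of the multimaps is unary say that
the `n`-ary maps form a functor `(Cⁿ)ᵒᵖ × C ⥤ Type`, and that the substitutions of the multimaps
of arity different from one are natural and dinatural. -/

/-- The pairs `(n, m)` for which an `m`-ary map can be substituted into an `n`-ary map of a short
multicategory. -/
def SubOK (n m : ℕ) : Prop :=
  (n = 1 ∧ m ≤ 4) ∨ (m = 1 ∧ 1 ≤ n ∧ n ≤ 4) ∨
    ((n = 2 ∨ n = 3) ∧ m = 2) ∨ (n = 2 ∧ m = 3) ∨ ((n = 2 ∨ n = 3) ∧ m = 0)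

/-- The arities of `h`, `g`, `f` for which `h ∘ᵢ (g ∘ⱼ f) = (h ∘ᵢ g) ∘ f` is required. -/
def AssocOK (p q r : ℕ) : Prop :=
  p = 1 ∨ q = 1 ∨ r = 1 ∨ (p = 2 ∧ q = 2 ∧ (r = 2 ∨ r = 0))

/-- The arities of `h`, `g`, `f` for which the substitutions of `g` and `f` at different positions
of `h` are required to commute, `g` being on the left of `f`. -/
def CommOK (p q r : ℕ) : Prop :=
  q = 1 ∨ r = 1 ∨ (p = 2 ∧ (q = 2 ∨ q = 0) ∧ (r = 2 ∨ r = 0))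

/-- A short multicategory. -/
structure ShortMulticategory where
  Obj : Type u
  Hom : (L : List Obj) → L.length ≤ 4 → Obj → Type v
  id : ∀ a : Obj, Hom [a] (by simp) a
  /-- `sub Γ₁ Γ₂ _ _ _ g f` is `g ∘ᵢ f` with `i = Γ₁.length + 1`. -/
  sub : ∀ {L Δ L' : List Obj} {b c : Obj} {hL : L.length ≤ 4} {hΔ : Δ.length ≤ 4}
    {hL' : L'.length ≤ 4} (Γ₁ Γ₂ : List Obj),
    L = Γ₁ ++ b :: Γ₂ → L' = Γ₁ ++ Δ ++ Γ₂ → SubOK L.length Δ.length →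
      Hom L hL c → Hom Δ hΔ b → Hom L' hL' c
  id_sub : ∀ {Δ : List Obj} {b : Obj} {hΔ : Δ.length ≤ 4} (f : Hom Δ hΔ b),
    sub [] [] rfl (by simp) (Or.inl ⟨rfl, hΔ⟩) (id b) f = f
  sub_id : ∀ {L : List Obj} {b c : Obj} {hL : L.length ≤ 4} (Γ₁ Γ₂ : List Obj)
    (eL : L = Γ₁ ++ b :: Γ₂) (g : Hom L hL c),
    sub Γ₁ Γ₂ eL (by simp [eL]) (Or.inr (Or.inl ⟨rfl, by simp [eL]; omega, hL⟩)) g (id b) = g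
  /-- `h ∘ᵢ (g ∘ⱼ f) = (h ∘ᵢ g) ∘ f`, the last substitution being at position `j + i - 1`. -/
  sub_assoc : ∀ {L M E M' L' K : List Obj} {b c d : Obj} {hL : L.length ≤ 4} {hM : M.length ≤ 4}
    {hE : E.length ≤ 4} {hM' : M'.length ≤ 4} {hL' : L'.length ≤ 4} {hK : K.length ≤ 4}
    (Γ₁ Γ₂ Δ₁ Δ₂ : List Obj)
    (eL : L = Γ₁ ++ c :: Γ₂) (eM : M = Δ₁ ++ b :: Δ₂) (eM' : M' = Δ₁ ++ E ++ Δ₂)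
    (eL' : L' = Γ₁ ++ M ++ Γ₂) (eK : K = Γ₁ ++ M' ++ Γ₂)
    (s₁ : SubOK M.length E.length) (s₂ : SubOK L.length M'.length)
    (s₃ : SubOK L.length M.length) (s₄ : SubOK L'.length E.length)
    (_ : AssocOK L.length M.length E.length)
    (h : Hom L hL d) (g : Hom M hM c) (f : Hom E hE b),
    (sub Γ₁ Γ₂ eL eK s₂ h (sub Δ₁ Δ₂ eM eM' s₁ g f : Hom M' hM' c) : Hom K hK d) =
      sub (Γ₁ ++ Δ₁) (Δ₂ ++ Γ₂) (by simp [eL', eM]) (by simp [eK, eM']) s₄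
        (sub Γ₁ Γ₂ eL eL' s₃ h g : Hom L' hL' d) f
  /-- Substitutions at two different positions commute. -/
  sub_comm : ∀ {L M E L₁ L₂ K : List Obj} {b c d : Obj} {hL : L.length ≤ 4} {hM : M.length ≤ 4}
    {hE : E.length ≤ 4} {hL₁ : L₁.length ≤ 4} {hL₂ : L₂.length ≤ 4} {hK : K.length ≤ 4}
    (Γ₁ Γ₂ Γ₃ : List Obj)
    (eL : L = Γ₁ ++ b :: (Γ₂ ++ c :: Γ₃)) (eL₁ : L₁ = Γ₁ ++ M ++ (Γ₂ ++ c :: Γ₃))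
    (eL₂ : L₂ = Γ₁ ++ b :: (Γ₂ ++ E ++ Γ₃)) (eK : K = Γ₁ ++ M ++ Γ₂ ++ E ++ Γ₃)
    (s₁ : SubOK L.length M.length) (s₂ : SubOK L₁.length E.length)
    (s₃ : SubOK L.length E.length) (s₄ : SubOK L₂.length M.length)
    (_ : CommOK L.length M.length E.length)
    (h : Hom L hL d) (g : Hom M hM b) (f : Hom E hE c),
    (sub (Γ₁ ++ M ++ Γ₂) Γ₃ (by simp [eL₁]) eK s₂
        (sub Γ₁ (Γ₂ ++ c :: Γ₃) eL eL₁ s₁ h g : Hom L₁ hL₁ d) f : Hom K hK d) =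
      sub Γ₁ (Γ₂ ++ E ++ Γ₃) eL₂ (by simp [eK]) s₄
        (sub (Γ₁ ++ b :: Γ₂) Γ₃ (by simp [eL]) (by simp [eL₂]) s₃ h f : Hom L₂ hL₂ d) g

/-- A morphism of short multicategories. -/
@[ext]
structure ShortMultifunctor (C D : ShortMulticategory.{v, u}) where
  obj : C.Obj → D.Obj
  map : ∀ {L : List C.Obj} {L' : List D.Obj} {b : C.Obj} {hL : L.length ≤ 4}
    {hL' : L'.length ≤ 4}, L' = L.map obj → C.Hom L hL b → D.Hom L' hL' (obj b)
  map_id : ∀ a : C.Obj, map (L := [a]) (L' := [obj a]) rfl (C.id a) = D.id (obj a)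
  map_sub : ∀ {L Δ L' : List C.Obj} {M Θ M' : List D.Obj} {b c : C.Obj} {hL : L.length ≤ 4}
    {hΔ : Δ.length ≤ 4} {hL' : L'.length ≤ 4} {hM : M.length ≤ 4} {hΘ : Θ.length ≤ 4}
    {hM' : M'.length ≤ 4} (Γ₁ Γ₂ : List C.Obj)
    (eL : L = Γ₁ ++ b :: Γ₂) (eL' : L' = Γ₁ ++ Δ ++ Γ₂) (s : SubOK L.length Δ.length)
    (eM : M = L.map obj) (eΘ : Θ = Δ.map obj) (eM' : M' = L'.map obj)
    (g : C.Hom L hL c) (f : C.Hom Δ hΔ b),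
    (map eM' (C.sub Γ₁ Γ₂ eL eL' s g f : C.Hom L' hL' c) : D.Hom M' hM' (obj c)) =
      D.sub (Γ₁.map obj) (Γ₂.map obj) (by simp [eM, eL]) (by simp [eM', eL', eΘ])
        (by simpa [eM, eΘ] using s) (map eM g : D.Hom M hM (obj c))
        (map eΘ f : D.Hom Θ hΘ (obj b))

namespace ShortMultifunctor

/-- The identity morphism. -/
def idm (C : ShortMulticategory.{v, u}) : ShortMultifunctor C C where
  obj a := a
  map e g := cast (by simp only [List.map_id'] at e; subst e; rfl) g
  map_id _ := rfl
  map_sub Γ₁ Γ₂ eL eL' s eM eΘ eM' g f := by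
    simp only [List.map_id'] at eM eΘ eM'
    subst eM eΘ eM'
    simp

/-- Composition of morphisms. -/
def comp {C D E : ShortMulticategory.{v, u}} (F : ShortMultifunctor C D)
    (G : ShortMultifunctor D E) : ShortMultifunctor C E where
  obj a := G.obj (F.obj a)
  map {L _ _ hL _} e g := G.map (L := L.map F.obj) (hL := by simpa using hL) (by simp [e])
    (F.map rfl g)
  map_id a := (congrArg (G.map rfl) (F.map_id a)).trans (G.map_id _)
  map_sub {_ _ _ _ _ _ _ _ hL hΔ _ _ _ _} Γ₁ Γ₂ eL eL' s eM eΘ eM' g f := by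
    rw [F.map_sub (hM := by simpa using hL) (hΘ := by simpa using hΔ) Γ₁ Γ₂ eL eL' s rfl rfl rfl,
      G.map_sub (Γ₁.map F.obj) (Γ₂.map F.obj) _ _ _ (eM.trans List.map_map.symm)
        (eΘ.trans List.map_map.symm) (eM'.trans List.map_map.symm)]
    simp only [List.map_map]
    rfl

lemma map_cast {C D : ShortMulticategory.{v, u}} (F : ShortMultifunctor C D) {L M : List C.Obj}
    {L' : List D.Obj} {b : C.Obj} {hL : L.length ≤ 4} {hM : M.length ≤ 4} {hL' : L'.length ≤ 4}
    (e : L = M) (e' : L' = M.map F.obj) (h : C.Hom L hL b = C.Hom M hM b) (g : C.Hom L hL b) :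
    (F.map e' (cast h g) : D.Hom L' hL' _) = F.map (e'.trans (by rw [e])) g := by
  subst e
  rfl

lemma map_map_congr {C D E : ShortMulticategory.{v, u}} (H : ShortMultifunctor D E)
    (G : ShortMultifunctor C D) {L : List C.Obj} {M M' : List D.Obj} {N : List E.Obj} {b : C.Obj}
    {hL : L.length ≤ 4} {hM : M.length ≤ 4} {hM' : M'.length ≤ 4} {hN : N.length ≤ 4}
    (g : C.Hom L hL b)
    (e : M = L.map G.obj) (e' : M' = L.map G.obj) (k : N = M.map H.obj) (k' : N = M'.map H.obj) :
    (H.map k (G.map e g : D.Hom M hM _) : E.Hom N hN _) =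
      H.map k' (G.map e' g : D.Hom M' hM' _) := by
  subst e e'
  rfl

end ShortMultifunctor

/-- The category of short multicategories. -/
instance : Category ShortMulticategory.{v, u} where
  Hom := ShortMultifunctor
  id := ShortMultifunctor.idm
  comp := ShortMultifunctor.comp
  id_comp F := by
    refine ShortMultifunctor.ext rfl (heq_of_eq ?_)
    funext L L' b hL hL' e g
    exact F.map_cast (List.map_id' L).symm _ _ _
  comp_id F := by
    refine ShortMultifunctor.ext rfl (heq_of_eq ?_)
    funext L L' b hL hL' e g
    subst e
    rfl
  assoc F G H := by
    refine ShortMultifunctor.ext rfl (heq_of_eq ?_)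
    funext L L' b hL hL' e g
    exact H.map_map_congr G _ _ _ _ _

/-! ### The forgetful functor -/

/-- The functor which forgets the multimaps of arity greater than four. -/
def forgetShort : Multicategory.{v, u} ⥤ ShortMulticategory.{v, u} where
  obj C :=
    { Obj := C.Obj
      Hom := fun L _ b => C.Hom L b
      id := C.id
      sub := fun Γ₁ Γ₂ eL eL' _ g f => C.sub Γ₁ Γ₂ eL eL' g f
      id_sub := C.id_sub
      sub_id := C.sub_id
      sub_assoc := fun Γ₁ Γ₂ Δ₁ Δ₂ eL eM eM' eL' eK _ _ _ _ _ h g f =>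
        C.sub_assoc Γ₁ Γ₂ Δ₁ Δ₂ eL eM eM' eL' eK h g f
      sub_comm := fun Γ₁ Γ₂ Γ₃ eL eL₁ eL₂ eK _ _ _ _ _ h g f =>
        C.sub_comm Γ₁ Γ₂ Γ₃ eL eL₁ eL₂ eK h g f }
  map F := show ShortMultifunctor _ _ from
    { obj := F.obj
      map := fun e g => F.map e g
      map_id := F.map_id
      map_sub := fun Γ₁ Γ₂ eL eL' _ eM eΘ eM' g f => F.map_sub Γ₁ Γ₂ eL eL' eM eΘ eM' g f }
  map_id _ := rfl
  map_comp _ _ := rfl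

/-! ### Representability and closedness -/

namespace Multicategory

variable (C : Multicategory.{v, u})

/-- The underlying category: its morphisms are the unary maps. -/
instance : Category C.Obj where
  Hom a b := C.Hom [a] b
  id a := C.id a
  comp f g := C.sub [] [] rfl rfl g f
  id_comp f := C.sub_id [] [] rfl f
  comp_id f := C.id_sub f
  assoc f g h := C.sub_assoc [] [] [] [] rfl rfl rfl rfl rfl h g f

/-- Precomposition of the first variable with `θ` is a bijection, for every list of further
variables.  With `x = []` this says that `θ` is a map classifier. -/
def IsLeftUniversal {L : List C.Obj} {m : C.Obj} (θ : C.Hom L m) : Prop :=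
  ∀ (x : List C.Obj) (d : C.Obj),
    Function.Bijective (fun g : C.Hom (m :: x) d =>
      (C.sub [] x rfl rfl g θ : C.Hom (L ++ x) d))

/-- Every list of objects has a left universal map classifier. -/
def LeftRepresentable : Prop :=
  ∀ L : List C.Obj, ∃ (m : C.Obj) (θ : C.Hom L m), C.IsLeftUniversal θ

/-- Closed multicategories. -/
def Closed : Prop :=
  ∀ b c : C.Obj, ∃ (h : C.Obj) (e : C.Hom [h, b] c), ∀ x : List C.Obj,
    Function.Bijective (fun f : C.Hom x h => (C.sub [] [b] rfl rfl e f : C.Hom (x ++ [b]) c))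

end Multicategory

namespace ShortMulticategory

variable (C : ShortMulticategory.{v, u})

/-- The underlying category: its morphisms are the unary maps. -/
instance : Category C.Obj where
  Hom a b := C.Hom [a] (by simp) b
  id a := C.id a
  comp f g := C.sub [] [] rfl rfl (by simp [SubOK]) g f
  id_comp f := C.sub_id [] [] rfl f
  comp_id f := C.id_sub f
  assoc f g h := C.sub_assoc [] [] [] [] rfl rfl rfl rfl rfl (by simp [SubOK]) (by simp [SubOK])
    (by simp [SubOK]) (by simp [SubOK]) (by simp [AssocOK]) h g f

/-- Nullary maps. -/
abbrev M0 (b : C.Obj) : Type v := C.Hom [] (by simp) b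

/-- Binary maps. -/
abbrev M2 (a₁ a₂ b : C.Obj) : Type v := C.Hom [a₁, a₂] (by simp) b

/-- Ternary maps. -/
abbrev M3 (a₁ a₂ a₃ b : C.Obj) : Type v := C.Hom [a₁, a₂, a₃] (by simp) b

/-- Quaternary maps. -/
abbrev M4 (a₁ a₂ a₃ a₄ b : C.Obj) : Type v := C.Hom [a₁, a₂, a₃, a₄] (by simp) b

lemma subOK_classifier {n k : ℕ} (hn : n = 0 ∨ n = 2) (hk : k ≤ 2) : SubOK (k + 1) n := by
  unfold SubOK; omega

lemma subOK_closed {n : ℕ} (hn : n ≤ 3) : SubOK 2 n := by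
  unfold SubOK; omega

/-- Precomposition of the first variable of unary, binary and ternary maps with the nullary or
binary map `θ` is a bijection.  For unary maps this says that `θ` is a map classifier. -/
def IsLeftUniversal {L : List C.Obj} (hL : L.length = 0 ∨ L.length = 2) {m : C.Obj}
    (θ : C.Hom L (by omega) m) : Prop :=
  ∀ (x : List C.Obj) (hx : x.length ≤ 2) (d : C.Obj),
    Function.Bijective (fun g : C.Hom (m :: x) (by simp; omega) d =>
      (C.sub [] x rfl rfl (subOK_classifier hL hx) g θ : C.Hom (L ++ x) (by simp; omega) d))

/-- There are a left universal nullary map classifier and all left universal binary map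
classifiers. -/
def LeftRepresentable : Prop :=
  (∃ (i : C.Obj) (θ : C.M0 i), C.IsLeftUniversal (L := []) (Or.inl rfl) θ) ∧
    ∀ a b : C.Obj, ∃ (m : C.Obj) (θ : C.M2 a b m), C.IsLeftUniversal (L := [a, b]) (Or.inr rfl) θ

/-- Closed short multicategories. -/
def Closed : Prop :=
  ∀ b c : C.Obj, ∃ (h : C.Obj) (e : C.M2 h b c), ∀ (x : List C.Obj) (hx : x.length ≤ 3),
    Function.Bijective (fun f : C.Hom x (by omega) h =>
      (C.sub [] [b] rfl rfl (subOK_closed hx) e f : C.Hom (x ++ [b]) (by simp; omega) c))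

end ShortMulticategory

/-! ### Skew monoidal categories -/

/-- A (left) skew monoidal category. -/
structure SkewMonoidalCategory where
  carrier : Type u
  [category : Category.{v} carrier]
  tensorObj : carrier → carrier → carrier
  tensorHom : ∀ {a b c d : carrier}, (a ⟶ b) → (c ⟶ d) → (tensorObj a c ⟶ tensorObj b d)
  unit : carrier
  α : ∀ a b c : carrier, tensorObj (tensorObj a b) c ⟶ tensorObj a (tensorObj b c)
  lam : ∀ a : carrier, tensorObj unit a ⟶ a
  ρ : ∀ a : carrier, a ⟶ tensorObj a unit
  tensor_id : ∀ a b : carrier, tensorHom (𝟙 a) (𝟙 b) = 𝟙 (tensorObj a b)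
  tensor_comp : ∀ {a b c a' b' c' : carrier} (f : a ⟶ b) (g : b ⟶ c) (f' : a' ⟶ b') (g' : b' ⟶ c'),
    tensorHom (f ≫ g) (f' ≫ g') = tensorHom f f' ≫ tensorHom g g'
  α_naturality : ∀ {a b c a' b' c' : carrier} (f : a ⟶ a') (g : b ⟶ b') (h : c ⟶ c'),
    tensorHom (tensorHom f g) h ≫ α a' b' c' = α a b c ≫ tensorHom f (tensorHom g h)
  lam_naturality : ∀ {a a' : carrier} (f : a ⟶ a'),
    tensorHom (𝟙 unit) f ≫ lam a' = lam a ≫ f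
  ρ_naturality : ∀ {a a' : carrier} (f : a ⟶ a'),
    f ≫ ρ a' = ρ a ≫ tensorHom f (𝟙 unit)
  pentagon : ∀ a b c d : carrier,
    tensorHom (α a b c) (𝟙 d) ≫ α a (tensorObj b c) d ≫ tensorHom (𝟙 a) (α b c d) =
      α (tensorObj a b) c d ≫ α a b (tensorObj c d)
  lam_tensor : ∀ a b : carrier,
    α unit a b ≫ lam (tensorObj a b) = tensorHom (lam a) (𝟙 b)
  ρ_tensor : ∀ a b : carrier,
    ρ (tensorObj a b) ≫ α a b unit = tensorHom (𝟙 a) (ρ b)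
  ρ_α_lam : ∀ a b : carrier,
    tensorHom (ρ a) (𝟙 b) ≫ α a unit b ≫ tensorHom (𝟙 a) (lam b) = 𝟙 (tensorObj a b)
  ρ_lam : ρ unit ≫ lam unit = 𝟙 unit

attribute [instance] SkewMonoidalCategory.category

/-- A lax monoidal functor between skew monoidal categories. -/
@[ext]
structure LaxMonoidalFunctor (V W : SkewMonoidalCategory.{v, u}) where
  functor : V.carrier ⥤ W.carrier
  f₀ : W.unit ⟶ functor.obj V.unit
  f₂ : ∀ a b : V.carrier,
    W.tensorObj (functor.obj a) (functor.obj b) ⟶ functor.obj (V.tensorObj a b)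
  f₂_naturality : ∀ {a b a' b' : V.carrier} (f : a ⟶ a') (g : b ⟶ b'),
    W.tensorHom (functor.map f) (functor.map g) ≫ f₂ a' b' = f₂ a b ≫ functor.map (V.tensorHom f g)
  associativity : ∀ a b c : V.carrier,
    W.tensorHom (f₂ a b) (𝟙 (functor.obj c)) ≫ f₂ (V.tensorObj a b) c ≫ functor.map (V.α a b c) =
      W.α (functor.obj a) (functor.obj b) (functor.obj c) ≫
        W.tensorHom (𝟙 (functor.obj a)) (f₂ b c) ≫ f₂ a (V.tensorObj b c)
  left_unitality : ∀ a : V.carrier,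
    W.tensorHom f₀ (𝟙 (functor.obj a)) ≫ f₂ V.unit a ≫ functor.map (V.lam a) =
      W.lam (functor.obj a)
  right_unitality : ∀ a : V.carrier,
    W.ρ (functor.obj a) ≫ W.tensorHom (𝟙 (functor.obj a)) f₀ ≫ f₂ a V.unit =
      functor.map (V.ρ a)

namespace LaxMonoidalFunctor

/-- The identity lax monoidal functor. -/
def idm (V : SkewMonoidalCategory.{v, u}) : LaxMonoidalFunctor V V where
  functor := 𝟭 V.carrier
  f₀ := 𝟙 _
  f₂ _ _ := 𝟙 _
  f₂_naturality f g := by simp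
  associativity a b c := by simp [V.tensor_id]
  left_unitality a := by simp [V.tensor_id]
  right_unitality a := by simp [V.tensor_id]

/-- Composition of lax monoidal functors. -/
def comp {V W X : SkewMonoidalCategory.{v, u}} (F : LaxMonoidalFunctor V W)
    (G : LaxMonoidalFunctor W X) : LaxMonoidalFunctor V X where
  functor := F.functor ⋙ G.functor
  f₀ := G.f₀ ≫ G.functor.map F.f₀
  f₂ a b := G.f₂ (F.functor.obj a) (F.functor.obj b) ≫ G.functor.map (F.f₂ a b)
  f₂_naturality f g := by
    have h1 := G.f₂_naturality (F.functor.map f) (F.functor.map g)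
    have h2 := F.f₂_naturality f g
    simp only [Functor.comp_map, Functor.comp_obj, Category.assoc, ← Functor.map_comp, ← h2]
    rw [← Category.assoc, h1]
    simp
  associativity a b c := by
    have h1 := G.associativity (F.functor.obj a) (F.functor.obj b) (F.functor.obj c)
    have h2 := congrArg G.functor.map (F.associativity a b c)
    have h3 := G.f₂_naturality (F.f₂ a b) (𝟙 (F.functor.obj c))
    have h4 := G.f₂_naturality (𝟙 (F.functor.obj a)) (F.f₂ b c)
    have e1 := X.tensor_comp (G.f₂ (F.functor.obj a) (F.functor.obj b))
      (G.functor.map (F.f₂ a b)) (𝟙 _) (𝟙 (G.functor.obj (F.functor.obj c)))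
    have e2 := X.tensor_comp (𝟙 _) (𝟙 (G.functor.obj (F.functor.obj a)))
      (G.f₂ (F.functor.obj b) (F.functor.obj c)) (G.functor.map (F.f₂ b c))
    simp only [Category.comp_id, CategoryTheory.Functor.map_id, CategoryTheory.Functor.map_comp] at *
    simp only [Functor.comp_obj, Functor.comp_map, e1, e2, Category.assoc]
    rw [reassoc_of% h3, h2, reassoc_of% h1, reassoc_of% h4]
  left_unitality a := by
    have h1 := G.left_unitality (F.functor.obj a)
    have h2 := congrArg G.functor.map (F.left_unitality a)
    have h3 := G.f₂_naturality F.f₀ (𝟙 (F.functor.obj a))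
    have e1 := X.tensor_comp G.f₀ (G.functor.map F.f₀) (𝟙 _) (𝟙 (G.functor.obj (F.functor.obj a)))
    simp only [Category.comp_id, CategoryTheory.Functor.map_id, CategoryTheory.Functor.map_comp] at *
    simp only [Functor.comp_obj, Functor.comp_map, e1, Category.assoc]
    rw [reassoc_of% h3, h2, h1]
  right_unitality a := by
    have h1 := G.right_unitality (F.functor.obj a)
    have h2 := congrArg G.functor.map (F.right_unitality a)
    have h3 := G.f₂_naturality (𝟙 (F.functor.obj a)) F.f₀
    have e1 := X.tensor_comp (𝟙 _) (𝟙 (G.functor.obj (F.functor.obj a))) G.f₀ (G.functor.map F.f₀)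
    simp only [Category.comp_id, CategoryTheory.Functor.map_id, CategoryTheory.Functor.map_comp] at *
    simp only [Functor.comp_obj, Functor.comp_map, e1, Category.assoc]
    rw [reassoc_of% h3, reassoc_of% h1, h2]

end LaxMonoidalFunctor

/-- The category of skew monoidal categories and lax monoidal functors. -/
instance : Category SkewMonoidalCategory.{v, u} where
  Hom := LaxMonoidalFunctor
  id := LaxMonoidalFunctor.idm
  comp := LaxMonoidalFunctor.comp
  id_comp F := by
    refine LaxMonoidalFunctor.ext rfl (heq_of_eq ?_) (heq_of_eq ?_)
    · simp [LaxMonoidalFunctor.comp, LaxMonoidalFunctor.idm]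
    · funext a b
      simp [LaxMonoidalFunctor.comp, LaxMonoidalFunctor.idm]
  comp_id F := by
    refine LaxMonoidalFunctor.ext rfl (heq_of_eq ?_) (heq_of_eq ?_)
    · simp [LaxMonoidalFunctor.comp, LaxMonoidalFunctor.idm]
    · funext a b
      simp [LaxMonoidalFunctor.comp, LaxMonoidalFunctor.idm]
  assoc F G H := by
    refine LaxMonoidalFunctor.ext rfl (heq_of_eq ?_) (heq_of_eq ?_)
    · simp [LaxMonoidalFunctor.comp]
    · funext a b
      simp [LaxMonoidalFunctor.comp]

namespace SkewMonoidalCategory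

variable (V : SkewMonoidalCategory.{v, u})

/-- The left unit maps are invertible. -/
def LeftNormal : Prop := ∀ a : V.carrier, IsIso (V.lam a)

/-- The endofunctor `- ⊗ b`. -/
def tensorRight (b : V.carrier) : V.carrier ⥤ V.carrier where
  obj a := V.tensorObj a b
  map f := V.tensorHom f (𝟙 b)
  map_id a := V.tensor_id a b
  map_comp f g := by rw [← V.tensor_comp, Category.comp_id]

/-- Every endofunctor `- ⊗ b` has a right adjoint. -/
def Closed : Prop := ∀ b : V.carrier, (V.tensorRight b).IsLeftAdjoint

end SkewMonoidalCategory

/-! ### The operations of a short multicategory in explicit form -/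

namespace ShortMulticategory

variable {C : ShortMulticategory.{v, u}} {a b c d e x y z x' y' : C.Obj}

/-- Postcomposition with a unary map. -/
def post {L : List C.Obj} {hL : L.length ≤ 4} (f : C.Hom L hL b) (q : b ⟶ c) : C.Hom L hL c :=
  C.sub [] [] rfl (by simp) (Or.inl ⟨rfl, hL⟩) q f

/-- Substitution, arities 2 and 1, in position 1. -/
def pre21 (f : C.M2 x y z) (g : (a ⟶ x)) : C.M2 a y z :=
  C.sub [] [y] rfl rfl (by simp [SubOK]) f g

/-- Substitution, arities 2 and 1, in position 2. -/
def pre22 (f : C.M2 x y z) (g : (a ⟶ y)) : C.M2 x a z :=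
  C.sub [x] [] rfl rfl (by simp [SubOK]) f g

/-- Substitution, arities 3 and 1, in position 1. -/
def pre31 (f : C.M3 x y d z) (g : (a ⟶ x)) : C.M3 a y d z :=
  C.sub [] [y, d] rfl rfl (by simp [SubOK]) f g

/-- Substitution, arities 3 and 1, in position 2. -/
def pre32 (f : C.M3 x y d z) (g : (a ⟶ y)) : C.M3 x a d z :=
  C.sub [x] [d] rfl rfl (by simp [SubOK]) f g

/-- Substitution, arities 3 and 1, in position 3. -/
def pre33 (f : C.M3 x y d z) (g : (a ⟶ d)) : C.M3 x y a z :=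
  C.sub [x, y] [] rfl rfl (by simp [SubOK]) f g

/-- Substitution, arities 2 and 2, in position 1. -/
def s221 (f : C.M2 x y z) (g : C.M2 a b x) : C.M3 a b y z :=
  C.sub [] [y] rfl rfl (by simp [SubOK]) f g

/-- Substitution, arities 2 and 2, in position 2. -/
def s222 (f : C.M2 x y z) (g : C.M2 a b y) : C.M3 x a b z :=
  C.sub [x] [] rfl rfl (by simp [SubOK]) f g

/-- Substitution, arities 3 and 2, in position 1. -/
def s321 (f : C.M3 x y d z) (g : C.M2 a b x) : C.M4 a b y d z :=
  C.sub [] [y, d] rfl rfl (by simp [SubOK]) f g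

/-- Substitution, arities 3 and 2, in position 2. -/
def s322 (f : C.M3 x y d z) (g : C.M2 a b y) : C.M4 x a b d z :=
  C.sub [x] [d] rfl rfl (by simp [SubOK]) f g

/-- Substitution, arities 3 and 2, in position 3. -/
def s323 (f : C.M3 x y d z) (g : C.M2 a b d) : C.M4 x y a b z :=
  C.sub [x, y] [] rfl rfl (by simp [SubOK]) f g

/-- Substitution, arities 2 and 3, in position 1. -/
def s231 (f : C.M2 x y z) (g : C.M3 a b c x) : C.M4 a b c y z :=
  C.sub [] [y] rfl rfl (by simp [SubOK]) f g

/-- Substitution, arities 2 and 3, in position 2. -/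
def s232 (f : C.M2 x y z) (g : C.M3 a b c y) : C.M4 x a b c z :=
  C.sub [x] [] rfl rfl (by simp [SubOK]) f g

/-- Substitution, arities 2 and 0, in position 1. -/
def s201 (f : C.M2 x y z) (g : C.M0 x) : y ⟶ z :=
  C.sub [] [y] rfl rfl (by simp [SubOK]) f g

/-- Substitution, arities 2 and 0, in position 2. -/
def s202 (f : C.M2 x y z) (g : C.M0 y) : x ⟶ z :=
  C.sub [x] [] rfl rfl (by simp [SubOK]) f g

/-- Substitution, arities 3 and 0, in position 1. -/
def s301 (f : C.M3 x y d z) (g : C.M0 x) : C.M2 y d z :=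
  C.sub [] [y, d] rfl rfl (by simp [SubOK]) f g

/-- Substitution, arities 3 and 0, in position 2. -/
def s302 (f : C.M3 x y d z) (g : C.M0 y) : C.M2 x d z :=
  C.sub [x] [d] rfl rfl (by simp [SubOK]) f g

/-- Substitution, arities 3 and 0, in position 3. -/
def s303 (f : C.M3 x y d z) (g : C.M0 d) : C.M2 x y z :=
  C.sub [x, y] [] rfl rfl (by simp [SubOK]) f g

lemma post_id {L : List C.Obj} {hL : L.length ≤ 4} (f : C.Hom L hL b) : post f (𝟙 b) = f :=
  C.id_sub f

lemma post_comp {L : List C.Obj} {hL : L.length ≤ 4} (f : C.Hom L hL b) (p : b ⟶ c) (q : c ⟶ d) :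
    post (post f p) q = post f (p ≫ q) :=
  C.sub_assoc [] [] [] [] rfl rfl (by simp) rfl (by simp) (Or.inl ⟨rfl, hL⟩) (Or.inl ⟨rfl, hL⟩)
    (by simp [SubOK]) (Or.inl ⟨rfl, hL⟩) (Or.inl rfl) q p f

lemma post_unary (f : a ⟶ b) (q : b ⟶ c) :
    post (C := C) (L := [a]) (hL := by simp) f q = f ≫ q := rfl

lemma pre21_id (f : C.M2 x y z) : pre21 f (𝟙 x) = f := C.sub_id [] [y] rfl f

lemma pre22_id (f : C.M2 x y z) : pre22 f (𝟙 y) = f := C.sub_id [x] [] rfl f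

lemma pre21_comp (f : C.M2 x y z) (p : a ⟶ b) (q : b ⟶ x) :
    pre21 f (p ≫ q) = pre21 (pre21 f q) p :=
  C.sub_assoc [] [y] [] [] rfl rfl rfl rfl rfl (by simp [SubOK]) (by simp [SubOK]) (by simp [SubOK]) (by simp [SubOK]) (by simp [AssocOK]) f q p

lemma pre22_comp (f : C.M2 x y z) (p : a ⟶ b) (q : b ⟶ y) :
    pre22 f (p ≫ q) = pre22 (pre22 f q) p :=
  C.sub_assoc [x] [] [] [] rfl rfl rfl rfl rfl (by simp [SubOK]) (by simp [SubOK]) (by simp [SubOK]) (by simp [SubOK]) (by simp [AssocOK]) f q p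

lemma pre22_pre21 (f : C.M2 x y z) (p : a ⟶ x) (q : b ⟶ y) :
    pre22 (pre21 f p) q = pre21 (pre22 f q) p :=
  C.sub_comm [] [] [] rfl rfl rfl rfl (by simp [SubOK]) (by simp [SubOK]) (by simp [SubOK]) (by simp [SubOK]) (by simp [CommOK]) f p q

lemma post_pre21 (f : C.M2 x y z) (g : a ⟶ x) (q : z ⟶ e) :
    post (pre21 f g) q = pre21 (post f q) g :=
  C.sub_assoc [] [] [] [y] rfl rfl rfl rfl rfl (by simp [SubOK]) (by simp [SubOK]) (by simp [SubOK]) (by simp [SubOK]) (by simp [AssocOK]) q f g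

lemma post_pre22 (f : C.M2 x y z) (g : a ⟶ y) (q : z ⟶ e) :
    post (pre22 f g) q = pre22 (post f q) g :=
  C.sub_assoc [] [] [x] [] rfl rfl rfl rfl rfl (by simp [SubOK]) (by simp [SubOK]) (by simp [SubOK]) (by simp [SubOK]) (by simp [AssocOK]) q f g

lemma post_s221 (f : C.M2 x y z) (g : C.M2 a b x) (q : z ⟶ e) :
    post (s221 f g) q = s221 (post f q) g :=
  C.sub_assoc [] [] [] [y] rfl rfl rfl rfl rfl (by simp [SubOK]) (by simp [SubOK]) (by simp [SubOK]) (by simp [SubOK]) (by simp [AssocOK]) q f g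

lemma post_s222 (f : C.M2 x y z) (g : C.M2 a b y) (q : z ⟶ e) :
    post (s222 f g) q = s222 (post f q) g :=
  C.sub_assoc [] [] [x] [] rfl rfl rfl rfl rfl (by simp [SubOK]) (by simp [SubOK]) (by simp [SubOK]) (by simp [SubOK]) (by simp [AssocOK]) q f g

lemma s201_comp (f : C.M2 x y z) (g : C.M0 x) (q : z ⟶ e) :
    s201 f g ≫ q = s201 (post f q) g :=
  C.sub_assoc [] [] [] [y] rfl rfl rfl rfl rfl (by simp [SubOK]) (by simp [SubOK]) (by simp [SubOK]) (by simp [SubOK]) (by simp [AssocOK]) q f g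

lemma s202_comp (f : C.M2 x y z) (g : C.M0 y) (q : z ⟶ e) :
    s202 f g ≫ q = s202 (post f q) g :=
  C.sub_assoc [] [] [x] [] rfl rfl rfl rfl rfl (by simp [SubOK]) (by simp [SubOK]) (by simp [SubOK]) (by simp [SubOK]) (by simp [AssocOK]) q f g

lemma s221_post (f : C.M2 x y z) (p : x' ⟶ x) (g : C.M2 a b x') :
    s221 f (post g p) = s221 (pre21 f p) g :=
  C.sub_assoc [] [y] [] [] rfl rfl rfl rfl rfl (by simp [SubOK]) (by simp [SubOK]) (by simp [SubOK]) (by simp [SubOK]) (by simp [AssocOK]) f p g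

lemma s222_post (f : C.M2 x y z) (p : y' ⟶ y) (g : C.M2 a b y') :
    s222 f (post g p) = s222 (pre22 f p) g :=
  C.sub_assoc [x] [] [] [] rfl rfl rfl rfl rfl (by simp [SubOK]) (by simp [SubOK]) (by simp [SubOK]) (by simp [SubOK]) (by simp [AssocOK]) f p g

lemma s201_post (f : C.M2 x y z) (p : x' ⟶ x) (g : C.M0 x') :
    s201 f (post g p) = s201 (pre21 f p) g :=
  C.sub_assoc [] [y] [] [] rfl rfl rfl rfl rfl (by simp [SubOK]) (by simp [SubOK]) (by simp [SubOK]) (by simp [SubOK]) (by simp [AssocOK]) f p g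

lemma s202_post (f : C.M2 x y z) (p : y' ⟶ y) (g : C.M0 y') :
    s202 f (post g p) = s202 (pre22 f p) g :=
  C.sub_assoc [x] [] [] [] rfl rfl rfl rfl rfl (by simp [SubOK]) (by simp [SubOK]) (by simp [SubOK]) (by simp [SubOK]) (by simp [AssocOK]) f p g

lemma s221_pre21 (f : C.M2 x y z) (g : C.M2 a b x) (p : c ⟶ a) :
    s221 f (pre21 g p) = pre31 (s221 f g) p :=
  C.sub_assoc [] [y] [] [b] rfl rfl rfl rfl rfl (by simp [SubOK]) (by simp [SubOK]) (by simp [SubOK]) (by simp [SubOK]) (by simp [AssocOK]) f g p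

lemma s221_pre22 (f : C.M2 x y z) (g : C.M2 a b x) (p : c ⟶ b) :
    s221 f (pre22 g p) = pre32 (s221 f g) p :=
  C.sub_assoc [] [y] [a] [] rfl rfl rfl rfl rfl (by simp [SubOK]) (by simp [SubOK]) (by simp [SubOK]) (by simp [SubOK]) (by simp [AssocOK]) f g p

lemma s222_pre21 (f : C.M2 x y z) (g : C.M2 a b y) (p : c ⟶ a) :
    s222 f (pre21 g p) = pre32 (s222 f g) p :=
  C.sub_assoc [x] [] [] [b] rfl rfl rfl rfl rfl (by simp [SubOK]) (by simp [SubOK]) (by simp [SubOK]) (by simp [SubOK]) (by simp [AssocOK]) f g p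

lemma s222_pre22 (f : C.M2 x y z) (g : C.M2 a b y) (p : c ⟶ b) :
    s222 f (pre22 g p) = pre33 (s222 f g) p :=
  C.sub_assoc [x] [] [a] [] rfl rfl rfl rfl rfl (by simp [SubOK]) (by simp [SubOK]) (by simp [SubOK]) (by simp [SubOK]) (by simp [AssocOK]) f g p

lemma pre33_s221 (f : C.M2 x y z) (g : C.M2 a b x) (p : c ⟶ y) :
    pre33 (s221 f g) p = s221 (pre22 f p) g :=
  C.sub_comm [] [] [] rfl rfl rfl rfl (by simp [SubOK]) (by simp [SubOK]) (by simp [SubOK]) (by simp [SubOK]) (by simp [CommOK]) f g p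

lemma s222_pre21_outer (f : C.M2 x y z) (p : c ⟶ x) (g : C.M2 a b y) :
    s222 (pre21 f p) g = pre31 (s222 f g) p :=
  C.sub_comm [] [] [] rfl rfl rfl rfl (by simp [SubOK]) (by simp [SubOK]) (by simp [SubOK]) (by simp [SubOK]) (by simp [CommOK]) f p g

lemma comp_s201 (f : C.M2 x y z) (g : C.M0 x) (p : c ⟶ y) :
    p ≫ s201 f g = s201 (pre22 f p) g :=
  C.sub_comm [] [] [] rfl rfl rfl rfl (by simp [SubOK]) (by simp [SubOK]) (by simp [SubOK]) (by simp [SubOK]) (by simp [CommOK]) f g p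

lemma s202_pre21_outer (f : C.M2 x y z) (p : c ⟶ x) (g : C.M0 y) :
    s202 (pre21 f p) g = p ≫ s202 f g :=
  C.sub_comm [] [] [] rfl rfl rfl rfl (by simp [SubOK]) (by simp [SubOK]) (by simp [SubOK]) (by simp [SubOK]) (by simp [CommOK]) f p g

lemma s231_s221 (f : C.M2 x y z) (g : C.M2 a b x) (h : C.M2 c d a) :
    s231 f (s221 g h) = s321 (s221 f g) h :=
  C.sub_assoc [] [y] [] [b] rfl rfl rfl rfl rfl (by simp [SubOK]) (by simp [SubOK]) (by simp [SubOK]) (by simp [SubOK]) (by simp [AssocOK]) f g h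

lemma s231_s222 (f : C.M2 x y z) (g : C.M2 a b x) (h : C.M2 c d b) :
    s231 f (s222 g h) = s322 (s221 f g) h :=
  C.sub_assoc [] [y] [a] [] rfl rfl rfl rfl rfl (by simp [SubOK]) (by simp [SubOK]) (by simp [SubOK]) (by simp [SubOK]) (by simp [AssocOK]) f g h

lemma s232_s221 (f : C.M2 x y z) (g : C.M2 a b y) (h : C.M2 c d a) :
    s232 f (s221 g h) = s322 (s222 f g) h :=
  C.sub_assoc [x] [] [] [b] rfl rfl rfl rfl rfl (by simp [SubOK]) (by simp [SubOK]) (by simp [SubOK]) (by simp [SubOK]) (by simp [AssocOK]) f g h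

lemma s232_s222 (f : C.M2 x y z) (g : C.M2 a b y) (h : C.M2 c d b) :
    s232 f (s222 g h) = s323 (s222 f g) h :=
  C.sub_assoc [x] [] [a] [] rfl rfl rfl rfl rfl (by simp [SubOK]) (by simp [SubOK]) (by simp [SubOK]) (by simp [SubOK]) (by simp [AssocOK]) f g h

lemma s323_s221 (f : C.M2 x y z) (g : C.M2 a b x) (h : C.M2 c d y) :
    s323 (s221 f g) h = s321 (s222 f h) g :=
  C.sub_comm [] [] [] rfl rfl rfl rfl (by simp [SubOK]) (by simp [SubOK]) (by simp [SubOK]) (by simp [SubOK]) (by simp [CommOK]) f g h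

lemma pre21_s201 (f : C.M2 x y z) (g : C.M2 a b x) (h : C.M0 a) :
    pre21 f (s201 g h) = s301 (s221 f g) h :=
  C.sub_assoc [] [y] [] [b] rfl rfl rfl rfl rfl (by simp [SubOK]) (by simp [SubOK]) (by simp [SubOK]) (by simp [SubOK]) (by simp [AssocOK]) f g h

lemma pre21_s202 (f : C.M2 x y z) (g : C.M2 a b x) (h : C.M0 b) :
    pre21 f (s202 g h) = s302 (s221 f g) h :=
  C.sub_assoc [] [y] [a] [] rfl rfl rfl rfl rfl (by simp [SubOK]) (by simp [SubOK]) (by simp [SubOK]) (by simp [SubOK]) (by simp [AssocOK]) f g h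

lemma pre22_s201 (f : C.M2 x y z) (g : C.M2 a b y) (h : C.M0 a) :
    pre22 f (s201 g h) = s302 (s222 f g) h :=
  C.sub_assoc [x] [] [] [b] rfl rfl rfl rfl rfl (by simp [SubOK]) (by simp [SubOK]) (by simp [SubOK]) (by simp [SubOK]) (by simp [AssocOK]) f g h

lemma pre22_s202 (f : C.M2 x y z) (g : C.M2 a b y) (h : C.M0 b) :
    pre22 f (s202 g h) = s303 (s222 f g) h :=
  C.sub_assoc [x] [] [a] [] rfl rfl rfl rfl rfl (by simp [SubOK]) (by simp [SubOK]) (by simp [SubOK]) (by simp [SubOK]) (by simp [AssocOK]) f g h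

lemma s303_s221 (f : C.M2 x y z) (g : C.M2 a b x) (h : C.M0 y) :
    s303 (s221 f g) h = post g (s202 f h) :=
  C.sub_comm [] [] [] rfl rfl rfl rfl (by simp [SubOK]) (by simp [SubOK]) (by simp [SubOK]) (by simp [SubOK]) (by simp [CommOK]) f g h

lemma post_s201 (f : C.M2 x y z) (g : C.M0 x) (h : C.M2 a b y) :
    post h (s201 f g) = s301 (s222 f h) g :=
  C.sub_comm [] [] [] rfl rfl rfl rfl (by simp [SubOK]) (by simp [SubOK]) (by simp [SubOK]) (by simp [SubOK]) (by simp [CommOK]) f g h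

lemma post_s201_nullary (f : C.M2 x y z) (g : C.M0 x) (h : C.M0 y) :
    post h (s201 f g) = post g (s202 f h) :=
  C.sub_comm [] [] [] rfl rfl rfl rfl (by simp [SubOK]) (by simp [SubOK]) (by simp [SubOK]) (by simp [SubOK]) (by simp [CommOK]) f g h

end ShortMulticategory

namespace ShortMultifunctor

variable {C D : ShortMulticategory.{v, u}} (F : ShortMultifunctor C D) {a b x y z : C.Obj}

/-- The action on unary maps. -/
def map1 (f : a ⟶ b) : F.obj a ⟶ F.obj b :=
  (F.map (L := [a]) (L' := [F.obj a]) rfl f : D.Hom _ (by simp) _)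

lemma map1_id (a : C.Obj) : F.map1 (𝟙 a) = 𝟙 (F.obj a) := F.map_id a

/-- The underlying functor. -/
def toFunctor : C.Obj ⥤ D.Obj where
  obj := F.obj
  map := F.map1
  map_id := F.map1_id
  map_comp f g := F.map_sub [] [] rfl rfl (by simp [SubOK]) rfl rfl rfl g f

/-- The action on nullary maps. -/
def map0 (f : C.M0 b) : D.M0 (F.obj b) := F.map rfl f

/-- The action on binary maps. -/
def map2 (f : C.M2 x y z) : D.M2 (F.obj x) (F.obj y) (F.obj z) := F.map rfl f

/-- The action on ternary maps. -/
def map3 (f : C.M3 a x y z) : D.M3 (F.obj a) (F.obj x) (F.obj y) (F.obj z) := F.map rfl f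

lemma map0_post (f : C.M0 y) (q : y ⟶ z) :
    F.map0 (ShortMulticategory.post f q) = ShortMulticategory.post (F.map0 f) (F.map1 q) :=
  F.map_sub [] [] rfl rfl (by simp [SubOK]) rfl rfl rfl q f

lemma map2_post (f : C.M2 a b y) (q : y ⟶ z) :
    F.map2 (ShortMulticategory.post f q) = ShortMulticategory.post (F.map2 f) (F.map1 q) :=
  F.map_sub [] [] rfl rfl (by simp [SubOK]) rfl rfl rfl q f

lemma map3_post (f : C.M3 a b x y) (q : y ⟶ z) :
    F.map3 (ShortMulticategory.post f q) = ShortMulticategory.post (F.map3 f) (F.map1 q) :=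
  F.map_sub [] [] rfl rfl (by simp [SubOK]) rfl rfl rfl q f

lemma map2_pre21 (f : C.M2 x y z) (p : a ⟶ x) :
    F.map2 (ShortMulticategory.pre21 f p) = ShortMulticategory.pre21 (F.map2 f) (F.map1 p) :=
  F.map_sub [] [y] rfl rfl (by simp [SubOK]) rfl rfl rfl f p

lemma map2_pre22 (f : C.M2 x y z) (p : a ⟶ y) :
    F.map2 (ShortMulticategory.pre22 f p) = ShortMulticategory.pre22 (F.map2 f) (F.map1 p) :=
  F.map_sub [x] [] rfl rfl (by simp [SubOK]) rfl rfl rfl f p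

lemma map3_s221 (f : C.M2 x y z) (g : C.M2 a b x) :
    F.map3 (ShortMulticategory.s221 f g) = ShortMulticategory.s221 (F.map2 f) (F.map2 g) :=
  F.map_sub [] [y] rfl rfl (by simp [SubOK]) rfl rfl rfl f g

lemma map3_s222 (f : C.M2 x y z) (g : C.M2 a b y) :
    F.map3 (ShortMulticategory.s222 f g) = ShortMulticategory.s222 (F.map2 f) (F.map2 g) :=
  F.map_sub [x] [] rfl rfl (by simp [SubOK]) rfl rfl rfl f g

lemma map_s201 (f : C.M2 x y z) (g : C.M0 x) :
    F.map1 (ShortMulticategory.s201 f g) = ShortMulticategory.s201 (F.map2 f) (F.map0 g) :=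
  F.map_sub [] [y] rfl rfl (by simp [SubOK]) rfl rfl rfl f g

lemma map_s202 (f : C.M2 x y z) (g : C.M0 y) :
    F.map1 (ShortMulticategory.s202 f g) = ShortMulticategory.s202 (F.map2 f) (F.map0 g) :=
  F.map_sub [x] [] rfl rfl (by simp [SubOK]) rfl rfl rfl f g

end ShortMultifunctor

/-! ### From left representable short multicategories to skew monoidal categories -/

namespace ShortMulticategory

/-- A choice of left universal nullary and binary map classifiers. -/
structure Classifiers (C : ShortMulticategory.{v, u}) where
  i : C.Obj
  u : C.M0 i
  u_universal : C.IsLeftUniversal (L := []) (Or.inl rfl) u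
  m : C.Obj → C.Obj → C.Obj
  θ : ∀ a b : C.Obj, C.M2 a b (m a b)
  θ_universal : ∀ a b : C.Obj, C.IsLeftUniversal (L := [a, b]) (Or.inr rfl) (θ a b)

namespace Classifiers

variable {C : ShortMulticategory.{v, u}} (R : C.Classifiers) {a b c d e : C.Obj}

lemma bij_u (d : C.Obj) : Function.Bijective (fun g : R.i ⟶ d => (post R.u g : C.M0 d)) :=
  R.u_universal [] (by simp) d

lemma bij_u₁ (a d : C.Obj) :
    Function.Bijective (fun g : C.M2 R.i a d => (s201 g R.u : a ⟶ d)) :=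
  R.u_universal [a] (by simp) d

lemma bij_u₂ (a b d : C.Obj) :
    Function.Bijective (fun g : C.M3 R.i a b d => (s301 g R.u : C.M2 a b d)) :=
  R.u_universal [a, b] (by simp) d

lemma bij_θ (a b d : C.Obj) :
    Function.Bijective (fun g : R.m a b ⟶ d => (post (R.θ a b) g : C.M2 a b d)) :=
  R.θ_universal a b [] (by simp) d

lemma bij_θ₁ (a b c d : C.Obj) :
    Function.Bijective (fun g : C.M2 (R.m a b) c d => (s221 g (R.θ a b) : C.M3 a b c d)) :=
  R.θ_universal a b [c] (by simp) d

lemma bij_θ₂ (a b c d e : C.Obj) :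
    Function.Bijective (fun g : C.M3 (R.m a b) c d e => (s321 g (R.θ a b) : C.M4 a b c d e)) :=
  R.θ_universal a b [c, d] (by simp) e

/-- The unique unary map `g` with `g ∘ u = f`. -/
noncomputable def desc₀ (f : C.M0 d) : R.i ⟶ d := (Equiv.ofBijective _ (R.bij_u d)).symm f

/-- The unique unary map `g` with `g ∘ θ = f`. -/
noncomputable def desc₂ (f : C.M2 a b d) : R.m a b ⟶ d :=
  (Equiv.ofBijective _ (R.bij_θ a b d)).symm f

/-- The unique unary map `g` with `(g ∘ θ) ∘₁ θ = f`. -/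
noncomputable def desc₃ (f : C.M3 a b c d) : R.m (R.m a b) c ⟶ d :=
  R.desc₂ ((Equiv.ofBijective _ (R.bij_θ₁ a b c d)).symm f)

/-- The unique unary map `g` with `(g ∘ θ) ∘₁ u = f`. -/
noncomputable def descUnit (f : a ⟶ d) : R.m R.i a ⟶ d :=
  R.desc₂ ((Equiv.ofBijective _ (R.bij_u₁ a d)).symm f)

lemma post_desc₀ (f : C.M0 d) : post R.u (R.desc₀ f) = f :=
  (Equiv.ofBijective _ (R.bij_u d)).apply_symm_apply f

lemma post_desc₂ (f : C.M2 a b d) : post (R.θ a b) (R.desc₂ f) = f :=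
  (Equiv.ofBijective _ (R.bij_θ a b d)).apply_symm_apply f

lemma s221_desc₃ (f : C.M3 a b c d) :
    s221 (post (R.θ (R.m a b) c) (R.desc₃ f)) (R.θ a b) = f := by
  rw [desc₃, post_desc₂]
  exact (Equiv.ofBijective _ (R.bij_θ₁ a b c d)).apply_symm_apply f

lemma s201_descUnit (f : a ⟶ d) : s201 (post (R.θ R.i a) (R.descUnit f)) R.u = f := by
  rw [descUnit, post_desc₂]
  exact (Equiv.ofBijective _ (R.bij_u₁ a d)).apply_symm_apply f

variable {R}

lemma ext₀ {f g : R.i ⟶ d} (h : post R.u f = post R.u g) : f = g := (R.bij_u d).1 h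

lemma ext₂ {f g : R.m a b ⟶ d} (h : post (R.θ a b) f = post (R.θ a b) g) : f = g :=
  (R.bij_θ a b d).1 h

lemma ext₃ {f g : R.m (R.m a b) c ⟶ d}
    (h : s221 (post (R.θ (R.m a b) c) f) (R.θ a b) =
      s221 (post (R.θ (R.m a b) c) g) (R.θ a b)) : f = g :=
  ext₂ ((R.bij_θ₁ a b c d).1 h)

lemma ext₄ {f g : R.m (R.m (R.m a b) c) d ⟶ e}
    (h : s321 (s221 (post (R.θ (R.m (R.m a b) c) d) f) (R.θ (R.m a b) c)) (R.θ a b) =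
      s321 (s221 (post (R.θ (R.m (R.m a b) c) d) g) (R.θ (R.m a b) c)) (R.θ a b)) : f = g :=
  ext₃ ((R.bij_θ₂ a b c d e).1 h)

lemma extUnit {f g : R.m R.i a ⟶ d}
    (h : s201 (post (R.θ R.i a) f) R.u = s201 (post (R.θ R.i a) g) R.u) : f = g :=
  ext₂ ((R.bij_u₁ a d).1 h)

lemma extUnit₂ {f g : R.m (R.m R.i a) b ⟶ d}
    (h : s301 (s221 (post (R.θ (R.m R.i a) b) f) (R.θ R.i a)) R.u =
      s301 (s221 (post (R.θ (R.m R.i a) b) g) (R.θ R.i a)) R.u) : f = g :=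
  ext₃ ((R.bij_u₂ a b d).1 h)

variable (R)

/-- The tensor product of unary maps. -/
noncomputable def tensorHom (f : a ⟶ b) (g : c ⟶ d) : R.m a c ⟶ R.m b d :=
  R.desc₂ (pre22 (pre21 (R.θ b d) f) g)

/-- The associator. -/
noncomputable def assoc (a b c : C.Obj) : R.m (R.m a b) c ⟶ R.m a (R.m b c) :=
  R.desc₃ (s222 (R.θ a (R.m b c)) (R.θ b c))

/-- The left unit map. -/
noncomputable def leftUnit (a : C.Obj) : R.m R.i a ⟶ a := R.descUnit (𝟙 a)

/-- The right unit map. -/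
def rightUnit (a : C.Obj) : a ⟶ R.m a R.i := s202 (R.θ a R.i) R.u

lemma post_tensorHom (f : a ⟶ b) (g : c ⟶ d) :
    post (R.θ a c) (R.tensorHom f g) = pre22 (pre21 (R.θ b d) f) g := R.post_desc₂ _

lemma s221_assoc (a b c : C.Obj) :
    s221 (post (R.θ (R.m a b) c) (R.assoc a b c)) (R.θ a b) =
      s222 (R.θ a (R.m b c)) (R.θ b c) := R.s221_desc₃ _

lemma s201_leftUnit (a : C.Obj) :
    s201 (post (R.θ R.i a) (R.leftUnit a)) R.u = 𝟙 a := R.s201_descUnit _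

lemma post_post_tensorHom (f : a ⟶ b) (g : c ⟶ d) (h : R.m b d ⟶ e) :
    post (R.θ a c) (R.tensorHom f g ≫ h) = pre22 (pre21 (post (R.θ b d) h) f) g := by
  rw [← post_comp, post_tensorHom, post_pre22, post_pre21]

/-- The skew monoidal category of a left representable short multicategory. -/
noncomputable def skew : SkewMonoidalCategory.{v, u} where
  carrier := C.Obj
  tensorObj := R.m
  tensorHom := R.tensorHom
  unit := R.i
  α := R.assoc
  lam := R.leftUnit
  ρ := R.rightUnit
  tensor_id a b := ext₂ (by rw [post_tensorHom, pre21_id, pre22_id, post_id])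
  tensor_comp f g f' g' := ext₂ (by
    rw [post_post_tensorHom, post_tensorHom, post_tensorHom, pre21_comp, pre22_comp, pre22_pre21])
  α_naturality {a b c a' b' c'} f g h := ext₃ (by
    rw [post_post_tensorHom, ← pre33_s221, ← s221_post, post_tensorHom, s221_pre22, s221_pre21,
      s221_assoc, ← post_comp, ← post_s221, s221_assoc, post_s222, post_tensorHom, ← s222_post,
      post_tensorHom, s222_pre22, s222_pre21, s222_pre21_outer])
  lam_naturality f := extUnit (by
    rw [post_post_tensorHom, pre21_id, ← comp_s201, s201_leftUnit, ← post_comp, ← s201_comp,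
      s201_leftUnit, Category.comp_id, Category.id_comp])
  ρ_naturality f := by
    rw [rightUnit, rightUnit, s202_comp, post_tensorHom, pre22_id, s202_pre21_outer]
  pentagon a b c d := ext₄ (by
    rw [post_post_tensorHom, pre22_id, ← s221_post, ← s231_s221, s221_assoc, s231_s222,
      ← post_comp, ← post_s221, s221_assoc, post_s222, post_tensorHom, pre21_id, ← s222_post,
      ← s232_s221, s221_assoc, ← post_comp, ← post_s221, s221_assoc, post_s222, ← s323_s221,
      s221_assoc, s232_s222])
  lam_tensor a b := extUnit₂ (by
    rw [← post_comp, ← post_s221, s221_assoc, post_s222, ← post_s201, s201_leftUnit, post_id,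
      post_tensorHom, pre22_id, ← s221_post, ← pre21_s201, s201_leftUnit, pre21_id])
  ρ_tensor a b := ext₂ (by
    rw [rightUnit, s202_comp, ← s303_s221, s221_assoc, ← pre22_s202, post_tensorHom, pre21_id,
      rightUnit])
  ρ_α_lam a b := ext₂ (by
    rw [post_post_tensorHom, pre22_id, rightUnit, pre21_s202, ← post_comp, ← post_s221, s221_assoc,
      post_s222, post_tensorHom, pre21_id, ← s222_post, ← pre22_s201, s201_leftUnit, pre22_id,
      post_id])
  ρ_lam := ext₀ (by
    rw [rightUnit, s202_comp, ← post_s201_nullary, s201_leftUnit])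

lemma isIso_leftUnit (a : C.Obj) : IsIso (R.leftUnit a) := by
  have h1 : s201 (R.θ R.i a) R.u ≫ R.leftUnit a = 𝟙 a := by rw [s201_comp, s201_leftUnit]
  have h2 : R.leftUnit a ≫ s201 (R.θ R.i a) R.u = 𝟙 _ := extUnit (by
    rw [← post_comp, ← s201_comp, s201_leftUnit, Category.id_comp, post_id])
  exact ⟨⟨_, h2, h1⟩⟩

lemma skew_leftNormal : R.skew.LeftNormal := R.isIso_leftUnit

/-- The skew monoidal category of a closed left representable short multicategory is closed. -/
lemma skew_closed (h : C.Closed) : R.skew.Closed := fun (b : C.Obj) => by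
  choose H e he using h b
  have key : ∀ a c : C.Obj, Function.Bijective (fun f : a ⟶ H c => (pre21 (e c) f : C.M2 a b c)) :=
    fun a c => he c [a] (by simp)
  let E : ∀ a c : C.Obj, (R.m a b ⟶ c) ≃ (a ⟶ H c) := fun a c =>
    (Equiv.ofBijective _ (R.bij_θ a b c)).trans (Equiv.ofBijective _ (key a c)).symm
  have hE : ∀ (a c : C.Obj) (g : R.m a b ⟶ c), pre21 (e c) (E a c g) = post (R.θ a b) g :=
    fun a c g => (Equiv.ofBijective _ (key a c)).apply_symm_apply _
  have nat : ∀ (a' a c : C.Obj) (f : a' ⟶ a) (g : R.m a b ⟶ c),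
      E a' c (R.tensorHom f (𝟙 b) ≫ g) = f ≫ E a c g := fun a' a c f g => (key a' c).1 (by
    change pre21 (e c) (E a' c (R.tensorHom f (𝟙 b) ≫ g)) = pre21 (e c) (f ≫ E a c g)
    rw [hE, pre21_comp, hE, post_post_tensorHom, pre22_id])
  exact (Adjunction.adjunctionOfEquivRight (F := R.skew.tensorRight b) (G_obj := H) E
    nat).isLeftAdjoint

end Classifiers

/-- Classifiers chosen from left representability. -/
noncomputable def LeftRepresentable.classifiers {C : ShortMulticategory.{v, u}}
    (h : C.LeftRepresentable) : C.Classifiers where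
  i := h.1.choose
  u := h.1.choose_spec.choose
  u_universal := h.1.choose_spec.choose_spec
  m a b := (h.2 a b).choose
  θ a b := (h.2 a b).choose_spec.choose
  θ_universal a b := (h.2 a b).choose_spec.choose_spec

end ShortMulticategory

namespace ShortMultifunctor

open ShortMulticategory ShortMulticategory.Classifiers

variable {C D : ShortMulticategory.{v, u}} (F : ShortMultifunctor C D)
  (R : C.Classifiers) (S : D.Classifiers)

/-- The unique unary map `f₀` with `f₀ ∘ u = F u`. -/
noncomputable def lax₀ : S.i ⟶ F.obj R.i := S.desc₀ (F.map0 R.u)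

/-- The unique unary map `f₂` with `f₂ ∘ θ = F θ`. -/
noncomputable def lax₂ (a b : C.Obj) : S.m (F.obj a) (F.obj b) ⟶ F.obj (R.m a b) :=
  S.desc₂ (F.map2 (R.θ a b))

lemma post_lax₀ : post S.u (F.lax₀ R S) = F.map0 R.u := S.post_desc₀ _

lemma post_lax₂ (a b : C.Obj) :
    post (S.θ (F.obj a) (F.obj b)) (F.lax₂ R S a b) = F.map2 (R.θ a b) := S.post_desc₂ _

lemma lax₂_naturality {a b a' b' : C.Obj} (f : a ⟶ a') (g : b ⟶ b') :
    S.tensorHom (F.map1 f) (F.map1 g) ≫ F.lax₂ R S a' b' =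
      F.lax₂ R S a b ≫ F.map1 (R.tensorHom f g) := ext₂ (by
  rw [post_post_tensorHom, post_lax₂, ← map2_pre21, ← map2_pre22, ← post_comp, post_lax₂,
    ← map2_post, post_tensorHom])

lemma lax_associativity (a b c : C.Obj) :
    S.tensorHom (F.lax₂ R S a b) (𝟙 (F.obj c)) ≫ F.lax₂ R S (R.m a b) c ≫
        F.map1 (R.assoc a b c) =
      S.assoc (F.obj a) (F.obj b) (F.obj c) ≫
        S.tensorHom (𝟙 (F.obj a)) (F.lax₂ R S b c) ≫ F.lax₂ R S a (R.m b c) := ext₃ (by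
  rw [post_post_tensorHom, pre22_id, ← s221_post, post_lax₂, ← post_comp, post_lax₂, ← map2_post,
    ← map3_s221, s221_assoc, map3_s222, ← post_comp, ← post_s221, s221_assoc, post_s222,
    post_post_tensorHom, pre21_id, ← s222_post, post_lax₂, post_lax₂])

lemma lax_left_unitality (a : C.Obj) :
    S.tensorHom (F.lax₀ R S) (𝟙 (F.obj a)) ≫ F.lax₂ R S R.i a ≫ F.map1 (R.leftUnit a) =
      S.leftUnit (F.obj a) := extUnit (by
  rw [post_post_tensorHom, pre22_id, ← s201_post, post_lax₀, ← post_comp, post_lax₂, ← map2_post,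
    ← map_s201, s201_leftUnit, s201_leftUnit, map1_id])

lemma lax_right_unitality (a : C.Obj) :
    S.rightUnit (F.obj a) ≫ S.tensorHom (𝟙 (F.obj a)) (F.lax₀ R S) ≫ F.lax₂ R S a R.i =
      F.map1 (R.rightUnit a) := by
  rw [rightUnit, s202_comp, post_post_tensorHom, pre21_id, ← s202_post, post_lax₀, post_lax₂,
    ← map_s202, rightUnit]

/-- The lax monoidal functor of a morphism of left representable short multicategories. -/
noncomputable def lax : LaxMonoidalFunctor R.skew S.skew where
  functor := F.toFunctor
  f₀ := F.lax₀ R S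
  f₂ := F.lax₂ R S
  f₂_naturality := F.lax₂_naturality R S
  associativity := F.lax_associativity R S
  left_unitality := F.lax_left_unitality R S
  right_unitality := F.lax_right_unitality R S

lemma lax_id : (idm C).lax R R = LaxMonoidalFunctor.idm R.skew := by
  refine LaxMonoidalFunctor.ext rfl (heq_of_eq (ext₀ (R := R) ?_)) (heq_of_eq ?_)
  · exact ((idm C).post_lax₀ R R).trans (post_id R.u).symm
  · funext a b
    exact ext₂ (R := R) (((idm C).post_lax₂ R R a b).trans (post_id (R.θ a b)).symm)

lemma lax₀_comp {E : ShortMulticategory.{v, u}} (G : ShortMultifunctor D E) (T : E.Classifiers) :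
    (F.comp G).lax₀ R T = G.lax₀ S T ≫ G.map1 (F.lax₀ R S) := by
  have h : post T.u (G.lax₀ S T ≫ G.map1 (F.lax₀ R S)) = G.map0 (F.map0 R.u) := by
    rw [← post_comp, post_lax₀ G, ← map0_post, post_lax₀ F]
  exact ext₀ (R := T) (((F.comp G).post_lax₀ R T).trans h.symm)

lemma lax₂_comp {E : ShortMulticategory.{v, u}} (G : ShortMultifunctor D E) (T : E.Classifiers)
    (a b : C.Obj) :
    (F.comp G).lax₂ R T a b = G.lax₂ S T (F.obj a) (F.obj b) ≫ G.map1 (F.lax₂ R S a b) := by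
  have h : post (T.θ (G.obj (F.obj a)) (G.obj (F.obj b)))
      (G.lax₂ S T (F.obj a) (F.obj b) ≫ G.map1 (F.lax₂ R S a b)) =
        G.map2 (F.map2 (R.θ a b)) := by
    rw [← post_comp, post_lax₂ G, ← map2_post, post_lax₂ F]
  exact ext₂ (R := T) (((F.comp G).post_lax₂ R T a b).trans h.symm)

lemma lax_comp {E : ShortMulticategory.{v, u}} (G : ShortMultifunctor D E) (T : E.Classifiers) :
    (F.comp G).lax R T = (F.lax R S).comp (G.lax S T) :=
  LaxMonoidalFunctor.ext rfl (heq_of_eq (F.lax₀_comp R S G T))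
    (heq_of_eq (funext fun a => funext fun b => F.lax₂_comp R S G T a b))

end ShortMultifunctor

/-! ### The categories and functors of the triangle -/

/-- The category of left representable short multicategories. -/
abbrev ShortLR : Type _ :=
  ObjectProperty.FullSubcategory (fun C : ShortMulticategory.{v, u} => C.LeftRepresentable)

/-- The category of left normal skew monoidal categories. -/
abbrev SkewMonLN : Type _ :=
  ObjectProperty.FullSubcategory (fun V : SkewMonoidalCategory.{v, u} => V.LeftNormal)

/-- The category of left representable closed multicategories. -/
abbrev MultiLRCl : Type _ :=
  ObjectProperty.FullSubcategory (fun C : Multicategory.{v, u} => C.LeftRepresentable ∧ C.Closed)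

/-- The category of left representable closed short multicategories. -/
abbrev ShortLRCl : Type _ :=
  ObjectProperty.FullSubcategory
    (fun C : ShortMulticategory.{v, u} => C.LeftRepresentable ∧ C.Closed)

/-- The category of left normal closed skew monoidal categories. -/
abbrev SkewMonLNCl : Type _ :=
  ObjectProperty.FullSubcategory
    (fun V : SkewMonoidalCategory.{v, u} => V.LeftNormal ∧ V.Closed)

/-- The functor `K` from left representable short multicategories to left normal skew monoidal
categories. -/
noncomputable def K : ShortLR.{v, u} ⥤ SkewMonLN.{v, u} where
  obj C := ⟨C.property.classifiers.skew, C.property.classifiers.skew_leftNormal⟩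
  map {C D} F := ObjectProperty.homMk
    (ShortMultifunctor.lax F.hom C.property.classifiers D.property.classifiers)
  map_id C := ObjectProperty.hom_ext _ (ShortMultifunctor.lax_id C.property.classifiers)
  map_comp {C D E} F G := ObjectProperty.hom_ext _
    (ShortMultifunctor.lax_comp F.hom C.property.classifiers D.property.classifiers G.hom
      E.property.classifiers)

/-- The inclusion of the closed left representable short multicategories. -/
abbrev inclShort : ShortLRCl.{v, u} ⥤ ShortLR.{v, u} :=
  ObjectProperty.ιOfLE (fun _ h => h.1)

/-- The inclusion of the closed left normal skew monoidal categories. -/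
abbrev inclSkew : SkewMonLNCl.{v, u} ⥤ SkewMonLN.{v, u} :=
  ObjectProperty.ιOfLE (fun _ h => h.1)

/-- The restriction of `K` to closed objects. -/
noncomputable def Kcl : ShortLRCl.{v, u} ⥤ SkewMonLNCl.{v, u} :=
  ObjectProperty.lift _ (inclShort ⋙ K ⋙ ObjectProperty.ι _)
    (fun C => ⟨(K.obj (inclShort.obj C)).property,
      (inclShort.obj C).property.classifiers.skew_closed C.property.2⟩)

/-! ### From left representable multicategories to skew monoidal categories -/

namespace Multicategory

/-- A choice of left universal map classifiers. -/
structure Classifiers (C : Multicategory.{v, u}) where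
  m : List C.Obj → C.Obj
  θ : ∀ L : List C.Obj, C.Hom L (m L)
  universal : ∀ L : List C.Obj, C.IsLeftUniversal (θ L)

/-- Classifiers chosen from left representability. -/
noncomputable def LeftRepresentable.classifiers {C : Multicategory.{v, u}}
    (h : C.LeftRepresentable) : C.Classifiers where
  m L := (h L).choose
  θ L := (h L).choose_spec.choose
  universal L := (h L).choose_spec.choose_spec

namespace Classifiers

variable {C : Multicategory.{v, u}} (R : C.Classifiers) {a b c d : C.Obj}

/-- The nullary and binary classifiers among `R`. -/
def toShort : (forgetShort.obj C).Classifiers where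
  i := R.m []
  u := R.θ []
  u_universal := fun x _ d => R.universal [] x d
  m a b := R.m [a, b]
  θ a b := R.θ [a, b]
  θ_universal a b := fun x _ d => R.universal [a, b] x d

/-- The unique multimap `g` with `g ∘₁ θ = f`. -/
noncomputable def lift (L x : List C.Obj) (f : C.Hom (L ++ x) d) : C.Hom (R.m L :: x) d :=
  (Equiv.ofBijective _ (R.universal L x d)).symm f

/-- The tensor product of unary maps, determined by `(f ⊗ g) ∘ θ = (θ ∘₁ f) ∘₂ g`. -/
noncomputable def tensorHom (f : a ⟶ b) (g : c ⟶ d) : R.m [a, c] ⟶ R.m [b, d] :=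
  R.lift [a, c] []
    (C.sub (L := [a, d]) [a] [] rfl rfl (C.sub [] [d] rfl rfl (R.θ [b, d]) f) g)

/-- The associator, determined by `(α ∘ θ) ∘₁ θ = θ ∘₂ θ`. -/
noncomputable def assoc (a b c : C.Obj) : R.m [R.m [a, b], c] ⟶ R.m [a, R.m [b, c]] :=
  R.lift [R.m [a, b], c] [] (R.lift [a, b] [c]
    (C.sub [a] [] rfl rfl (R.θ [a, R.m [b, c]]) (R.θ [b, c])))

/-- The left unit map, determined by `(λ ∘ θ) ∘₁ u = 1`. -/
noncomputable def leftUnit (a : C.Obj) : R.m [R.m [], a] ⟶ a :=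
  R.lift [R.m [], a] [] (R.lift [] [a] (C.id a))

/-- The right unit map `θ ∘₂ u`. -/
def rightUnit (a : C.Obj) : a ⟶ R.m [a, R.m []] :=
  C.sub [a] [] rfl rfl (R.θ [a, R.m []]) (R.θ [])

/-- The skew monoidal category of a left representable multicategory. -/
noncomputable def skew : SkewMonoidalCategory.{v, u} where
  carrier := C.Obj
  tensorObj a b := R.m [a, b]
  tensorHom := R.tensorHom
  unit := R.m []
  α := R.assoc
  lam := R.leftUnit
  ρ := R.rightUnit
  tensor_id := R.toShort.skew.tensor_id
  tensor_comp := R.toShort.skew.tensor_comp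
  α_naturality := R.toShort.skew.α_naturality
  lam_naturality := R.toShort.skew.lam_naturality
  ρ_naturality := R.toShort.skew.ρ_naturality
  pentagon := R.toShort.skew.pentagon
  lam_tensor := R.toShort.skew.lam_tensor
  ρ_tensor := R.toShort.skew.ρ_tensor
  ρ_α_lam := R.toShort.skew.ρ_α_lam
  ρ_lam := R.toShort.skew.ρ_lam

lemma skew_eq : R.skew = R.toShort.skew := rfl

end Classifiers

end Multicategory

namespace Multifunctor

variable {C D : Multicategory.{v, u}} (F : Multifunctor C D) (R : C.Classifiers) (S : D.Classifiers)

/-- The underlying functor on unary maps. -/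
def toFunctor : C.Obj ⥤ D.Obj where
  obj := F.obj
  map {a b} f := (F.map (L := [a]) (L' := [F.obj a]) rfl f : D.Hom _ _)
  map_id a := F.map_id a
  map_comp f g := F.map_sub [] [] rfl rfl rfl rfl rfl g f

/-- The lax monoidal functor of a multifunctor between left representable multicategories: `f₀` and
`f₂` are determined by `f₀ ∘ u = F u` and `f₂ ∘ θ = F θ`. -/
noncomputable def lax : LaxMonoidalFunctor R.skew S.skew where
  functor := F.toFunctor
  f₀ := S.lift [] [] (F.map rfl (R.θ []))
  f₂ a b := S.lift [F.obj a, F.obj b] [] (F.map rfl (R.θ [a, b]))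
  f₂_naturality := ((forgetShort.map F).lax R.toShort S.toShort).f₂_naturality
  associativity := ((forgetShort.map F).lax R.toShort S.toShort).associativity
  left_unitality := ((forgetShort.map F).lax R.toShort S.toShort).left_unitality
  right_unitality := ((forgetShort.map F).lax R.toShort S.toShort).right_unitality

lemma lax_eq : F.lax R S = (forgetShort.map F).lax R.toShort S.toShort := rfl

end Multifunctor

lemma forgetShort_leftRepresentable {C : Multicategory.{v, u}} (h : C.LeftRepresentable) :
    (forgetShort.obj C).LeftRepresentable :=
  ⟨⟨_, _, h.classifiers.toShort.u_universal⟩,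
    fun a b => ⟨_, _, h.classifiers.toShort.θ_universal a b⟩⟩

lemma forgetShort_closed {C : Multicategory.{v, u}} (h : C.Closed) :
    (forgetShort.obj C).Closed := fun b c => by
  obtain ⟨H, e, he⟩ := h b c
  exact ⟨H, e, fun x _ => he x⟩

/-- The restriction of the forgetful functor to left representable closed multicategories. -/
def Ucl : MultiLRCl.{v, u} ⥤ ShortLRCl.{v, u} :=
  ObjectProperty.lift _ (ObjectProperty.ι _ ⋙ forgetShort)
    (fun C => ⟨forgetShort_leftRepresentable C.property.1, forgetShort_closed C.property.2⟩)

/-- The functor `T` from left representable closed multicategories to left normal closed skew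
monoidal categories. -/
noncomputable def Tcl : MultiLRCl.{v, u} ⥤ SkewMonLNCl.{v, u} where
  obj C := ⟨C.property.1.classifiers.skew,
    C.property.1.classifiers.toShort.skew_leftNormal,
    C.property.1.classifiers.toShort.skew_closed (forgetShort_closed C.property.2)⟩
  map {C D} F := ObjectProperty.homMk
    (Multifunctor.lax F.hom C.property.1.classifiers D.property.1.classifiers)
  map_id C := ObjectProperty.hom_ext _
    (ShortMultifunctor.lax_id C.property.1.classifiers.toShort)
  map_comp {C D E} F G := ObjectProperty.hom_ext _
    (ShortMultifunctor.lax_comp (forgetShort.map F.hom) C.property.1.classifiers.toShort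
      D.property.1.classifiers.toShort (forgetShort.map G.hom)
      E.property.1.classifiers.toShort)

end ShortMult

/-! `K`, `Kcl` and `Tcl` are each shown to be fully faithful and essentially surjective; `Ucl` is
then an equivalence by two-out-of-three along `triangleIso`.

Essential surjectivity. A skew monoidal `V` yields a multicategory whose maps `a₁, …, aₙ → b` are
the morphisms `(⋯(i ⊗ a₁) ⊗ ⋯) ⊗ aₙ ⟶ b`. A multimap `f` from `Δ` to `b` induces, naturally in `x`,
a morphism `whisker Δ f x : act Δ x ⟶ x ⊗ b`: insert a unit with `ρ`, move `x` out by associators in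
their given direction, apply `f`. Substituting `f` behind the variables `Γ₁` is precomposition with
this morphism at `x = act Γ₁ i`. Whiskering turns substitution into composition (`whisker_subMap`),
which gives associativity; naturality in `x` gives the commutation law. Left normality enters
through `whisker Δ f i ≫ λ = f`: an invertible `f` is invertible after whiskering by the unit, hence
left universal. The classifiers `λ ⊗ 1` and `1_i` whisker to `α` and `ρ`, so `f ↦ λ ≫ f` is a strict
isomorphism from `V` to the skew monoidal category of its multicategory (`LeftNormal.skewIso`). An
adjoint of `- ⊗ b` provides internal homs.

Full faithfulness. In a left representable multicategory every multimap arises from a unary one by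
substituting `u`, or repeatedly `θ`, into the first variable, and in only one way. Hence a lax
monoidal functor has at most one extension to multimaps, and only preservation of substitution is at
issue. For substitution of the generators (unary maps, `θ`, `u`) into the first two variables this
amounts to functoriality, naturality of `f₂`, the associativity axiom and the two unit axioms,
together with the recursive definition of the extension. Later variables follow from the commutation
law (`preservesAt_cons`), arbitrary multimaps from associativity (`Preserves.sub`). The
substitutions and laws used are among those of a short multicategory, so one argument in a
`BoundedMulticategory` covers both the short and the unbounded case. -/

namespace ShortMult

/-! ### The multicategory of a skew monoidal category -/

namespace SkewMonoidalCategory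

variable (V : SkewMonoidalCategory.{v, u})

/-- The iterated tensor product `(⋯(x ⊗ a₁) ⊗ ⋯) ⊗ aₙ`. -/
def act : List V.carrier → V.carrier → V.carrier
  | [], x => x
  | a :: L, x => act L (V.tensorObj x a)

/-- The functorial action of `act L`. -/
def actMap : ∀ (L : List V.carrier) {x y : V.carrier}, (x ⟶ y) → (V.act L x ⟶ V.act L y)
  | [], _, _, f => f
  | a :: L, _, _, f => actMap L (V.tensorHom f (𝟙 a))

/-- The iterated associator. -/
def strength : ∀ (L : List V.carrier) (x y : V.carrier),
    V.act L (V.tensorObj x y) ⟶ V.tensorObj x (V.act L y)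
  | [], _, _ => 𝟙 _
  | a :: L, x, y => V.actMap L (V.α x y a) ≫ strength L x (V.tensorObj y a)

/-- The map `(⋯(x ⊗ a₁) ⊗ ⋯) ⊗ aₙ ⟶ x ⊗ b` induced by a map `(⋯(i ⊗ a₁) ⊗ ⋯) ⊗ aₙ ⟶ b`. -/
def whisker (L : List V.carrier) {b : V.carrier} (f : V.act L V.unit ⟶ b) (x : V.carrier) :
    V.act L x ⟶ V.tensorObj x b :=
  V.actMap L (V.ρ x) ≫ V.strength L x V.unit ≫ V.tensorHom (𝟙 x) f

variable {V} {a b c d x y z x' y' : V.carrier}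

/-! ### Iterated tensor products and iterated associators -/

lemma tensor_id_comp (f : a ⟶ b) (g : b ⟶ c) :
    V.tensorHom (𝟙 x) (f ≫ g) = V.tensorHom (𝟙 x) f ≫ V.tensorHom (𝟙 x) g := by
  rw [← V.tensor_comp, Category.id_comp]

lemma tensor_comp_id (f : a ⟶ b) (g : b ⟶ c) :
    V.tensorHom (f ≫ g) (𝟙 x) = V.tensorHom f (𝟙 x) ≫ V.tensorHom g (𝟙 x) := by
  rw [← V.tensor_comp, Category.id_comp]

lemma tensor_comp_id_assoc (f : a ⟶ b) (g : b ⟶ c) (h : V.tensorObj c x ⟶ d) :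
    V.tensorHom (f ≫ g) (𝟙 x) ≫ h = V.tensorHom f (𝟙 x) ≫ V.tensorHom g (𝟙 x) ≫ h := by
  rw [tensor_comp_id, Category.assoc]

lemma tensor_exchange (f : a ⟶ b) (g : c ⟶ d) :
    V.tensorHom f (𝟙 c) ≫ V.tensorHom (𝟙 b) g = V.tensorHom (𝟙 a) g ≫ V.tensorHom f (𝟙 d) := by
  rw [← V.tensor_comp, ← V.tensor_comp, Category.id_comp, Category.id_comp, Category.comp_id,
    Category.comp_id]

@[simp]
lemma actMap_id (L : List V.carrier) (x : V.carrier) : V.actMap L (𝟙 x) = 𝟙 (V.act L x) := by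
  induction L generalizing x with
  | nil => rfl
  | cons a L ih => rw [actMap, V.tensor_id, ih]; rfl

lemma actMap_comp (L : List V.carrier) (f : x ⟶ y) (g : y ⟶ z) :
    V.actMap L (f ≫ g) = V.actMap L f ≫ V.actMap L g := by
  induction L generalizing x y z with
  | nil => rfl
  | cons a L ih => rw [actMap, tensor_comp_id, ih]; rfl

lemma actMap_comp_assoc (L : List V.carrier) (f : x ⟶ y) (g : y ⟶ z) (h : V.act L z ⟶ a) :
    V.actMap L (f ≫ g) ≫ h = V.actMap L f ≫ V.actMap L g ≫ h := by
  rw [actMap_comp, Category.assoc]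

lemma isIso_actMap (L : List V.carrier) (f : x ⟶ y) [IsIso f] : IsIso (V.actMap L f) :=
  ⟨V.actMap L (inv f), by rw [← actMap_comp, IsIso.hom_inv_id, actMap_id],
    by rw [← actMap_comp, IsIso.inv_hom_id, actMap_id]⟩

lemma actMap_eqToHom (L : List V.carrier) (e : x = y) :
    V.actMap L (eqToHom e) = eqToHom (by rw [e]) := by
  subst e
  simp

/-- The source of the transports below: `act` recurses from the front of the list, so this equation
is definitional for an explicit `L` but not for a variable one. -/
lemma act_append (L M : List V.carrier) (x : V.carrier) :
    V.act (L ++ M) x = V.act M (V.act L x) := by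
  induction L generalizing x with
  | nil => rfl
  | cons a L ih => exact ih _

lemma actMap_append (L M : List V.carrier) (f : x ⟶ y) :
    V.actMap (L ++ M) f =
      eqToHom (act_append L M x) ≫ V.actMap M (V.actMap L f) ≫
        eqToHom (act_append L M y).symm := by
  induction L generalizing x y with
  | nil => exact ((Category.id_comp _).trans (Category.comp_id _)).symm
  | cons a L ih => exact ih _

lemma strength_naturality (L : List V.carrier) (f : x ⟶ x') (g : y ⟶ y') :
    V.actMap L (V.tensorHom f g) ≫ V.strength L x' y' =
      V.strength L x y ≫ V.tensorHom f (V.actMap L g) := by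
  induction L generalizing y y' with
  | nil => simp [actMap, strength, act]
  | cons a L ih =>
    simp only [actMap, strength, act]
    rw [← Category.assoc, ← actMap_comp, V.α_naturality, actMap_comp, Category.assoc, ih,
      Category.assoc]

lemma strength_append (L M : List V.carrier) (x y : V.carrier) :
    V.strength (L ++ M) x y =
      eqToHom (act_append L M _) ≫ V.actMap M (V.strength L x y) ≫ V.strength M x (V.act L y) ≫
        V.tensorHom (𝟙 x) (eqToHom (act_append L M y).symm) := by
  induction L generalizing y with
  | nil =>
    change V.strength M x y =
      𝟙 _ ≫ V.actMap M (𝟙 _) ≫ V.strength M x y ≫ V.tensorHom (𝟙 x) (𝟙 _)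
    simp [V.tensor_id]
  | cons a L ih =>
    simp only [List.cons_append, strength, act, ih, actMap_append, Category.assoc,
      eqToHom_trans_assoc, actMap_comp, eqToHom_refl, Category.id_comp]

/-- The pentagon, used once for each object of `L`; `strength_naturality` carries the associator
past the remaining list. -/
lemma strength_assoc (L : List V.carrier) (x y z : V.carrier) :
    V.strength L (V.tensorObj x y) z ≫ V.α x y (V.act L z) =
      V.actMap L (V.α x y z) ≫ V.strength L x (V.tensorObj y z) ≫
        V.tensorHom (𝟙 x) (V.strength L y z) := by
  induction L generalizing z with
  | nil => simp [strength, act, actMap, tensor_id]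
  | cons a L ih =>
    simp only [strength, act, actMap, Category.assoc, ih]
    rw [tensor_id_comp, reassoc_of% (strength_naturality L (𝟙 x) (V.α y z a)).symm]
    simp only [← Category.assoc, ← actMap_comp]
    rw [Category.assoc (V.tensorHom _ _), V.pentagon]

/-- The axiom `lam_tensor`, used once for each object of `L`. -/
lemma strength_lam (L : List V.carrier) (y : V.carrier) :
    V.strength L V.unit y ≫ V.lam (V.act L y) = V.actMap L (V.lam y) := by
  induction L generalizing y with
  | nil => simp [strength, act, actMap]
  | cons a L ih =>
    simp only [strength, act, actMap, Category.assoc, ih]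
    rw [← actMap_comp, V.lam_tensor]

/-! ### Whiskering a multimap by an object -/

lemma whisker_naturality (L : List V.carrier) (f : V.act L V.unit ⟶ b) (g : x ⟶ y) :
    V.actMap L g ≫ V.whisker L f y = V.whisker L f x ≫ V.tensorHom g (𝟙 b) := by
  simp only [whisker, Category.assoc]
  rw [← tensor_exchange, ← V.actMap_id L V.unit, ← reassoc_of% strength_naturality]
  simp only [← Category.assoc, ← actMap_comp, V.ρ_naturality]

lemma whisker_comp (L : List V.carrier) (f : V.act L V.unit ⟶ b) (g : b ⟶ c) (x : V.carrier) :
    V.whisker L (f ≫ g) x = V.whisker L f x ≫ V.tensorHom (𝟙 x) g := by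
  simp only [whisker, tensor_id_comp, Category.assoc]

/-- The strength is absorbed by `strength_lam`, and the inserted unit cancels by `ρ_lam`. A multimap
is thus recovered from its whiskering at the unit. -/
lemma whisker_unit_lam (L : List V.carrier) (f : V.act L V.unit ⟶ b) :
    V.whisker L f V.unit ≫ V.lam b = f := by
  rw [whisker, Category.assoc, Category.assoc, V.lam_naturality,
    ← Category.assoc (V.strength _ _ _), strength_lam, ← Category.assoc, ← actMap_comp, V.ρ_lam,
    actMap_id, Category.id_comp]

lemma whisker_unit_lam_assoc (L : List V.carrier) (f : V.act L V.unit ⟶ b) (h : b ⟶ c) :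
    V.whisker L f V.unit ≫ V.lam b ≫ h = f ≫ h := by
  rw [← Category.assoc, whisker_unit_lam]

/-- This is the axiom `ρ_α_lam`; it makes `λ` the identity multimap. -/
lemma whisker_lam (b x : V.carrier) : V.whisker [b] (V.lam b) x = 𝟙 _ := by
  simp only [whisker, actMap, strength, act, Category.assoc, Category.id_comp]
  exact V.ρ_α_lam x b

/-- By `ρ_tensor` the unit inserted behind `x ⊗ y` may be inserted behind `y` alone, and
`strength_assoc` splits the iterated associator accordingly. Up to `α`, whiskering by `x ⊗ y` is
whiskering by `y` inside `x ⊗ -`. -/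
lemma whisker_assoc (L : List V.carrier) (f : V.act L V.unit ⟶ b) (x y : V.carrier) :
    V.whisker L f (V.tensorObj x y) ≫ V.α x y b =
      V.strength L x y ≫ V.tensorHom (𝟙 x) (V.whisker L f y) := by
  have h := V.α_naturality (𝟙 x) (𝟙 y) f
  rw [V.tensor_id] at h
  rw [whisker, Category.assoc, Category.assoc, h, ← Category.assoc (V.strength _ _ _),
    strength_assoc, Category.assoc, Category.assoc, ← Category.assoc, ← actMap_comp, V.ρ_tensor,
    ← Category.assoc, strength_naturality, whisker, tensor_id_comp, tensor_id_comp,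
    Category.assoc]

lemma whisker_obj (L : List V.carrier) (f : V.act L V.unit ⟶ b) (h : x = y) :
    V.whisker L f x = eqToHom (by rw [h]) ≫ V.whisker L f y ≫ eqToHom (by rw [h]) := by
  subst h
  simp

/-- The unit inserted behind `x` collects the block `L` first, which is the whiskering of an
identity; the block `M` is then moved in by its own strength. -/
lemma whisker_append (L M : List V.carrier) (f : V.act (L ++ M) V.unit ⟶ b) (x : V.carrier) :
    V.whisker (L ++ M) f x =
      eqToHom (act_append L M x) ≫ V.actMap M (V.whisker L (𝟙 _) x) ≫
        V.strength M x (V.act L V.unit) ≫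
          V.tensorHom (𝟙 x) (eqToHom (act_append L M V.unit).symm ≫ f) := by
  simp only [whisker, actMap_append, strength_append, tensor_id_comp, Category.assoc,
    eqToHom_trans_assoc, eqToHom_refl, Category.id_comp, actMap_comp, V.tensor_id, actMap_id]

lemma act_append_cons (L M : List V.carrier) (b x : V.carrier) :
    V.act (L ++ b :: M) x = V.act M (V.tensorObj (V.act L x) b) :=
  act_append L (b :: M) x

/-- Isolates the associator belonging to `b`, the variable into which a multimap will be
substituted. -/
lemma whisker_append_cons (L M : List V.carrier) (f : V.act (L ++ b :: M) V.unit ⟶ c)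
    (x : V.carrier) :
    V.whisker (L ++ b :: M) f x =
      eqToHom (act_append_cons L M b x) ≫ V.actMap M (V.tensorHom (V.whisker L (𝟙 _) x) (𝟙 b)) ≫
        V.actMap M (V.α x (V.act L V.unit) b) ≫
          V.strength M x (V.tensorObj (V.act L V.unit) b) ≫
          V.tensorHom (𝟙 x) (eqToHom (act_append_cons L M b V.unit).symm ≫ f) := by
  refine (whisker_append L (b :: M) f x).trans ?_
  -- Regrouped this way, the associator followed by `strength M` is `strength (b :: M)` by
  -- definition.
  rw [← Category.assoc (V.actMap M (V.α _ _ _))]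
  rfl

/-! ### Substitution as precomposition -/

variable (V)

/-- Precomposition with this map is the substitution of `f`. -/
def subMap {Δ : List V.carrier} (Γ₁ Γ₂ : List V.carrier) (f : V.act Δ V.unit ⟶ b)
    (x : V.carrier) : V.act (Γ₁ ++ Δ ++ Γ₂) x ⟶ V.act (Γ₁ ++ b :: Γ₂) x :=
  eqToHom (by rw [act_append, act_append]) ≫ V.actMap Γ₂ (V.whisker Δ f (V.act Γ₁ x)) ≫
    eqToHom (act_append_cons Γ₁ Γ₂ b x).symm

variable {V}

/-- The core of `whisker_subMap`, with the variables before the substitution hidden in `k`. The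
whiskered `f` slides past `k` by naturality, and `whisker_assoc` trades whiskering by `x ⊗ y` for
whiskering by `y` inside `x ⊗ -`. -/
lemma actMap_whisker {Δ : List V.carrier} (Γ : List V.carrier) (f : V.act Δ V.unit ⟶ b)
    (g : V.act Γ (V.tensorObj y b) ⟶ c) (k : z ⟶ V.tensorObj x y) :
    V.actMap Γ (V.actMap Δ k) ≫ V.actMap Γ (V.strength Δ x y) ≫ V.strength Γ x (V.act Δ y) ≫
        V.tensorHom (𝟙 x) (V.actMap Γ (V.whisker Δ f y) ≫ g) =
      V.actMap Γ (V.whisker Δ f z) ≫ V.actMap Γ (V.tensorHom k (𝟙 b)) ≫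
        V.actMap Γ (V.α x y b) ≫ V.strength Γ x (V.tensorObj y b) ≫ V.tensorHom (𝟙 x) g := by
  rw [tensor_id_comp, ← reassoc_of% strength_naturality]
  simp only [← Category.assoc, ← actMap_comp]
  rw [← whisker_naturality, Category.assoc (V.actMap Δ k), Category.assoc (V.actMap Δ k),
    whisker_assoc]

/-- Whiskering turns substitution into composition; associativity of substitution rests on this. An
arbitrary `x` is needed because an inner substitution takes place behind the variables of the outer
one. -/
lemma whisker_subMap {Δ : List V.carrier} (Γ₁ Γ₂ : List V.carrier) (f : V.act Δ V.unit ⟶ b)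
    (g : V.act (Γ₁ ++ b :: Γ₂) V.unit ⟶ c) (x : V.carrier) :
    V.whisker (Γ₁ ++ Δ ++ Γ₂) (V.subMap Γ₁ Γ₂ f V.unit ≫ g) x =
      V.subMap Γ₁ Γ₂ f x ≫ V.whisker (Γ₁ ++ b :: Γ₂) g x := by
  -- The block `Γ₁` enters as `k`, its whiskering with the identity of `act Γ₁ i`.
  have h := actMap_whisker Γ₂ f (eqToHom (act_append_cons Γ₁ Γ₂ b V.unit).symm ≫ g)
    (V.whisker Γ₁ (𝟙 _) x)
  rw [whisker_append (Γ₁ ++ Δ), whisker_append Γ₁ Δ, whisker_append_cons Γ₁ Γ₂]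
  simp only [subMap, Category.assoc, eqToHom_trans_assoc, actMap_comp, actMap_eqToHom,
    Category.comp_id, eqToHom_refl, Category.id_comp] at h ⊢
  rw [← h, ← Category.assoc (V.actMap Γ₂ (V.tensorHom _ _)), strength_naturality]
  simp only [Category.assoc, ← tensor_id_comp, actMap_eqToHom, eqToHom_trans_assoc, eqToHom_refl,
    Category.id_comp]

lemma actMap_append_cons (L M : List V.carrier) (c : V.carrier) (f : x ⟶ y) :
    V.actMap (L ++ c :: M) f =
      eqToHom (act_append_cons L M c x) ≫ V.actMap M (V.tensorHom (V.actMap L f) (𝟙 c)) ≫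
        eqToHom (act_append_cons L M c y).symm :=
  actMap_append L (c :: M) f

/-- Further variables on either side are absorbed into the two lists that mark the position. -/
lemma actMap_subMap {Δ : List V.carrier} (Γ₁ Γ₂ Δ₁ Δ₂ : List V.carrier)
    (f : V.act Δ V.unit ⟶ b) (x : V.carrier) :
    V.actMap Γ₂ (V.subMap Δ₁ Δ₂ f (V.act Γ₁ x)) =
      eqToHom (by simp only [act_append]) ≫ V.subMap (Γ₁ ++ Δ₁) (Δ₂ ++ Γ₂) f x ≫
        eqToHom (by rw [act_append_cons, act_append_cons, act_append, act_append]) := by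
  rw [subMap, subMap, whisker_obj Δ f (act_append Γ₁ Δ₁ x), actMap_append]
  simp only [actMap_comp, actMap_eqToHom, Category.assoc, eqToHom_trans, eqToHom_trans_assoc]

lemma subMap_comp {Δ : List V.carrier} (Γ₁ Γ₂ Δ₁ Δ₂ : List V.carrier)
    (f : V.act Δ V.unit ⟶ b) (g : V.act (Δ₁ ++ b :: Δ₂) V.unit ⟶ c) (x : V.carrier) :
    V.subMap Γ₁ Γ₂ (V.subMap Δ₁ Δ₂ f V.unit ≫ g) x =
      eqToHom (by simp) ≫ V.subMap (Γ₁ ++ Δ₁) (Δ₂ ++ Γ₂) f x ≫ eqToHom (by simp) ≫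
        V.subMap Γ₁ Γ₂ g x := by
  rw [subMap, whisker_subMap, actMap_comp, actMap_subMap, subMap.eq_def V Γ₁ Γ₂ g]
  simp only [Category.assoc, eqToHom_trans_assoc]

/-- The left substitution changes only the object by which the right multimap `f` is whiskered, so
the law is `whisker_naturality` for `f`; the rest is transport. -/
lemma subMap_comm {M E : List V.carrier} (Γ₁ Γ₂ Γ₃ : List V.carrier)
    (g : V.act M V.unit ⟶ b) (f : V.act E V.unit ⟶ c) (x : V.carrier) :
    V.subMap (Γ₁ ++ M ++ Γ₂) Γ₃ f x ≫ eqToHom (by simp) ≫ V.subMap Γ₁ (Γ₂ ++ c :: Γ₃) g x =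
      eqToHom (by simp) ≫ V.subMap Γ₁ (Γ₂ ++ E ++ Γ₃) g x ≫ eqToHom (by simp) ≫
        V.subMap (Γ₁ ++ b :: Γ₂) Γ₃ f x ≫ eqToHom (by simp) := by
  have h := whisker_naturality E f (V.actMap Γ₂ (V.whisker M g (V.act Γ₁ x)))
  simp only [subMap, actMap_append_cons]
  simp only [actMap_append,
    whisker_obj E f (act_append (Γ₁ ++ M) Γ₂ x),
    whisker_obj E f (congrArg (V.act Γ₂) (act_append Γ₁ M x)),
    whisker_obj E f (act_append_cons Γ₁ Γ₂ b x)]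
  simp only [actMap_comp, actMap_eqToHom, Category.assoc, eqToHom_trans, eqToHom_trans_assoc,
    eqToHom_refl, Category.id_comp]
  rw [← actMap_comp_assoc, ← actMap_comp_assoc, h]

lemma subMap_lam (Γ₁ Γ₂ : List V.carrier) (b x : V.carrier) :
    V.subMap Γ₁ Γ₂ (Δ := [b]) (V.lam b) x = eqToHom (by simp) := by
  have h : V.actMap Γ₂ (V.whisker [b] (V.lam b) (V.act Γ₁ x)) =
      𝟙 (V.act Γ₂ (V.tensorObj (V.act Γ₁ x) b)) :=
    (congrArg (V.actMap Γ₂) (whisker_lam b _)).trans (actMap_id _ _)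
  -- The objects here agree only after unfolding `act [b]`, so the cancellation is proved for
  -- abstract objects and matched definitionally.
  have key : ∀ {p q r : V.carrier} (k : q ⟶ q) (e₁ : p = q) (e₂ : q = r), k = 𝟙 q →
      eqToHom e₁ ≫ k ≫ eqToHom e₂ = eqToHom (e₁.trans e₂) := by
    rintro p q r _ rfl rfl rfl
    simp
  exact key _ _ _ h

lemma subMap_nil_nil {Δ : List V.carrier} (f : V.act Δ V.unit ⟶ b) (x : V.carrier) :
    V.subMap [] [] f x = eqToHom (by simp) ≫ V.whisker Δ f x :=
  congrArg (eqToHom _ ≫ ·) (Category.comp_id (V.whisker Δ f x))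

variable (V)

/-- The multicategory of a skew monoidal category. -/
def multicategory : Multicategory.{v, u} where
  Obj := V.carrier
  Hom L b := V.act L V.unit ⟶ b
  id a := V.lam a
  sub Γ₁ Γ₂ eL eL' g f :=
    eqToHom (by rw [eL']) ≫ V.subMap Γ₁ Γ₂ f V.unit ≫ eqToHom (by rw [eL]) ≫ g
  id_sub {Δ b} f := by
    rw [subMap_nil_nil]
    change eqToHom _ ≫ (eqToHom _ ≫ V.whisker Δ f V.unit) ≫ 𝟙 (V.tensorObj V.unit b) ≫ V.lam b = f
    simp [whisker_unit_lam]
  sub_id Γ₁ Γ₂ eL g := by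
    subst eL
    rw [subMap_lam]
    simp
  sub_assoc Γ₁ Γ₂ Δ₁ Δ₂ eL eM eM' eL' eK h g f := by
    subst eL eM eM' eL' eK
    simp only [eqToHom_refl, Category.id_comp, subMap_comp, Category.assoc]
  sub_comm Γ₁ Γ₂ Γ₃ eL eL₁ eL₂ eK h g f := by
    subst eL eL₁ eL₂ eK
    have := congrArg (· ≫ h) (subMap_comm Γ₁ Γ₂ Γ₃ g f V.unit)
    simp only [Category.assoc] at this
    simp only [eqToHom_refl, Category.id_comp]
    exact this

end SkewMonoidalCategory

/-! ### Representability and closedness of the multicategory -/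

namespace SkewMonoidalCategory

variable {V : SkewMonoidalCategory.{v, u}} {a b c d x y z : V.carrier}

lemma bijective_precomp {𝒜 : Type*} [Category 𝒜] {x y : 𝒜} (p : x ⟶ y) [IsIso p] (z : 𝒜) :
    Function.Bijective (fun g : y ⟶ z => p ≫ g) :=
  ⟨fun _ _ h => (cancel_epi p).1 h, fun f => ⟨inv p ≫ f, by simp⟩⟩

/-- Both `λ` and the composite `whisker ≫ λ = θ` are invertible. The argument is confined to the
unit: at other objects the whiskered classifiers are `α` and `ρ`, which need not be invertible. This
is why universality concerns the first variable. -/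
lemma LeftNormal.isIso_whisker (hV : V.LeftNormal) (L : List V.carrier)
    (θ : V.act L V.unit ⟶ b) [IsIso θ] : IsIso (V.whisker L θ V.unit) := by
  have := hV b
  have h : IsIso (V.whisker L θ V.unit ≫ V.lam b) := by rwa [whisker_unit_lam]
  exact IsIso.of_isIso_comp_right _ (V.lam b)

lemma isIso_subMap {Δ : List V.carrier} (Γ₁ Γ₂ : List V.carrier) (f : V.act Δ V.unit ⟶ b)
    (x : V.carrier) [IsIso (V.whisker Δ f (V.act Γ₁ x))] : IsIso (V.subMap Γ₁ Γ₂ f x) := by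
  have := isIso_actMap Γ₂ (V.whisker Δ f (V.act Γ₁ x))
  unfold subMap
  infer_instance

lemma LeftNormal.bijective_sub (hV : V.LeftNormal) (L x : List V.carrier)
    (θ : V.act L V.unit ⟶ b) [IsIso θ] (d : V.carrier) :
    Function.Bijective (fun g : V.act (b :: x) V.unit ⟶ d =>
      eqToHom rfl ≫ V.subMap [] x θ V.unit ≫ eqToHom rfl ≫ g) := by
  -- No variable precedes `θ`, so the whiskering takes place at the unit.
  have : IsIso (V.whisker L θ (V.act [] V.unit)) := hV.isIso_whisker L θ
  have := isIso_subMap [] x θ V.unit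
  have h := bijective_precomp (eqToHom rfl ≫ V.subMap [] x θ V.unit ≫ eqToHom rfl) d
  simp only [Category.assoc] at h
  exact h

/-- Invertible maps `(⋯(i ⊗ a₁) ⊗ ⋯) ⊗ aₙ ⟶ b` are left universal. -/
lemma LeftNormal.isLeftUniversal (hV : V.LeftNormal) (L : List V.carrier)
    (θ : V.act L V.unit ⟶ b) [IsIso θ] : V.multicategory.IsLeftUniversal (L := L) θ :=
  fun x d => hV.bijective_sub L x θ d

lemma LeftNormal.leftRepresentable (hV : V.LeftNormal) : V.multicategory.LeftRepresentable :=
  fun L => ⟨V.act L V.unit, 𝟙 (V.act L V.unit), hV.isLeftUniversal L _⟩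

/-! ### Closedness of the multicategory -/

lemma act_concat (L : List V.carrier) (b x : V.carrier) :
    V.act (L ++ [b]) x = V.tensorObj (V.act L x) b :=
  act_append L [b] x

lemma subMap_singleton (x : List V.carrier) (f : V.act x V.unit ⟶ a) :
    V.subMap [] [b] f V.unit =
      eqToHom (act_concat x b V.unit) ≫ V.tensorHom (V.whisker x f V.unit) (𝟙 b) :=
  congrArg (eqToHom _ ≫ ·) (Category.comp_id (V.tensorHom (V.whisker x f V.unit) (𝟙 b)))

/-- The `λ` in the evaluation map absorbs the whiskering of `f` by the unit, leaving the usual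
transposition formula. -/
lemma eval_sub (x : List V.carrier) (f : V.act x V.unit ⟶ a) (e : V.tensorObj a b ⟶ c) :
    eqToHom rfl ≫ V.subMap [] [b] f V.unit ≫ eqToHom rfl ≫ V.tensorHom (V.lam a) (𝟙 b) ≫ e =
      eqToHom (act_concat x b V.unit) ≫ V.tensorHom f (𝟙 b) ≫ e := by
  have h : V.tensorHom f (𝟙 b) ≫ e =
      V.tensorHom (V.whisker x f V.unit) (𝟙 b) ≫ V.tensorHom (V.lam a) (𝟙 b) ≫ e := by
    rw [← tensor_comp_id_assoc, whisker_unit_lam]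
  rw [subMap_singleton, h]
  change 𝟙 _ ≫ (eqToHom _ ≫ V.tensorHom (V.whisker x f V.unit) (𝟙 b)) ≫
    𝟙 (V.tensorObj (V.tensorObj V.unit a) b) ≫ V.tensorHom (V.lam a) (𝟙 b) ≫ e = _
  simp only [Category.assoc, Category.id_comp]

lemma Closed.multicategory (hV : V.Closed) : V.multicategory.Closed := by
  intro (b : V.carrier) (c : V.carrier)
  have := hV b
  let adj := Adjunction.ofIsLeftAdjoint (V.tensorRight b)
  let G := (V.tensorRight b).rightAdjoint
  -- The domain of this binary map is `(i ⊗ G c) ⊗ b`, so the counit must be preceded by `λ ⊗ 1`.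
  let e : V.act [G.obj c, b] V.unit ⟶ c :=
    V.tensorHom (V.lam (G.obj c)) (𝟙 b) ≫ adj.counit.app c
  refine ⟨G.obj c, e, fun (x : List V.carrier) => ?_⟩
  have h : ∀ f : V.act x V.unit ⟶ G.obj c,
      eqToHom rfl ≫ V.subMap [] [b] f V.unit ≫ eqToHom rfl ≫ e =
        eqToHom (act_concat x b V.unit) ≫ (adj.homEquiv (V.act x V.unit) c).symm f :=
    fun f => (eval_sub x f (adj.counit.app c)).trans
      (congrArg _ (adj.homEquiv_counit (X := V.act x V.unit) (Y := c) (g := f)).symm)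
  have hb := (bijective_precomp (eqToHom (act_concat x b V.unit)) c).comp
    (adj.homEquiv (V.act x V.unit) c).symm.bijective
  exact (congrArg Function.Bijective (funext h)).mpr hb

/-- The binary map classifier of the multicategory of `V`. -/
def tensorClassifier (a b : V.carrier) : V.act [a, b] V.unit ⟶ V.tensorObj a b :=
  V.tensorHom (V.lam a) (𝟙 b)

lemma LeftNormal.isIso_tensorClassifier (hV : V.LeftNormal) (a b : V.carrier) :
    IsIso (tensorClassifier a b) := by
  have := hV a
  exact isIso_actMap [b] (V.lam a)

/-- The nullary map classifier of the multicategory of `V`. -/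
def unitClassifier (V : SkewMonoidalCategory.{v, u}) : V.act [] V.unit ⟶ V.unit := 𝟙 _

instance : IsIso V.unitClassifier := inferInstanceAs (IsIso (𝟙 V.unit))

/-- Classifiers of the multicategory of a left normal skew monoidal category. -/
def LeftNormal.shortClassifiers (hV : V.LeftNormal) :
    (forgetShort.obj V.multicategory).Classifiers where
  i := V.unit
  u := V.unitClassifier
  u_universal x _ d := hV.isLeftUniversal [] V.unitClassifier x d
  m := V.tensorObj
  θ := tensorClassifier (V := V)
  θ_universal a b x _ d :=
    have := hV.isIso_tensorClassifier a b
    hV.isLeftUniversal [a, b] (tensorClassifier (V := V) a b) x d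

end SkewMonoidalCategory

/-! ### Comparison of a skew monoidal category with that of its multicategory -/

namespace SkewMonoidalCategory

open ShortMulticategory ShortMulticategory.Classifiers

variable {V : SkewMonoidalCategory.{v, u}} {a b c d x y z : V.carrier}

/-- The short multicategory of a skew monoidal category. -/
abbrev short (V : SkewMonoidalCategory.{v, u}) : ShortMulticategory.{v, u} :=
  forgetShort.obj V.multicategory

/-- A morphism of `V` as a unary map. -/
def unary (f : a ⟶ b) : V.act [a] V.unit ⟶ b := V.lam a ≫ f

lemma whisker_unary (f : a ⟶ b) (x : V.carrier) :
    V.whisker [a] (unary f) x = V.tensorHom (𝟙 x) f :=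
  (whisker_comp [a] (V.lam a) f x).trans
    ((congrArg (· ≫ V.tensorHom (𝟙 x) f) (whisker_lam a x)).trans (Category.id_comp _))

lemma whisker_unitClassifier (x : V.carrier) : V.whisker [] V.unitClassifier x = V.ρ x := by
  change V.ρ x ≫ 𝟙 _ ≫ V.tensorHom (𝟙 x) (𝟙 V.unit) = V.ρ x
  rw [V.tensor_id, Category.comp_id, Category.comp_id]

/-- Naturality of `α` brings together the `ρ`, `α` and `λ` around the inserted unit, which cancel by
`ρ_α_lam`. This is how the associator of `V` reappears in that of its multicategory. -/
lemma whisker_tensorClassifier (x a b : V.carrier) :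
    V.whisker [a, b] (tensorClassifier a b) x = V.α x a b := by
  change V.tensorHom (V.tensorHom (V.ρ x) (𝟙 a)) (𝟙 b) ≫
    (V.tensorHom (V.α x V.unit a) (𝟙 b) ≫ V.α x (V.tensorObj V.unit a) b ≫ 𝟙 _) ≫
      V.tensorHom (𝟙 x) (V.tensorHom (V.lam a) (𝟙 b)) = V.α x a b
  rw [Category.comp_id, Category.assoc, ← V.α_naturality, ← tensor_comp_id_assoc,
    ← tensor_comp_id_assoc, Category.assoc, V.ρ_α_lam, V.tensor_id, Category.id_comp]

lemma post_unary (L : List V.carrier) (hL : L.length ≤ 4) (f : V.act L V.unit ⟶ b) (q : b ⟶ c) :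
    post (C := V.short) (L := L) (hL := hL) f (unary q : V.act [b] V.unit ⟶ c) = f ≫ q := by
  have key : ∀ k : V.act ([] ++ L ++ []) V.unit ⟶ V.tensorObj V.unit b,
      k = eqToHom (by simp) ≫ V.whisker L f V.unit →
        eqToHom (by simp) ≫ k ≫ 𝟙 (V.tensorObj V.unit b) ≫ V.lam b ≫ q = f ≫ q := by
    rintro _ rfl
    simp [whisker_unit_lam_assoc]
  exact key _ (subMap_nil_nil f V.unit)

/-- For explicit lists every transport in a substitution reduces to an identity, so the low-arity
formulas below are instances of this cancellation. -/
lemma id_cancel {x y z : V.carrier} (f : x ⟶ y) (g : y ⟶ z) :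
    𝟙 x ≫ (𝟙 x ≫ f ≫ 𝟙 y) ≫ 𝟙 y ≫ g = f ≫ g := by
  simp only [Category.id_comp, Category.comp_id]

lemma pre21_unary (f : V.tensorObj (V.tensorObj V.unit x) y ⟶ z) (g : a ⟶ x) :
    pre21 (C := V.short) (x := x) (y := y) f (unary g : V.act [a] V.unit ⟶ x) =
      V.tensorHom (V.tensorHom (𝟙 V.unit) g) (𝟙 y) ≫ f := by
  rw [← whisker_unary]
  exact id_cancel (V.tensorHom _ (𝟙 y)) f

lemma pre22_unary (f : V.tensorObj (V.tensorObj V.unit x) y ⟶ z) (g : a ⟶ y) :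
    pre22 (C := V.short) (x := x) (y := y) f (unary g : V.act [a] V.unit ⟶ y) =
      V.tensorHom (𝟙 (V.tensorObj V.unit x)) g ≫ f := by
  rw [← whisker_unary]
  exact id_cancel _ f

lemma s221_eq (f : V.tensorObj (V.tensorObj V.unit x) y ⟶ z)
    (g : V.tensorObj (V.tensorObj V.unit a) b ⟶ x) :
    s221 (C := V.short) (x := x) (y := y) (a := a) (b := b) f g =
      V.tensorHom (V.whisker [a, b] g V.unit) (𝟙 y) ≫ f := by
  exact id_cancel (V.tensorHom _ (𝟙 y)) f

lemma s222_eq (f : V.tensorObj (V.tensorObj V.unit x) y ⟶ z)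
    (g : V.tensorObj (V.tensorObj V.unit a) b ⟶ y) :
    s222 (C := V.short) (x := x) (y := y) (a := a) (b := b) f g =
      V.whisker [a, b] g (V.tensorObj V.unit x) ≫ f := by
  exact id_cancel _ f

lemma s201_eq (f : V.tensorObj (V.tensorObj V.unit x) y ⟶ z) (g : V.unit ⟶ x) :
    s201 (C := V.short) (x := x) (y := y) f g =
      V.tensorHom (V.whisker [] g V.unit) (𝟙 y) ≫ f := by
  exact id_cancel (V.tensorHom _ (𝟙 y)) f

lemma s202_eq (f : V.tensorObj (V.tensorObj V.unit x) y ⟶ z) (g : V.unit ⟶ y) :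
    s202 (C := V.short) (x := x) (y := y) f g =
      V.whisker [] g (V.tensorObj V.unit x) ≫ f := by
  exact id_cancel _ f

/-- The types of `f₀` and `f₂` involve the functor, which in the applications equals the identity
only propositionally; hence the heterogeneous equalities. -/
lemma _root_.ShortMult.LaxMonoidalFunctor.eq_idm (F : LaxMonoidalFunctor V V)
    (h : F.functor = 𝟭 V.carrier) (h₀ : HEq F.f₀ (𝟙 V.unit))
    (h₂ : ∀ a b, HEq (F.f₂ a b) (𝟙 (V.tensorObj a b))) : F = LaxMonoidalFunctor.idm V := by
  obtain ⟨Φ, f₀, f₂, _, _, _, _⟩ := F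
  subst h
  exact LaxMonoidalFunctor.ext rfl h₀ (heq_of_eq (funext fun a => funext fun b =>
    eq_of_heq (h₂ a b)))

/-! ### A left normal skew monoidal category inside its unary maps -/

namespace LeftNormal

variable (hV : V.LeftNormal)

/-- By the universal property it suffices to compare after composing with the classifier `λ ⊗ 1`;
what remains in `V` is naturality of `λ`. -/
lemma tensorHom_unary (f : a ⟶ b) (g : c ⟶ d) :
    hV.shortClassifiers.tensorHom (a := a) (b := b) (c := c) (d := d)
      (unary f : V.act [a] V.unit ⟶ b) (unary g : V.act [c] V.unit ⟶ d) =
        (unary (V.tensorHom f g) : V.act [V.tensorObj a c] V.unit ⟶ V.tensorObj b d) := by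
  refine ext₂ (R := hV.shortClassifiers) ((post_tensorHom _ _ _).trans ?_)
  refine Eq.trans ?_ (post_unary [a, c] _ (tensorClassifier a c) (V.tensorHom f g)).symm
  refine (congrArg (fun k => pre22 (C := V.short) (x := a) (y := d) k _)
    (pre21_unary (tensorClassifier b d) f)).trans ((pre22_unary _ g).trans ?_)
  have h : V.tensorHom (𝟙 (V.tensorObj V.unit a)) g ≫
      V.tensorHom (V.tensorHom (𝟙 V.unit) f) (𝟙 d) ≫ V.tensorHom (V.lam b) (𝟙 d) =
        V.tensorHom (V.lam a) (𝟙 c) ≫ V.tensorHom f g := by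
    rw [← tensor_comp_id, V.lam_naturality, ← V.tensor_comp, ← V.tensor_comp, Category.id_comp,
      Category.id_comp, Category.comp_id]
  exact h

/-- After composing with the classifiers, what remains in `V` is `lam_tensor` together with
naturality of `α`. -/
lemma assoc_unary (a b c : V.carrier) :
    hV.shortClassifiers.assoc a b c =
      (unary (V.α a b c) : V.act [V.tensorObj (V.tensorObj a b) c] V.unit ⟶ _) := by
  refine ext₃ (R := hV.shortClassifiers) ((s221_assoc _ _ _ _).trans ?_)
  refine (s222_eq (tensorClassifier a (V.tensorObj b c)) (tensorClassifier b c)).trans ?_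
  refine Eq.trans ?_ (congrArg (fun k => s221 (C := V.short) (x := V.tensorObj a b) (y := c) k _)
    (post_unary [V.tensorObj a b, c] _ (tensorClassifier (V.tensorObj a b) c) (V.α a b c))).symm
  refine Eq.trans ?_ (s221_eq _ (tensorClassifier a b)).symm
  rw [whisker_tensorClassifier]
  have h : V.α (V.tensorObj V.unit a) b c ≫ V.tensorHom (V.lam a) (𝟙 (V.tensorObj b c)) =
      V.tensorHom (V.α V.unit a b) (𝟙 c) ≫
        V.tensorHom (V.lam (V.tensorObj a b)) (𝟙 c) ≫ V.α a b c := by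
    rw [← tensor_comp_id_assoc, V.lam_tensor, V.α_naturality, V.tensor_id]
  rw [whisker_tensorClassifier]
  exact h

/-- After composing with the classifiers, what remains in `V` is `ρ_lam`. -/
lemma leftUnit_unary (a : V.carrier) :
    hV.shortClassifiers.leftUnit a =
      (unary (V.lam a) : V.act [V.tensorObj V.unit a] V.unit ⟶ a) := by
  refine extUnit (R := hV.shortClassifiers) ((s201_leftUnit _ _).trans ?_)
  refine Eq.trans ?_ (congrArg (fun k => s201 (C := V.short) (x := V.unit) (y := a) k _)
    (post_unary [V.unit, a] _ (tensorClassifier V.unit a) (V.lam a))).symm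
  refine Eq.trans ?_ (s201_eq _ V.unitClassifier).symm
  rw [whisker_unitClassifier]
  have h : V.lam a =
      V.tensorHom (V.ρ V.unit) (𝟙 a) ≫ V.tensorHom (V.lam V.unit) (𝟙 a) ≫ V.lam a := by
    rw [← tensor_comp_id_assoc, V.ρ_lam, V.tensor_id, Category.id_comp]
  exact h

lemma rightUnit_unary (a : V.carrier) :
    hV.shortClassifiers.rightUnit a =
      (unary (V.ρ a) : V.act [a] V.unit ⟶ V.tensorObj a V.unit) := by
  refine (s202_eq (tensorClassifier a V.unit) V.unitClassifier).trans ?_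
  rw [whisker_unitClassifier]
  exact (V.ρ_naturality (V.lam a)).symm

lemma unary_id (a : V.carrier) : unary (𝟙 a) = V.lam a := Category.comp_id _

lemma unary_comp (f : a ⟶ b) (g : b ⟶ c) :
    (unary (f ≫ g) : V.act [a] V.unit ⟶ c) =
      post (C := V.short) (L := [a]) (hL := (by decide : 1 ≤ 4)) (unary f : V.act [a] V.unit ⟶ b)
        (unary g : V.act [b] V.unit ⟶ c) := by
  refine Eq.trans ?_ (post_unary [a] _ (unary f) g).symm
  exact (Category.assoc _ _ _).symm

/-- The inclusion of `V` in the category of unary maps. -/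
def inclusion : V.carrier ⥤ hV.shortClassifiers.skew.carrier where
  obj a := a
  map {a b} f := (unary f : V.act [a] V.unit ⟶ b)
  map_id := unary_id
  map_comp := unary_comp

lemma tensor_id_cancel_left (f : V.tensorObj a b ⟶ c) :
    V.tensorHom (𝟙 a) (𝟙 b) ≫ 𝟙 _ ≫ f = f := by
  rw [V.tensor_id, Category.id_comp, Category.id_comp]

lemma tensor_id_cancel_right (f : a ⟶ V.tensorObj b c) :
    f ≫ V.tensorHom (𝟙 b) (𝟙 c) ≫ 𝟙 _ = f := by
  rw [V.tensor_id, Category.comp_id, Category.comp_id]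

/-- The inclusion of `V` in the category of unary maps is strict monoidal. -/
noncomputable def inclusionLax : LaxMonoidalFunctor V hV.shortClassifiers.skew where
  functor := hV.inclusion
  f₀ := 𝟙 (hV.inclusion.obj V.unit)
  f₂ a b := 𝟙 (hV.inclusion.obj (V.tensorObj a b))
  f₂_naturality f g := (Category.comp_id _).trans
    ((hV.tensorHom_unary f g).trans
      (Category.id_comp (hV.inclusion.map (V.tensorHom f g))).symm)
  associativity a b c :=
    (tensor_id_cancel_left (V := hV.shortClassifiers.skew) _).trans
      ((hV.assoc_unary a b c).symm.trans
        (tensor_id_cancel_right (V := hV.shortClassifiers.skew) _).symm)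
  left_unitality a :=
    (tensor_id_cancel_left (V := hV.shortClassifiers.skew) _).trans (hV.leftUnit_unary a).symm
  right_unitality a :=
    (tensor_id_cancel_right (V := hV.shortClassifiers.skew) _).trans (hV.rightUnit_unary a)

/-- The morphism of `V` given by a unary map. -/
noncomputable def ofUnary {a b : V.carrier} (f : V.act [a] V.unit ⟶ b) : a ⟶ b :=
  have := hV a
  inv (V.lam a) ≫ f

lemma unary_ofUnary (f : V.act [a] V.unit ⟶ b) : unary (hV.ofUnary f) = f := by
  have := hV a
  exact IsIso.hom_inv_id_assoc (V.lam a) f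

lemma ofUnary_unary (f : a ⟶ b) : hV.ofUnary (unary f) = f := by
  have := hV a
  exact IsIso.inv_hom_id_assoc (V.lam a) f

lemma unary_injective (hV : V.LeftNormal) : Function.Injective (unary (a := a) (b := b)) :=
  Function.LeftInverse.injective hV.ofUnary_unary

/-- The inverse of the inclusion of `V` in the category of unary maps. -/
noncomputable def retraction : hV.shortClassifiers.skew.carrier ⥤ V.carrier where
  obj a := a
  map {a b} f := hV.ofUnary (a := a) (b := b) f
  map_id a := (congrArg hV.ofUnary (unary_id (V := V) a).symm).trans
    (ofUnary_unary (V := V) hV (a := a) (b := a) _)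
  map_comp {a b c} f g := hV.unary_injective ((hV.unary_ofUnary _).trans (by
    refine Eq.trans ?_ (hV.inclusion.map_comp (X := a) (Y := b) (Z := c)
      (hV.ofUnary f) (hV.ofUnary g)).symm
    exact congrArg₂ (fun p q => p ≫ q) (unary_ofUnary (V := V) hV (a := a) (b := b) f).symm
      (unary_ofUnary (V := V) hV (a := b) (b := c) g).symm))

/-- The inverse of the inclusion of `V` in the category of unary maps is strict monoidal. -/
noncomputable def retractionLax : LaxMonoidalFunctor hV.shortClassifiers.skew V where
  functor := hV.retraction
  f₀ := 𝟙 V.unit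
  f₂ a b := 𝟙 (V.tensorObj a b)
  f₂_naturality {a b a' b'} f g := by
    refine (Category.comp_id _).trans (Eq.trans ?_
      (Category.id_comp (hV.retraction.map (hV.shortClassifiers.tensorHom f g))).symm)
    -- `unary` is injective, so the equation may be checked on unary maps, where it is
    -- `tensorHom_unary`.
    refine hV.unary_injective (Eq.trans ?_ (hV.unary_ofUnary _).symm)
    refine (hV.tensorHom_unary _ _).symm.trans ?_
    exact congrArg₂ (fun p q => hV.shortClassifiers.tensorHom p q)
      (unary_ofUnary (V := V) hV (a := a) (b := a') f)
      (unary_ofUnary (V := V) hV (a := b) (b := b') g)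
  associativity a b c :=
    (tensor_id_cancel_left _).trans (((congrArg hV.ofUnary (hV.assoc_unary a b c)).trans
      (hV.ofUnary_unary _)).trans (tensor_id_cancel_right _).symm)
  left_unitality a :=
    (tensor_id_cancel_left _).trans ((congrArg hV.ofUnary (hV.leftUnit_unary a)).trans
      (hV.ofUnary_unary _))
  right_unitality a :=
    (tensor_id_cancel_right _).trans ((congrArg hV.ofUnary (hV.rightUnit_unary a)).trans
      (hV.ofUnary_unary _)).symm

lemma inclusionLax_comp_retractionLax :
    hV.inclusionLax.comp hV.retractionLax = LaxMonoidalFunctor.idm V :=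
  LaxMonoidalFunctor.eq_idm _ (Functor.hext (fun _ => rfl) fun _ _ f =>
      heq_of_eq (hV.ofUnary_unary f))
    (heq_of_eq ((Category.id_comp _).trans (hV.retraction.map_id V.unit)))
    fun a b => heq_of_eq ((Category.id_comp _).trans (hV.retraction.map_id (V.tensorObj a b)))

lemma retractionLax_comp_inclusionLax :
    hV.retractionLax.comp hV.inclusionLax = LaxMonoidalFunctor.idm hV.shortClassifiers.skew :=
  LaxMonoidalFunctor.eq_idm _ (Functor.hext (fun _ => rfl) fun a b f =>
      heq_of_eq (unary_ofUnary (V := V) hV (a := a) (b := b) f))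
    (heq_of_eq ((Category.id_comp _).trans (hV.inclusion.map_id V.unit)))
    fun a b => heq_of_eq ((Category.id_comp _).trans (hV.inclusion.map_id (V.tensorObj a b)))

/-- A left normal skew monoidal category is isomorphic to that of its multicategory. -/
noncomputable def skewIso : V ≅ hV.shortClassifiers.skew where
  hom := hV.inclusionLax
  inv := hV.retractionLax
  hom_inv_id := hV.inclusionLax_comp_retractionLax
  inv_hom_id := hV.retractionLax_comp_inclusionLax

end LeftNormal

end SkewMonoidalCategory

/-! ### Multicategories and short multicategories treated simultaneously -/

/-- A multicategory in which, if `P` holds, only the substitutions of a short multicategory are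
given. -/
structure BoundedMulticategory (P : Prop) where
  Obj : Type u
  Hom : List Obj → Obj → Type v
  id : ∀ a : Obj, Hom [a] a
  -- The arity conditions are vacuous for `P = False` and those of a short multicategory for `P =
  -- True`; they come last so that the default tactic can supply them.
  sub : ∀ {L Δ L' : List Obj} {b c : Obj} (Γ₁ Γ₂ : List Obj), L = Γ₁ ++ b :: Γ₂ →
    L' = Γ₁ ++ Δ ++ Γ₂ → Hom L c → Hom Δ b →
      ∀ (_ : P → SubOK L.length Δ.length := by intro hP; grind [SubOK]), Hom L' c
  id_sub : ∀ {Δ : List Obj} {b : Obj} (f : Hom Δ b) (s),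
    sub [] [] rfl (by simp) (id b) f s = f
  sub_assoc : ∀ {L M E M' L' K : List Obj} {b c d : Obj} (Γ₁ Γ₂ Δ₁ Δ₂ : List Obj)
    (eL : L = Γ₁ ++ c :: Γ₂) (eM : M = Δ₁ ++ b :: Δ₂) (eM' : M' = Δ₁ ++ E ++ Δ₂)
    (eL' : L' = Γ₁ ++ M ++ Γ₂) (eK : K = Γ₁ ++ M' ++ Γ₂)
    (h : Hom L d) (g : Hom M c) (f : Hom E b)
    (s₁ : P → SubOK M.length E.length := by intro hP; grind [SubOK])
    (s₂ : P → SubOK L.length M'.length := by intro hP; grind [SubOK])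
    (s₃ : P → SubOK L.length M.length := by intro hP; grind [SubOK])
    (s₄ : P → SubOK L'.length E.length := by intro hP; grind [SubOK])
    (_ : P → AssocOK L.length M.length E.length := by intro hP; grind [SubOK, AssocOK]),
    (sub Γ₁ Γ₂ eL eK h (sub Δ₁ Δ₂ eM eM' g f s₁) s₂ : Hom K d) =
      sub (Γ₁ ++ Δ₁) (Δ₂ ++ Γ₂) (by simp [eL', eM]) (by simp [eK, eM'])
        (sub Γ₁ Γ₂ eL eL' h g s₃) f s₄
  sub_comm : ∀ {L M E L₁ L₂ K : List Obj} {b c d : Obj} (Γ₁ Γ₂ Γ₃ : List Obj)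
    (eL : L = Γ₁ ++ b :: (Γ₂ ++ c :: Γ₃)) (eL₁ : L₁ = Γ₁ ++ M ++ (Γ₂ ++ c :: Γ₃))
    (eL₂ : L₂ = Γ₁ ++ b :: (Γ₂ ++ E ++ Γ₃)) (eK : K = Γ₁ ++ M ++ Γ₂ ++ E ++ Γ₃)
    (h : Hom L d) (g : Hom M b) (f : Hom E c)
    (s₁ : P → SubOK L.length M.length := by intro hP; grind [SubOK])
    (s₂ : P → SubOK L₁.length E.length := by intro hP; grind [SubOK])
    (s₃ : P → SubOK L.length E.length := by intro hP; grind [SubOK])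
    (s₄ : P → SubOK L₂.length M.length := by intro hP; grind [SubOK])
    (_ : P → CommOK L.length M.length E.length := by intro hP; grind [SubOK, CommOK]),
    (sub (Γ₁ ++ M ++ Γ₂) Γ₃ (by simp [eL₁]) eK
        (sub Γ₁ (Γ₂ ++ c :: Γ₃) eL eL₁ h g s₁) f s₂ : Hom K d) =
      sub Γ₁ (Γ₂ ++ E ++ Γ₃) eL₂ (by simp [eK])
        (sub (Γ₁ ++ b :: Γ₂) Γ₃ (by simp [eL]) (by simp [eL₂]) h f s₃) g s₄

lemma SubOK.le_left {n m : ℕ} (h : SubOK n m) : n ≤ 4 := by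
  unfold SubOK at h; omega

lemma SubOK.le_right {n m : ℕ} (h : SubOK n m) : m ≤ 4 := by
  unfold SubOK at h; omega

namespace BoundedMulticategory

/-- A short multicategory as a bounded multicategory. -/
def ofShort (C : ShortMulticategory.{v, u}) : BoundedMulticategory.{v, u} True where
  Obj := C.Obj
  -- Beyond arity four this is a function type with empty domain, so there is exactly one map and no
  -- law has content there.
  Hom L b := ∀ h : L.length ≤ 4, C.Hom L h b
  id a _ := C.id a
  sub Γ₁ Γ₂ eL eL' g f s _ :=
    C.sub Γ₁ Γ₂ eL eL' (s trivial) (g (s trivial).le_left) (f (s trivial).le_right)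
  id_sub f s := funext fun _ => C.id_sub (f (s trivial).le_right)
  sub_assoc Γ₁ Γ₂ Δ₁ Δ₂ eL eM eM' eL' eK h g f s₁ s₂ s₃ s₄ s := funext fun _ =>
    C.sub_assoc Γ₁ Γ₂ Δ₁ Δ₂ eL eM eM' eL' eK (s₁ trivial) (s₂ trivial) (s₃ trivial) (s₄ trivial)
      (s trivial) (h _) (g _) (f _)
  sub_comm Γ₁ Γ₂ Γ₃ eL eL₁ eL₂ eK h g f s₁ s₂ s₃ s₄ s := funext fun _ =>
    C.sub_comm Γ₁ Γ₂ Γ₃ eL eL₁ eL₂ eK (s₁ trivial) (s₂ trivial) (s₃ trivial) (s₄ trivial)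
      (s trivial) (h _) (g _) (f _)

/-- A multicategory as a bounded multicategory without bound. -/
def ofMulti (C : Multicategory.{v, u}) : BoundedMulticategory.{v, u} False where
  Obj := C.Obj
  Hom L b := C.Hom L b
  id := C.id
  sub Γ₁ Γ₂ eL eL' g f _ := C.sub Γ₁ Γ₂ eL eL' g f
  id_sub f _ := C.id_sub f
  sub_assoc Γ₁ Γ₂ Δ₁ Δ₂ eL eM eM' eL' eK h g f _ _ _ _ _ :=
    C.sub_assoc Γ₁ Γ₂ Δ₁ Δ₂ eL eM eM' eL' eK h g f
  sub_comm Γ₁ Γ₂ Γ₃ eL eL₁ eL₂ eK h g f _ _ _ _ _ :=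
    C.sub_comm Γ₁ Γ₂ Γ₃ eL eL₁ eL₂ eK h g f

variable {P : Prop}

/-- Needed because the image of a concatenation under `List.map` is only propositionally the
concatenation of the images. -/
lemma sub_congr (C : BoundedMulticategory.{v, u} P) {L Δ L' : List C.Obj} {b c : C.Obj}
    {Γ₁ Γ₂ Γ₁' Γ₂' : List C.Obj} (e₁ : Γ₁ = Γ₁') (e₂ : Γ₂ = Γ₂') (eL : L = Γ₁ ++ b :: Γ₂)
    (eL' : L' = Γ₁ ++ Δ ++ Γ₂) (g : C.Hom L c) (f : C.Hom Δ b)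
    (s : P → SubOK L.length Δ.length) :
    C.sub Γ₁ Γ₂ eL eL' g f s = C.sub Γ₁' Γ₂' (by rw [eL, e₁, e₂]) (by rw [eL', e₁, e₂]) g f s := by
  subst e₁ e₂
  rfl

/-- Nullary and binary classifiers of a bounded multicategory `C`, and an assignment on objects, on
unary maps and on the classifiers, with values in `D`, which is compatible with the skew monoidal
structure. -/
structure GeneratingData (C D : BoundedMulticategory.{v, u} P) where
  i : C.Obj
  u : C.Hom [] i
  m : C.Obj → C.Obj → C.Obj
  θ : ∀ a b, C.Hom [a, b] (m a b)
  -- Universality of `u` is needed without further variables only; with further variables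
  -- `unit_left` takes its place.
  bij_u : ∀ d, Function.Bijective (fun g : C.Hom [i] d => (C.sub [] [] rfl rfl g u : C.Hom [] d))
  bij_θ : ∀ (a b : C.Obj) (x : List C.Obj) (_ : P → x.length ≤ 2) (d : C.Obj),
    Function.Bijective (fun g : C.Hom (m a b :: x) d =>
      (C.sub [] x rfl rfl g (θ a b) : C.Hom (a :: b :: x) d))
  obj : C.Obj → D.Obj
  map₁ : ∀ {a b}, C.Hom [a] b → D.Hom [obj a] (obj b)
  map₁_id : ∀ a, map₁ (C.id a) = D.id (obj a)
  map₁_comp : ∀ {a b c} (q : C.Hom [b] c) (p : C.Hom [a] b),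
    map₁ (C.sub [] [] rfl rfl q p) = D.sub [] [] rfl rfl (map₁ q) (map₁ p)
  v : D.Hom [] (obj i)
  φ : ∀ a b, D.Hom [obj a, obj b] (obj (m a b))
  -- The map `t` is `p ⊗ b`. By `bij_θ` the equation in `C` determines it, so the existential form
  -- loses nothing; likewise for `a ⊗ p` and the associator below.
  tensor_left : ∀ {a a'} (b) (p : C.Hom [a] a'), ∃ t : C.Hom [m a b] (m a' b),
    (C.sub [] [b] rfl rfl (θ a' b) p : C.Hom [a, b] (m a' b)) =
      C.sub [] [] rfl rfl t (θ a b) ∧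
    (D.sub [] [obj b] rfl rfl (φ a' b) (map₁ p) : D.Hom [obj a, obj b] (obj (m a' b))) =
      D.sub [] [] rfl rfl (map₁ t) (φ a b)
  tensor_right : ∀ (a) {b b'} (p : C.Hom [b] b'), ∃ t : C.Hom [m a b] (m a b'),
    (C.sub [a] [] rfl rfl (θ a b') p : C.Hom [a, b] (m a b')) =
      C.sub [] [] rfl rfl t (θ a b) ∧
    (D.sub [obj a] [] rfl rfl (φ a b') (map₁ p) : D.Hom [obj a, obj b] (obj (m a b'))) =
      D.sub [] [] rfl rfl (map₁ t) (φ a b)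
  assoc : ∀ a b c, ∃ t : C.Hom [m (m a b) c] (m a (m b c)),
    (C.sub [a] [] rfl rfl (θ a (m b c)) (θ b c) : C.Hom [a, b, c] (m a (m b c))) =
      C.sub [] [c] rfl rfl
        (C.sub [] [] rfl rfl t (θ (m a b) c) : C.Hom [m a b, c] (m a (m b c))) (θ a b) ∧
    (D.sub [obj a] [] rfl rfl (φ a (m b c)) (φ b c) :
      D.Hom [obj a, obj b, obj c] (obj (m a (m b c)))) =
        D.sub [] [obj c] rfl rfl
          (D.sub [] [] rfl rfl (map₁ t) (φ (m a b) c) :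
            D.Hom [obj (m a b), obj c] (obj (m a (m b c)))) (φ a b)
  -- Stated for `θ ∘₁ u`, the inverse of `λ`, which is itself a substitution.
  unit_left : ∀ a, map₁ (C.sub [] [a] rfl rfl (θ i a) u) =
    D.sub [] [obj a] rfl rfl (φ i a) v
  unit_right : ∀ a, map₁ (C.sub [a] [] rfl rfl (θ a i) u) =
    D.sub [obj a] [] rfl rfl (φ a i) v

/-! ### Extension of generating data to all multimaps -/

namespace GeneratingData

variable {C D : BoundedMulticategory.{v, u} P} (X : C.GeneratingData D) {a b c d : C.Obj}

/-- The action on multimaps of positive arity. -/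
noncomputable def mapCons : ∀ (x : List C.Obj) {a d : C.Obj}, (P → x.length ≤ 3) →
    C.Hom (a :: x) d → D.Hom ((a :: x).map X.obj) (X.obj d)
  | [], _, _, _, h => X.map₁ h
  | b :: x, a, d, hx, h =>
    D.sub (L := (X.m a b :: x).map X.obj) [] (x.map X.obj) rfl rfl
      (mapCons x (by grind)
        ((Equiv.ofBijective _ (X.bij_θ a b x (by grind) d)).symm h)) (X.φ a b)

/-- The action on multimaps. -/
noncomputable def map : ∀ {L : List C.Obj} {d : C.Obj} (_ : C.Hom L d)
    (_ : P → L.length ≤ 4 := by intro hP; grind [SubOK]), D.Hom (L.map X.obj) (X.obj d)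
  | [], d, h, _ => D.sub [] [] rfl rfl (X.map₁ ((Equiv.ofBijective _ (X.bij_u d)).symm h)) X.v
  | _ :: x, _, h, hx => X.mapCons x (by grind) h

lemma exists_factor (x : List C.Obj) (hx : P → x.length ≤ 2) (h : C.Hom (a :: b :: x) d) :
    ∃ k : C.Hom (X.m a b :: x) d, h = C.sub [] x rfl rfl k (X.θ a b) := by
  obtain ⟨k, hk⟩ := (X.bij_θ a b x hx d).2 h
  exact ⟨k, hk.symm⟩

lemma exists_factor_nil (h : C.Hom [] d) :
    ∃ k : C.Hom [X.i] d, h = C.sub [] [] rfl rfl k X.u := by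
  obtain ⟨k, hk⟩ := (X.bij_u d).2 h
  exact ⟨k, hk.symm⟩

lemma map_unary (h : C.Hom [a] d) : X.map h = X.map₁ h := rfl

/-- The recursive definition of the extension, with uniqueness of the factorization used to recover
`k`. -/
lemma map_sub_θ (x : List C.Obj) (hx : P → x.length ≤ 2) (k : C.Hom (X.m a b :: x) d) (s) :
    X.map (C.sub [] x rfl rfl k (X.θ a b) s : C.Hom (a :: b :: x) d) =
      D.sub [] (x.map X.obj) rfl rfl (X.map k) (X.φ a b) := by
  have h := (Equiv.ofBijective _ (X.bij_θ a b x hx d)).symm_apply_apply k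
  exact congrArg (fun k => D.sub [] (x.map X.obj) rfl rfl (X.mapCons x (by grind) k) (X.φ a b)) h

lemma map_sub_u (k : C.Hom [X.i] d) (s) :
    X.map (C.sub [] [] rfl rfl k X.u s : C.Hom [] d) = D.sub [] [] rfl rfl (X.map₁ k) X.v := by
  have h := (Equiv.ofBijective _ (X.bij_u d)).symm_apply_apply k
  exact congrArg (fun k => D.sub [] [] rfl rfl (X.map₁ k) X.v) h

lemma map_θ (a b : C.Obj) : X.map (X.θ a b) = X.φ a b := by
  have h := X.map_sub_θ [] (by simp) (C.id (X.m a b)) (by simp [SubOK])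
  rw [map_unary, X.map₁_id] at h
  exact (congrArg (fun g => X.map g) (C.id_sub (X.θ a b) (by simp [SubOK])).symm).trans
    (h.trans (D.id_sub (X.φ a b) (by simp [SubOK])))

lemma map_u : X.map X.u = X.v := by
  have h := X.map_sub_u (C.id X.i) (by simp [SubOK])
  rw [X.map₁_id] at h
  exact (congrArg (fun g => X.map g) (C.id_sub X.u (by simp [SubOK])).symm).trans
    (h.trans (D.id_sub X.v (by simp [SubOK])))

/-! ### Preservation of substitutions of the generators -/

/-- Substitution of `g` after the variables `Γ₁` is preserved. -/
def PreservesAt {Δ : List C.Obj} (g : C.Hom Δ c) (hΔ : P → Δ.length ≤ 4) (Γ₁ : List C.Obj) : Prop :=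
  ∀ (Γ₂ : List C.Obj) (d : C.Obj) (h : C.Hom (Γ₁ ++ c :: Γ₂) d)
    (hL' : P → (Γ₁ ++ Δ ++ Γ₂).length ≤ 4) (s),
    X.map (C.sub Γ₁ Γ₂ rfl rfl h g s) hL' =
      D.sub (Γ₁.map X.obj) (Γ₂.map X.obj) (by simp) (by simp) (X.map h) (X.map g hΔ)
        (by simpa using s)

/-- Induction on the other variables. Write `h = k ∘₁ θ`; since `θ ∘₁ p = (p ⊗ b) ∘ θ`, substituting
`p` into `h` reduces to substituting the unary `p ⊗ b` into the shorter `k`. The base case is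
functoriality. -/
lemma preservesAt_nil_unary (p : C.Hom [a] c) : X.PreservesAt p (by simp) [] := by
  intro x
  induction x generalizing a c with
  | nil => exact fun d h _ _ => X.map₁_comp h p
  | cons b x ih =>
    intro d h hL' s
    obtain ⟨k, rfl⟩ := X.exists_factor x (by grind) h
    obtain ⟨t, ht, ht'⟩ := X.tensor_left b p
    -- `h₁` and `h₂` regroup the substitutions on the two sides of `ht` in `C`; `h₃` and `h₄` do so
    -- for `ht'` in `D`. The next lemmas follow the same pattern.
    have h₁ := C.sub_assoc (K := a :: b :: x) [] x [] [b] rfl rfl rfl rfl rfl k (X.θ c b) p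
    have h₂ := C.sub_assoc (K := a :: b :: x) [] x [] [] rfl rfl rfl rfl rfl k t (X.θ a b)
    have h₃ := D.sub_assoc (K := X.obj a :: X.obj b :: x.map X.obj) [] (x.map X.obj) [] [X.obj b]
      rfl rfl rfl rfl rfl (X.map k) (X.φ c b) (X.map₁ p)
    have h₄ := D.sub_assoc (K := X.obj a :: X.obj b :: x.map X.obj) [] (x.map X.obj) [] []
      rfl rfl rfl rfl rfl (X.map k) (X.map₁ t) (X.φ a b)
    refine (congrArg (fun k => X.map k hL') (h₁.symm.trans ((congrArg (fun g =>
      C.sub [] x rfl rfl k g) ht).trans h₂))).trans ?_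
    refine (X.map_sub_θ x (by grind) _ _).trans ?_
    refine (congrArg (fun k => D.sub [] (x.map X.obj) rfl rfl k (X.φ a b))
      (ih t d k (by grind) (by grind [SubOK]))).trans ?_
    refine (h₄.symm.trans ((congrArg (fun g =>
      D.sub [] (x.map X.obj) rfl rfl (X.map k) g) ht'.symm).trans h₃)).trans ?_
    exact congrArg (fun k => D.sub [] ((b :: x).map X.obj) rfl rfl k (X.map₁ p))
      (X.map_sub_θ x (by grind) k _).symm

/-- No induction here: factoring `h` through `θ` merges the first two variables, and `p` becomes the
unary map `a ⊗ p` in the first one. -/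
lemma preservesAt_singleton_unary (a : C.Obj) (p : C.Hom [b] c) :
    X.PreservesAt p (by simp) [a] := by
  intro x d h hL' s
  obtain ⟨k, rfl⟩ := X.exists_factor x (by grind) h
  obtain ⟨t, ht, ht'⟩ := X.tensor_right a p
  have h₁ := C.sub_assoc (K := a :: b :: x) [] x [a] [] rfl rfl rfl rfl rfl k (X.θ a c) p
  have h₂ := C.sub_assoc (K := a :: b :: x) [] x [] [] rfl rfl rfl rfl rfl k t (X.θ a b)
  have h₃ := D.sub_assoc (K := X.obj a :: X.obj b :: x.map X.obj) [] (x.map X.obj) [X.obj a] []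
    rfl rfl rfl rfl rfl (X.map k) (X.φ a c) (X.map₁ p)
  have h₄ := D.sub_assoc (K := X.obj a :: X.obj b :: x.map X.obj) [] (x.map X.obj) [] []
    rfl rfl rfl rfl rfl (X.map k) (X.map₁ t) (X.φ a b)
  refine (congrArg (fun k => X.map k hL') (h₁.symm.trans ((congrArg (fun g =>
    C.sub [] x rfl rfl k g) ht).trans h₂))).trans ?_
  refine (X.map_sub_θ x (by grind) _ _).trans ?_
  refine (congrArg (fun k => D.sub [] (x.map X.obj) rfl rfl k (X.φ a b))
    (X.preservesAt_nil_unary t x d k (by grind) (by grind [SubOK]))).trans ?_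
  refine (h₄.symm.trans ((congrArg (fun g =>
    D.sub [] (x.map X.obj) rfl rfl (X.map k) g) ht'.symm).trans h₃)).trans ?_
  exact congrArg (fun k => D.sub [X.obj a] (x.map X.obj) rfl rfl k (X.map₁ p))
    (X.map_sub_θ x (by grind) k _).symm

lemma preservesAt_nil_θ (a b : C.Obj) : X.PreservesAt (X.θ a b) (by simp) [] := by
  intro x d h hL' s
  exact (X.map_sub_θ x (by grind) h _).trans (congrArg (fun g =>
    D.sub [] (x.map X.obj) rfl rfl (X.map h) g) (X.map_θ a b).symm)

/-- The associator rewrites `θ ∘₂ θ` as substitutions in the first variable only, where the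
extension is known by its definition and by `preservesAt_nil_unary`. -/
lemma preservesAt_singleton_θ (a b c : C.Obj) : X.PreservesAt (X.θ b c) (by simp) [a] := by
  intro x d h hL' s
  -- The result has arity `x.length + 3`. Hence `k` is at most binary in the short case, as
  -- associativity with two binary maps requires.
  have hx : P → x.length ≤ 1 := by grind
  obtain ⟨k, rfl⟩ := X.exists_factor x (by grind) h
  obtain ⟨t, ht, ht'⟩ := X.assoc a b c
  have h₁ := C.sub_assoc (K := a :: b :: c :: x) [] x [a] [] rfl rfl rfl rfl rfl k
    (X.θ a (X.m b c)) (X.θ b c)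
  have h₂ := C.sub_assoc (K := a :: b :: c :: x) [] x [] [c] rfl rfl rfl rfl rfl k
    (C.sub [] [] rfl rfl t (X.θ (X.m a b) c) : C.Hom [X.m a b, c] _) (X.θ a b)
  have h₃ := C.sub_assoc (K := X.m a b :: c :: x) [] x [] [] rfl rfl rfl rfl rfl k t
    (X.θ (X.m a b) c)
  have h₁' := D.sub_assoc (K := X.obj a :: X.obj b :: X.obj c :: x.map X.obj) [] (x.map X.obj)
    [X.obj a] [] rfl rfl rfl rfl rfl (X.map k) (X.φ a (X.m b c)) (X.φ b c)
  have h₂' := D.sub_assoc (K := X.obj a :: X.obj b :: X.obj c :: x.map X.obj) [] (x.map X.obj)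
    [] [X.obj c] rfl rfl rfl rfl rfl (X.map k)
    (D.sub [] [] rfl rfl (X.map₁ t) (X.φ (X.m a b) c) : D.Hom [X.obj (X.m a b), X.obj c] _)
    (X.φ a b)
  have h₃' := D.sub_assoc (K := X.obj (X.m a b) :: X.obj c :: x.map X.obj) [] (x.map X.obj) [] []
    rfl rfl rfl rfl rfl (X.map k) (X.map₁ t) (X.φ (X.m a b) c)
  refine (congrArg (fun k => X.map k hL') (h₁.symm.trans ((congrArg (fun g =>
    C.sub [] x rfl rfl k g) ht).trans h₂))).trans ?_
  refine (X.map_sub_θ (c :: x) (by grind) _ _).trans ?_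
  refine (congrArg (fun k => D.sub [] ((c :: x).map X.obj) rfl rfl k (X.φ a b))
    ((congrArg (fun k => X.map k) h₃).trans ((X.map_sub_θ x (by grind) _ _).trans
      ((congrArg (fun k => D.sub [] (x.map X.obj) rfl rfl k (X.φ (X.m a b) c))
        (X.preservesAt_nil_unary t x d k (by grind) (by grind [SubOK]))).trans h₃'.symm)))).trans ?_
  refine (h₂'.symm.trans ((congrArg (fun g =>
    D.sub [] (x.map X.obj) rfl rfl (X.map k) g) ht'.symm).trans h₁')).trans ?_
  rw [map_θ]
  exact congrArg (fun k => D.sub [X.obj a] (x.map X.obj) rfl rfl k (X.φ b c))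
    (X.map_sub_θ x (by grind) k _).symm

/-- With a second variable present, `h = k ∘₁ θ` and `θ ∘₁ u` is unary with image given by
`unit_left`; a unary map in the first variable is already settled. -/
lemma preservesAt_nil_u : X.PreservesAt X.u (by simp) [] := by
  intro x d h hL' s
  rw [map_u]
  cases x with
  | nil => exact X.map_sub_u h _
  | cons a x =>
    -- The bound comes from `SubOK`: a nullary map may be substituted into an at most ternary one.
    -- The arity of the result alone would give less.
    have hx : P → x.length ≤ 1 := by grind [SubOK]
    obtain ⟨k, rfl⟩ := X.exists_factor x (by grind) h
    have h₁ := C.sub_assoc (K := a :: x) [] x [] [a] rfl rfl rfl rfl rfl k (X.θ X.i a) X.u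
    have h₂ := D.sub_assoc (K := X.obj a :: x.map X.obj) [] (x.map X.obj) [] [X.obj a]
      rfl rfl rfl rfl rfl (X.map k) (X.φ X.i a) X.v
    refine (congrArg (fun k => X.map k hL') h₁.symm).trans ?_
    refine (X.preservesAt_nil_unary _ x d k (by grind) (by grind [SubOK])).trans ?_
    refine ((congrArg (fun g => D.sub [] (x.map X.obj) rfl rfl (X.map k) g)
      (X.unit_left a)).trans h₂).trans ?_
    exact congrArg (fun k => D.sub [] ((a :: x).map X.obj) rfl rfl k X.v)
      (X.map_sub_θ x (by grind) k _).symm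

lemma preservesAt_singleton_u (a : C.Obj) : X.PreservesAt X.u (by simp) [a] := by
  intro x d h hL' s
  rw [map_u]
  have hx : P → x.length ≤ 1 := by grind [SubOK]
  obtain ⟨k, rfl⟩ := X.exists_factor x (by grind) h
  have h₁ := C.sub_assoc (K := a :: x) [] x [a] [] rfl rfl rfl rfl rfl k (X.θ a X.i) X.u
  have h₂ := D.sub_assoc (K := X.obj a :: x.map X.obj) [] (x.map X.obj) [X.obj a] []
    rfl rfl rfl rfl rfl (X.map k) (X.φ a X.i) X.v
  refine (congrArg (fun k => X.map k hL') h₁.symm).trans ?_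
  refine (X.preservesAt_nil_unary _ x d k (by grind) (by grind [SubOK])).trans ?_
  refine ((congrArg (fun g => D.sub [] (x.map X.obj) rfl rfl (X.map k) g)
    (X.unit_right a)).trans h₂).trans ?_
  exact congrArg (fun k => D.sub [X.obj a] (x.map X.obj) rfl rfl k X.v)
    (X.map_sub_θ x (by grind) k _).symm

/-- Preservation of substitutions into the second variable implies preservation of substitutions
into all further variables. -/
lemma preservesAt_cons {Δ : List C.Obj} (g : C.Hom Δ c) (hΔ : P → Δ.length ≤ 2)
    (hg : ∀ a, X.PreservesAt g (by grind) [a]) (a : C.Obj) (Γ : List C.Obj) :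
    X.PreservesAt g (by grind) (a :: Γ) := by
  induction Γ generalizing a with
  | nil => exact hg a
  | cons a' Γ ih =>
    intro x d h hL' s
    obtain ⟨k, rfl⟩ := X.exists_factor (Γ ++ c :: x) (by grind [SubOK]) h
    -- Exchanging `g` and `θ` leaves `g` substituted into `k`, with one variable fewer before it.
    -- The law is available: if `g` is nullary or binary, `SubOK` forces `Γ` and `x` to be empty in
    -- the short case, so `k` is binary.
    have h₁ := C.sub_comm (K := a :: a' :: (Γ ++ Δ ++ x)) [] Γ x rfl rfl rfl rfl k (X.θ a a') g
    have h₂ := D.sub_comm (K := (a :: a' :: (Γ ++ Δ ++ x)).map X.obj)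
      (L₁ := (a :: a' :: (Γ ++ c :: x)).map X.obj)
      (L₂ := (X.m a a' :: (Γ ++ Δ ++ x)).map X.obj) [] (Γ.map X.obj) (x.map X.obj)
      (by simp) (by simp) (by simp) (by simp) (X.map k) (X.φ a a') (X.map g)
    refine (congrArg (fun k => X.map k hL') h₁).trans ?_
    refine (X.map_sub_θ (Γ ++ Δ ++ x) (by grind) _ _).trans ?_
    refine (congrArg (fun k => D.sub [] ((Γ ++ Δ ++ x).map X.obj) rfl rfl k (X.φ a a'))
      (ih (X.m a a') x d k (by grind) (by grind [SubOK]))).trans ?_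
    refine (D.sub_congr rfl (by simp) _ _ _ _ _).trans (h₂.symm.trans ?_)
    refine congrArg (fun k => D.sub ((a :: a' :: Γ).map X.obj) (x.map X.obj) (by simp) (by simp) k
      (X.map g)) ?_
    exact (D.sub_congr rfl (by simp) _ _ _ _ _).trans
      (X.map_sub_θ (Γ ++ c :: x) (by grind [SubOK]) k _).symm

/-! ### Preservation of all substitutions -/

/-- Substitution of `g` is preserved. -/
def Preserves {Δ : List C.Obj} (g : C.Hom Δ c) (hΔ : P → Δ.length ≤ 4) : Prop :=
  ∀ Γ₁, X.PreservesAt g hΔ Γ₁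

variable {X} in
lemma Preserves.map_sub {Δ : List C.Obj} {g : C.Hom Δ c} {hΔ : P → Δ.length ≤ 4}
    (hg : X.Preserves g hΔ) {L L' : List C.Obj} (Γ₁ Γ₂ : List C.Obj) (eL : L = Γ₁ ++ c :: Γ₂)
    (eL' : L' = Γ₁ ++ Δ ++ Γ₂) (h : C.Hom L d) (hL' : P → L'.length ≤ 4) (s) :
    X.map (C.sub Γ₁ Γ₂ eL eL' h g s) hL' =
      D.sub (Γ₁.map X.obj) (Γ₂.map X.obj) (by simp [eL]) (by simp [eL']) (X.map h) (X.map g hΔ)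
        (by simpa using s) := by
  subst eL eL'
  exact hg Γ₁ Γ₂ d h hL' s

lemma preserves_unary (p : C.Hom [a] c) : X.Preserves p (by simp)
  | [] => X.preservesAt_nil_unary p
  | a :: Γ => X.preservesAt_cons p (by simp) (fun a => X.preservesAt_singleton_unary a p) a Γ

lemma preserves_θ (a b : C.Obj) : X.Preserves (X.θ a b) (by simp)
  | [] => X.preservesAt_nil_θ a b
  | c :: Γ => X.preservesAt_cons _ (by simp) (fun c => X.preservesAt_singleton_θ c a b) c Γ

lemma preserves_u : X.Preserves X.u (by simp)
  | [] => X.preservesAt_nil_u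
  | a :: Γ => X.preservesAt_cons _ (by simp) X.preservesAt_singleton_u a Γ

variable {X} in
-- Associativity in `C` and in `D` splits substitution of `k ∘₁ f` into substitutions of `k` and of
-- `f`. The hypothesis `hs` says that whenever the composite may be substituted, so may its factors,
-- and the associativity law applies.
lemma Preserves.sub {x E : List C.Obj} {k : C.Hom (b :: x) c} {f : C.Hom E b}
    {hx : P → (b :: x).length ≤ 4} {hE : P → E.length ≤ 4} (hk : X.Preserves k hx)
    (hf : X.Preserves f hE) (s : P → SubOK (x.length + 1) E.length)
    (hs : P → ∀ n, SubOK n (E.length + x.length) → SubOK n (x.length + 1) ∧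
      SubOK (n + x.length) E.length ∧ AssocOK n (x.length + 1) E.length)
    (h₀ : P → (E ++ x).length ≤ 4) :
    X.Preserves (C.sub [] x rfl rfl k f s : C.Hom (E ++ x) c) h₀ := by
  intro Γ₁ Γ₂ d h hL' s'
  have hs' : P → _ := fun hP => hs hP _ (List.length_append (as := E) ▸ s' hP)
  -- If `f` is nullary the intermediate map has one more variable than the result, so `hL'` does not
  -- suffice; the bound is read off from `SubOK`.
  have hb : P → (Γ₁ ++ (b :: x) ++ Γ₂).length ≤ 4 := fun hP => by
    have := (hs' hP).2.1.le_left
    simp at *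
    omega
  have h₁ := C.sub_assoc (K := Γ₁ ++ (E ++ x) ++ Γ₂) Γ₁ Γ₂ [] x rfl rfl rfl rfl rfl h k f s s'
    (by grind) (by grind) (by grind)
  have h₂ := D.sub_assoc (K := (Γ₁ ++ (E ++ x) ++ Γ₂).map X.obj) (M' := (E ++ x).map X.obj)
    (L' := (Γ₁ ++ (b :: x) ++ Γ₂).map X.obj) (Γ₁.map X.obj) (Γ₂.map X.obj) [] (x.map X.obj)
    (by simp) rfl (by simp) (by simp) (by simp) (X.map h) (X.map k) (X.map f) (by grind) (by grind)
    (by grind) (by grind) (by grind)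
  refine (congrArg (fun k => X.map k hL') h₁).trans ?_
  refine (hf.map_sub _ _ _ _ _ hL' _).trans ?_
  refine (congrArg (fun k => (D.sub ((Γ₁ ++ []).map X.obj) ((x ++ Γ₂).map X.obj) (by simp)
    (by simp) k (X.map f) (by grind) : D.Hom ((Γ₁ ++ (E ++ x) ++ Γ₂).map X.obj) _))
    (hk.map_sub Γ₁ Γ₂ rfl rfl h hb (by grind))).trans ?_
  refine (D.sub_congr (by simp) (by simp) _ _ _ _ _).trans (h₂.symm.trans ?_)
  exact congrArg (fun g => D.sub (Γ₁.map X.obj) (Γ₂.map X.obj) (by simp) (by simp) (X.map h) g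
    (by grind)) (hf.map_sub [] x rfl rfl k h₀ s).symm

lemma preserves_cons (x : List C.Obj) (g : C.Hom (a :: x) c) (hx : P → (a :: x).length ≤ 4) :
    X.Preserves g hx := by
  induction x generalizing a with
  | nil => exact X.preserves_unary g
  | cons b x ih =>
    obtain ⟨k, rfl⟩ := X.exists_factor x (by grind) g
    -- In the short case an `(x.length + 2)`-ary map can be substituted into an `n`-ary one only if
    -- `n + x.length ≤ 3`, exactly what is needed to substitute `θ` afterwards.
    exact (ih k (by grind)).sub (X.preserves_θ a b) (by grind [SubOK])
      (by grind [SubOK, AssocOK]) hx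

lemma preserves_nil (g : C.Hom [] c) : X.Preserves g (by simp) := by
  obtain ⟨k, rfl⟩ := X.exists_factor_nil g
  exact (X.preserves_unary k).sub X.preserves_u (by grind [SubOK]) (by grind [SubOK, AssocOK])
    (by simp)

lemma preserves : ∀ {L : List C.Obj} (g : C.Hom L c) (hL : P → L.length ≤ 4), X.Preserves g hL
  | [], g, _ => X.preserves_nil g
  | _ :: x, g, hL => X.preserves_cons x g hL

/-- The extension of generating data to multimaps is unique. -/
lemma eq_map (M : ∀ {L : List C.Obj} {d : C.Obj} (_ : C.Hom L d) (_ : P → L.length ≤ 4),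
      D.Hom (L.map X.obj) (X.obj d))
    (h₁ : ∀ {a d} (p : C.Hom [a] d), M p (by simp) = X.map₁ p)
    (hu : ∀ {d} (k : C.Hom [X.i] d), M (C.sub [] [] rfl rfl k X.u : C.Hom [] d) (by simp) =
      D.sub [] [] rfl rfl (X.map₁ k) X.v)
    (hθ : ∀ {a b d} (x : List C.Obj) (hx : P → x.length ≤ 2) (k : C.Hom (X.m a b :: x) d),
      M (C.sub [] x rfl rfl k (X.θ a b) : C.Hom (a :: b :: x) d) (by grind) =
        D.sub [] (x.map X.obj) rfl rfl (M k (by grind)) (X.φ a b)) :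
    ∀ {L : List C.Obj} {d : C.Obj} (h : C.Hom L d) (hL : P → L.length ≤ 4), M h hL = X.map h hL
  | [], d, h, _ => by
    obtain ⟨k, rfl⟩ := X.exists_factor_nil h
    exact (hu k).trans (X.map_sub_u k _).symm
  | a :: x, d, h, hx => by
    induction x generalizing a with
    | nil => exact h₁ h
    | cons b x ih =>
      obtain ⟨k, rfl⟩ := X.exists_factor x (by grind) h
      refine (hθ x (by grind) k).trans (Eq.trans ?_ (X.map_sub_θ x (by grind) k _).symm)
      exact congrArg (fun k => D.sub [] (x.map X.obj) rfl rfl k (X.φ a b)) (ih _ k (by grind))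

end GeneratingData
end BoundedMulticategory

/-! ### The multimaps of a lax monoidal functor -/

namespace LaxMonoidalFunctor

open ShortMulticategory ShortMulticategory.Classifiers

variable {C D : ShortMulticategory.{v, u}} {R : C.Classifiers} {S : D.Classifiers}
  (G : LaxMonoidalFunctor R.skew S.skew) {a b c a' b' : C.Obj}

/-- The action on objects of the category of unary maps. -/
def onObj (a : C.Obj) : D.Obj := G.functor.obj a

/-- The action on unary maps. -/
def onUnary (f : a ⟶ b) : G.onObj a ⟶ G.onObj b := G.functor.map (X := a) (Y := b) f

/-- The nullary map of the unit constraint. -/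
def nullary : D.M0 (G.onObj R.i) := post S.u (c := G.onObj R.i) G.f₀

/-- The binary maps of the tensor constraint. -/
def binary (a b : C.Obj) : D.M2 (G.onObj a) (G.onObj b) (G.onObj (R.m a b)) :=
  post (S.θ (G.onObj a) (G.onObj b)) (c := G.onObj (R.m a b)) (G.f₂ a b)

lemma onUnary_id (a : C.Obj) : G.onUnary (𝟙 a) = 𝟙 (G.onObj a) := G.functor.map_id a

lemma onUnary_comp (f : a ⟶ b) (g : b ⟶ c) :
    G.onUnary (f ≫ g) = G.onUnary f ≫ G.onUnary g :=
  G.functor.map_comp (X := a) (Y := b) (Z := c) f g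

/-- Naturality of `f₂`, transposed along the classifier of `D`. -/
lemma pre_binary (f : a ⟶ a') (g : b ⟶ b') :
    pre22 (pre21 (G.binary a' b') (G.onUnary f)) (G.onUnary g) =
      post (G.binary a b) (G.onUnary (R.tensorHom f g)) := by
  have h := congrArg (post (S.θ (G.onObj a) (G.onObj b)) (c := G.onObj (R.m a' b')))
    (G.f₂_naturality (a := a) (b := b) (a' := a') (b' := b') f g)
  exact (S.post_post_tensorHom (G.onUnary f) (G.onUnary g) _).symm.trans
    (h.trans (post_comp _ _ _).symm)

lemma pre21_binary (f : a ⟶ a') (b : C.Obj) :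
    pre21 (G.binary a' b) (G.onUnary f) =
      post (G.binary a b) (G.onUnary (R.tensorHom f (𝟙 b))) := by
  rw [← pre_binary, onUnary_id, pre22_id]

lemma pre22_binary (a : C.Obj) (g : b ⟶ b') :
    pre22 (G.binary a b') (G.onUnary g) =
      post (G.binary a b) (G.onUnary (R.tensorHom (𝟙 a) g)) := by
  rw [← pre_binary, onUnary_id, pre21_id]

/-- The associativity axiom, transposed along the classifiers of `D`. -/
lemma s221_binary (a b c : C.Obj) :
    s221 (post (G.binary (R.m a b) c) (G.onUnary (R.assoc a b c))) (G.binary a b) =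
      s222 (G.binary a (R.m b c)) (G.binary b c) := by
  -- The constraints of `G` are morphisms of `S.skew`, whose category is that of `D` only by
  -- unfolding; with variables typed in `D` in their place, the rewriting lemmas apply.
  have key : ∀ (p : S.m (G.onObj a) (G.onObj b) ⟶ G.onObj (R.m a b))
      (q : S.m (G.onObj (R.m a b)) (G.onObj c) ⟶ G.onObj (R.m (R.m a b) c))
      (r : S.m (G.onObj b) (G.onObj c) ⟶ G.onObj (R.m b c))
      (t : S.m (G.onObj a) (G.onObj (R.m b c)) ⟶ G.onObj (R.m a (R.m b c))),
      S.tensorHom p (𝟙 (G.onObj c)) ≫ q ≫ G.onUnary (R.assoc a b c) =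
        S.assoc (G.onObj a) (G.onObj b) (G.onObj c) ≫ S.tensorHom (𝟙 (G.onObj a)) r ≫ t →
      s221 (post (post (S.θ _ _) q) (G.onUnary (R.assoc a b c))) (post (S.θ _ _) p) =
        s222 (post (S.θ _ _) t) (post (S.θ _ _) r) := by
    intro p q r t h
    rw [post_comp, s221_post, ← pre22_id (pre21 _ p), ← post_post_tensorHom, h, ← post_comp,
      ← post_s221, s221_assoc, post_s222, post_post_tensorHom, pre21_id, s222_post]
  exact key _ _ _ _ (G.associativity a b c)

/-- The left unit axiom gives the equation only after composition with the image of `λ`. This image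
is invertible, since `θ ∘₁ u` is inverse to `λ`, and so can be cancelled. -/
lemma s201_binary (a : C.Obj) :
    G.onUnary (s201 (R.θ R.i a) R.u) = s201 (G.binary R.i a) G.nullary := by
  have key : ∀ (p : S.i ⟶ G.onObj R.i)
      (q : S.m (G.onObj R.i) (G.onObj a) ⟶ G.onObj (R.m R.i a)),
      S.tensorHom p (𝟙 (G.onObj a)) ≫ q ≫ G.onUnary (R.leftUnit a) = S.leftUnit (G.onObj a) →
      s201 (post (S.θ _ _) q) (post S.u p) ≫ G.onUnary (R.leftUnit a) = 𝟙 (G.onObj a) := by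
    intro p q h
    rw [s201_comp, post_comp, s201_post, ← pre22_id (pre21 _ p), ← post_post_tensorHom, h,
      s201_leftUnit]
  have h₁ := key _ _ (G.left_unitality a)
  have h₂ : G.onUnary (s201 (R.θ R.i a) R.u) ≫ G.onUnary (R.leftUnit a) = 𝟙 (G.onObj a) := by
    rw [← onUnary_comp, s201_comp, s201_leftUnit, onUnary_id]
  have h₃ : G.onUnary (R.leftUnit a) ≫ G.onUnary (s201 (R.θ R.i a) R.u) = 𝟙 _ := by
    rw [← onUnary_comp, ← onUnary_id]
    refine congrArg G.onUnary (extUnit ?_)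
    rw [← post_comp, ← s201_comp, s201_leftUnit, Category.id_comp, post_id]
  calc G.onUnary (s201 (R.θ R.i a) R.u)
      = (s201 (G.binary R.i a) G.nullary ≫ G.onUnary (R.leftUnit a)) ≫
          G.onUnary (s201 (R.θ R.i a) R.u) :=
        ((congrArg (· ≫ G.onUnary (s201 (R.θ R.i a) R.u)) h₁).trans (Category.id_comp _)).symm
    _ = _ := by rw [Category.assoc, h₃, Category.comp_id]

lemma s202_binary (a : C.Obj) :
    G.onUnary (s202 (R.θ a R.i) R.u) = s202 (G.binary a R.i) G.nullary := by
  have key : ∀ (p : S.i ⟶ G.onObj R.i)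
      (q : S.m (G.onObj a) (G.onObj R.i) ⟶ G.onObj (R.m a R.i)),
      S.rightUnit (G.onObj a) ≫ S.tensorHom (𝟙 (G.onObj a)) p ≫ q = G.onUnary (R.rightUnit a) →
      G.onUnary (R.rightUnit a) = s202 (post (S.θ _ _) q) (post S.u p) := by
    intro p q h
    rw [← h, rightUnit, s202_comp, post_post_tensorHom, pre21_id, s202_post]
  exact key _ _ (G.right_unitality a)

end LaxMonoidalFunctor

/-! ### Extension of lax monoidal functors to multimaps -/

namespace LaxMonoidalFunctor

open ShortMulticategory ShortMulticategory.Classifiers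

section Short

variable {C D : ShortMulticategory.{v, u}} {R : C.Classifiers} {S : D.Classifiers}
  (G : LaxMonoidalFunctor R.skew S.skew)

/-- The generating data for short multicategories of a lax monoidal functor. -/
def shortData : (BoundedMulticategory.ofShort C).GeneratingData
    (BoundedMulticategory.ofShort D) where
  i := R.i
  u := fun _ => R.u
  m := R.m
  θ a b := fun _ => R.θ a b
  bij_u d := ⟨fun _ _ h => funext fun _ => (R.bij_u d).1 (congrFun h (Nat.zero_le 4)), fun f => by
    obtain ⟨g, hg⟩ := (R.bij_u d).2 (f (Nat.zero_le 4))
    exact ⟨fun _ => g, funext fun _ => hg⟩⟩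
  bij_θ a b x hx d :=
    have hx : x.length ≤ 2 := hx trivial
    ⟨fun _ _ h => funext fun _ =>
        (R.θ_universal a b x hx d).1 (congrFun h (Nat.add_le_add_right hx 2)),
      fun f => by
        obtain ⟨g, hg⟩ := (R.θ_universal a b x hx d).2 (f (Nat.add_le_add_right hx 2))
        exact ⟨fun _ => g, funext fun _ => hg⟩⟩
  obj := G.onObj
  map₁ p := fun _ => G.onUnary (p (by decide : 1 ≤ 4))
  map₁_id a := funext fun _ => G.onUnary_id a
  map₁_comp q p := funext fun _ => G.onUnary_comp (p (by decide : 1 ≤ 4)) (q (by decide : 1 ≤ 4))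
  v := fun _ => G.nullary
  φ a b := fun _ => G.binary a b
  tensor_left (b : C.Obj) p := ⟨fun _ => R.tensorHom (p (by decide : 1 ≤ 4)) (𝟙 b),
    funext fun _ => ((R.post_tensorHom _ _).trans (pre22_id _)).symm,
    funext fun _ => G.pre21_binary _ b⟩
  tensor_right (a : C.Obj) _ _ p := ⟨fun _ => R.tensorHom (𝟙 a) (p (by decide : 1 ≤ 4)),
    funext fun _ => ((R.post_tensorHom _ _).trans
      (congrArg (fun k => pre22 k _) (pre21_id _))).symm,
    funext fun _ => G.pre22_binary a _⟩
  assoc a b c := ⟨fun _ => R.assoc a b c, funext fun _ => (R.s221_assoc a b c).symm,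
    funext fun _ => (G.s221_binary a b c).symm⟩
  unit_left a := funext fun _ => G.s201_binary a
  unit_right a := funext fun _ => G.s202_binary a

/-- The morphism of short multicategories of a lax monoidal functor. -/
noncomputable def extendShort : ShortMultifunctor C D where
  obj := G.onObj
  map {L L' b hL hL'} e h := cast (by subst e; rfl)
    (G.shortData.map (L := L) (fun _ => h) (fun _ => hL) ((List.length_map _).trans_le hL))
  map_id a := congrFun (G.shortData.map₁_id a) (by decide : 1 ≤ 4)
  map_sub {L Δ L' M Θ M' b c hL hΔ hL' hM hΘ hM'} Γ₁ Γ₂ eL eL' s eM eΘ eM' g f := by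
    subst eM eΘ eM'
    exact congrFun ((G.shortData.preserves (L := Δ) (fun _ => f) (fun _ => hΔ)).map_sub Γ₁ Γ₂ eL eL'
      (fun _ => g) (fun _ => hL') (fun _ => s)) hM'

end Short

section Multi

variable {C D : Multicategory.{v, u}} {R : C.Classifiers} {S : D.Classifiers}
  (G : LaxMonoidalFunctor R.skew S.skew)

/-- The lax monoidal functor between the skew monoidal categories of the short multicategories. -/
abbrev toShort : LaxMonoidalFunctor R.toShort.skew S.toShort.skew := G

/-- The generating data for multicategories of a lax monoidal functor. -/
def multiData : (BoundedMulticategory.ofMulti C).GeneratingData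
    (BoundedMulticategory.ofMulti D) where
  i := R.m []
  u := R.θ []
  m a b := R.m [a, b]
  θ a b := R.θ [a, b]
  bij_u d := R.universal [] [] d
  bij_θ a b x _ d := R.universal [a, b] x d
  obj := G.toShort.onObj
  map₁ p := G.toShort.onUnary p
  map₁_id a := G.toShort.onUnary_id a
  map₁_comp q p := G.toShort.onUnary_comp p q
  v := G.toShort.nullary
  φ a b := G.toShort.binary a b
  tensor_left (b : C.Obj) p := ⟨R.toShort.tensorHom p (𝟙 b),
    ((R.toShort.post_tensorHom _ _).trans (pre22_id _)).symm, G.toShort.pre21_binary _ b⟩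
  tensor_right (a : C.Obj) _ _ p := ⟨R.toShort.tensorHom (𝟙 a) p,
    ((R.toShort.post_tensorHom _ _).trans (congrArg (fun k => pre22 k _) (pre21_id _))).symm,
    G.toShort.pre22_binary a _⟩
  assoc a b c := ⟨R.toShort.assoc a b c, (R.toShort.s221_assoc a b c).symm,
    (G.toShort.s221_binary a b c).symm⟩
  unit_left a := G.toShort.s201_binary a
  unit_right a := G.toShort.s202_binary a

/-- The multifunctor of a lax monoidal functor. -/
noncomputable def extend : Multifunctor C D where
  obj := G.toShort.onObj
  map {L L' b} e h := cast (by subst e; rfl) (G.multiData.map (L := L) h False.elim)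
  map_id a := G.multiData.map₁_id a
  map_sub {L Δ L' M Θ M' b c} Γ₁ Γ₂ eL eL' eM eΘ eM' g f := by
    subst eM eΘ eM'
    exact (G.multiData.preserves (L := Δ) f False.elim).map_sub Γ₁ Γ₂ eL eL' g False.elim
      False.elim

end Multi

section Short

variable {C D : ShortMulticategory.{v, u}} {R : C.Classifiers} {S : D.Classifiers}

/-- The constraints are determined by their composites with the classifiers, and the extension sends
`u` and `θ` to precisely those composites. -/
lemma lax_extendShort (G : LaxMonoidalFunctor R.skew S.skew) : G.extendShort.lax R S = G :=
  LaxMonoidalFunctor.ext rfl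
    (heq_of_eq (ext₀ (R := S) ((G.extendShort.post_lax₀ R S).trans
      (congrFun G.shortData.map_u (Nat.zero_le 4)))))
    (heq_of_eq (funext fun a => funext fun b => ext₂ (R := S)
      ((G.extendShort.post_lax₂ R S a b).trans
        (congrFun (G.shortData.map_θ a b) (by decide : 2 ≤ 4)))))

/-- A morphism of short multicategories satisfies the equations characterizing the extension of its
own lax structure, so uniqueness (`eq_map`) applies. -/
lemma extendShort_lax (F : ShortMultifunctor C D) : (F.lax R S).extendShort = F := by
  refine ShortMultifunctor.ext rfl (heq_of_eq ?_)
  funext L L' b hL hL' e h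
  subst e
  exact (congrFun ((F.lax R S).shortData.eq_map
    (M := fun {L d} (h : ∀ hL : L.length ≤ 4, C.Hom L hL d) hL hL' =>
      (F.map rfl (h (hL trivial)) : D.Hom (L.map F.obj) hL' (F.obj d)))
    (fun p => rfl)
    (fun {d} k => funext fun _ => (F.map0_post R.u (k (by decide : 1 ≤ 4))).trans
      (congrArg (fun g => post g (F.map1 (k (by decide : 1 ≤ 4)))) (F.post_lax₀ R S).symm))
    (fun {a b d} x hx k => funext fun hL' => (F.map_sub [] x rfl rfl
      (subOK_classifier (Or.inr rfl) (hx trivial)) rfl rfl rfl _ (R.θ a b)).trans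
        (congrArg (fun g : D.M2 (F.obj a) (F.obj b) (F.obj (R.m a b)) =>
          D.sub [] (x.map F.obj) rfl rfl _ _ g) (F.post_lax₂ R S a b).symm))
    (L := L) (fun _ => h) (fun _ => hL)) hL').symm

end Short

section Multi

variable {C D : Multicategory.{v, u}} {R : C.Classifiers} {S : D.Classifiers}

lemma lax_extend (G : LaxMonoidalFunctor R.skew S.skew) : G.extend.lax R S = G :=
  LaxMonoidalFunctor.ext rfl
    (heq_of_eq (ext₀ (R := S.toShort)
      (((forgetShort.map G.extend).post_lax₀ R.toShort S.toShort).trans G.multiData.map_u)))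
    (heq_of_eq (funext fun a => funext fun b => ext₂ (R := S.toShort)
      (((forgetShort.map G.extend).post_lax₂ R.toShort S.toShort a b).trans
        (G.multiData.map_θ a b))))

lemma extend_lax (F : Multifunctor C D) : (F.lax R S).extend = F := by
  refine Multifunctor.ext rfl (heq_of_eq ?_)
  funext L L' b e h
  subst e
  exact ((F.lax R S).multiData.eq_map
    (M := fun {L d} (h : C.Hom L d) _ => (F.map rfl h : D.Hom (L.map F.obj) (F.obj d)))
    (fun p => rfl)
    (fun {d} k => ((forgetShort.map F).map0_post (R.θ []) k).trans
      (congrArg (fun g => post (C := forgetShort.obj D) (L := []) (hL := Nat.zero_le 4) g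
        ((forgetShort.map F).map1 k)) ((forgetShort.map F).post_lax₀ R.toShort S.toShort).symm))
    (fun {a b d} x hx k => (F.map_sub [] x rfl rfl rfl rfl rfl _ (R.θ [a, b])).trans
        (congrArg (fun g : D.Hom [F.obj a, F.obj b] (F.obj (R.m [a, b])) =>
          D.sub [] (x.map F.obj) rfl rfl _ g)
            ((forgetShort.map F).post_lax₂ R.toShort S.toShort a b).symm))
    (L := L) h False.elim).symm

end Multi

end LaxMonoidalFunctor

/-! ### The equivalences -/

namespace ShortMulticategory

/-- Different choices of classifiers give isomorphic skew monoidal categories. -/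
noncomputable def Classifiers.skewIso {C : ShortMulticategory.{v, u}} (R S : C.Classifiers) :
    R.skew ≅ S.skew where
  hom := (ShortMultifunctor.idm C).lax R S
  inv := (ShortMultifunctor.idm C).lax S R
  hom_inv_id := ((ShortMultifunctor.idm C).lax_comp R S (ShortMultifunctor.idm C) R).symm.trans
    ((congrArg (fun F : ShortMultifunctor C C => F.lax R R) (Category.id_comp (𝟙 C))).trans
      (ShortMultifunctor.lax_id R))
  inv_hom_id := ((ShortMultifunctor.idm C).lax_comp S R (ShortMultifunctor.idm C) S).symm.trans
    ((congrArg (fun F : ShortMultifunctor C C => F.lax S S) (Category.id_comp (𝟙 C))).trans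
      (ShortMultifunctor.lax_id S))

end ShortMulticategory

lemma ShortMultifunctor.lax_injective {C D : ShortMulticategory.{v, u}} (R : C.Classifiers)
    (S : D.Classifiers) :
    Function.Injective (fun F : ShortMultifunctor C D => F.lax R S) :=
  Function.LeftInverse.injective (g := LaxMonoidalFunctor.extendShort)
    LaxMonoidalFunctor.extendShort_lax

lemma Multifunctor.lax_injective {C D : Multicategory.{v, u}} (R : C.Classifiers)
    (S : D.Classifiers) : Function.Injective (fun F : Multifunctor C D => F.lax R S) :=
  Function.LeftInverse.injective (g := LaxMonoidalFunctor.extend)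
    LaxMonoidalFunctor.extend_lax

/-- The skew monoidal category of the multicategory of a left normal skew monoidal category `V` is
isomorphic to `V`, for any choice of classifiers. -/
noncomputable def SkewMonoidalCategory.LeftNormal.classifiersIso {V : SkewMonoidalCategory.{v, u}}
    (hV : V.LeftNormal) (R : (forgetShort.obj V.multicategory).Classifiers) : R.skew ≅ V :=
  (R.skewIso hV.shortClassifiers).trans hV.skewIso.symm

/-! ### Full faithfulness and essential surjectivity -/

instance : K.{v, u}.Faithful where
  map_injective {C D _ _} h := ObjectProperty.hom_ext _
    (ShortMultifunctor.lax_injective C.property.classifiers D.property.classifiers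
      (congrArg (·.hom) h))

instance : K.{v, u}.Full where
  map_surjective {_ _} G := ⟨ObjectProperty.homMk (LaxMonoidalFunctor.extendShort G.hom),
    ObjectProperty.hom_ext _ (LaxMonoidalFunctor.lax_extendShort G.hom)⟩

/-- `K` uses arbitrarily chosen classifiers, not those of `shortClassifiers`; `classifiersIso`
bridges the two choices. -/
instance : K.{v, u}.EssSurj where
  mem_essImage V := ⟨⟨forgetShort.obj V.obj.multicategory,
    forgetShort_leftRepresentable V.property.leftRepresentable⟩,
    ⟨ObjectProperty.isoMk _ (V.property.classifiersIso _)⟩⟩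

instance : Kcl.{v, u}.Faithful where
  map_injective {C D _ _} h := ObjectProperty.hom_ext _
    (ShortMultifunctor.lax_injective C.property.1.classifiers D.property.1.classifiers
      (congrArg (·.hom) h))

instance : Kcl.{v, u}.Full where
  map_surjective {_ _} G := ⟨ObjectProperty.homMk (LaxMonoidalFunctor.extendShort G.hom),
    ObjectProperty.hom_ext _ (LaxMonoidalFunctor.lax_extendShort G.hom)⟩

instance : Kcl.{v, u}.EssSurj where
  mem_essImage V := ⟨⟨forgetShort.obj V.obj.multicategory,
    forgetShort_leftRepresentable V.property.1.leftRepresentable,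
    forgetShort_closed V.property.2.multicategory⟩,
    ⟨ObjectProperty.isoMk _ (V.property.1.classifiersIso _)⟩⟩

instance : Tcl.{v, u}.Faithful where
  map_injective {C D _ _} h := ObjectProperty.hom_ext _
    (Multifunctor.lax_injective C.property.1.classifiers D.property.1.classifiers
      (congrArg (·.hom) h))

instance : Tcl.{v, u}.Full where
  map_surjective {_ _} G := ⟨ObjectProperty.homMk (LaxMonoidalFunctor.extend G.hom),
    ObjectProperty.hom_ext _ (LaxMonoidalFunctor.lax_extend G.hom)⟩

instance : Tcl.{v, u}.EssSurj where
  mem_essImage V := ⟨⟨V.obj.multicategory, V.property.1.leftRepresentable,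
    V.property.2.multicategory⟩,
    ⟨ObjectProperty.isoMk _ (V.property.1.classifiersIso
      (Multicategory.LeftRepresentable.classifiers _).toShort)⟩⟩

instance : K.{v, u}.IsEquivalence where
instance : Kcl.{v, u}.IsEquivalence where
instance : Tcl.{v, u}.IsEquivalence where

/-- The triangle commutes up to the choice of classifiers. -/
noncomputable def triangleIso : Ucl.{v, u} ⋙ Kcl ≅ Tcl :=
  NatIso.ofComponents
    (fun C => ObjectProperty.isoMk _ (ShortMulticategory.Classifiers.skewIso
      (forgetShort_leftRepresentable C.property.1).classifiers C.property.1.classifiers.toShort))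
    (fun {C D} F => ObjectProperty.hom_ext _ <| by
      -- By functoriality of `lax` both composites are the lax structure of `Φ` formed with `R` at
      -- the source and `S'` at the target.
      have h (R : (forgetShort.obj C.obj).Classifiers) (S : (forgetShort.obj D.obj).Classifiers)
          (R' : (forgetShort.obj C.obj).Classifiers) (S' : (forgetShort.obj D.obj).Classifiers)
          (Φ : ShortMultifunctor (forgetShort.obj C.obj) (forgetShort.obj D.obj)) :
          (Φ.lax R S).comp ((ShortMultifunctor.idm _).lax S S') =
            ((ShortMultifunctor.idm _).lax R R').comp (Φ.lax R' S') :=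
        (Φ.lax_comp R S _ S').symm.trans ((congrArg
          (fun Φ : ShortMultifunctor (forgetShort.obj C.obj) (forgetShort.obj D.obj) =>
            Φ.lax R S') ((Category.comp_id (X := forgetShort.obj C.obj) (Y := forgetShort.obj D.obj)
              Φ).trans (Category.id_comp (X := forgetShort.obj C.obj) (Y := forgetShort.obj D.obj)
              Φ).symm)).trans ((ShortMultifunctor.idm _).lax_comp R R' Φ S'))
      exact h _ _ _ _ (forgetShort.map F.hom))

instance : Ucl.{v, u}.IsEquivalence := by
  have : (Ucl.{v, u} ⋙ Kcl).IsEquivalence := Functor.isEquivalence_of_iso triangleIso.symm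
  exact Functor.isEquivalence_of_comp_right Ucl Kcl

end ShortMult

theorem mainTheorem3 :
    ShortMult.K.{v, u}.IsEquivalence ∧
    ShortMult.Kcl.{v, u} ⋙ ShortMult.inclSkew = ShortMult.inclShort ⋙ ShortMult.K ∧
    ShortMult.Kcl.{v, u}.IsEquivalence ∧
    ShortMult.Ucl.{v, u}.IsEquivalence ∧
    ShortMult.Tcl.{v, u}.IsEquivalence ∧
    ∃ e : ShortMult.Ucl.{v, u} ⋙ ShortMult.Kcl ≅ ShortMult.Tcl,
      ∀ C : ShortMult.MultiLRCl.{v, u}, (e.hom.app C).hom.functor = 𝟭 C.obj.Obj :=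
  -- `Kcl` is a lift of `K` to full subcategories, so the restriction holds definitionally. The
  -- components of `triangleIso` are lax structures on identity morphisms, whence the final `rfl`.
  ⟨inferInstance, rfl, inferInstance, inferInstance, inferInstance, ShortMult.triangleIso,
    fun _ => rfl⟩
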